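/- Let $M$ be a smooth manifold of dimension $n$, let $F$ be a Finsler structure on $M$: a function on the bundle $TM_0$ of nonzero tangent vectors which is positive, smooth, satisfies $F(x,\lambda v)=\lambda F(x,v)$ for $\lambda>0$, and for which $g_{ij}(x,v)=\frac12\frac{\partial^2F^2}{\partial v^i\partial v^j}$ is positive definite. Let $\pi\colon TM_0\to M$ be the projection, $\varrho=\pi_*\colon TTM_0\to\pi^*TM$, let $\nabla$ be the Cartan connection of $F$ (a connection on $\pi^*TM$), $\Omega$ its curvature, $\mu(\hat X)=\nabla_{\hat X}\mathbf v$ where $\mathbf v$ is the canonical section of $\pi^*TM$, and $\mathcal H_zTM=\ker\mu_z$ the horizontal space at $z\in TM_0$. Let $P(X,\mu(\hat Y))=\Omega(H\hat X,V\hat Y)$ be the $hv$-curvature, where $X=\varrho(\hat X)$ and $H$, $V$ denote horizontal and vertical parts, and let ${}^aP(X,Y)=\frac12(P(X,Y)-P(Y,X))$. For a real number $k\ge 0$ put $$\eta^k(\hat X,\hat Y)Z=k\{g(Y,Z)X-g(X,Z)Y\}+{}^aP(X,\mu(\hat Y))Z,\qquad \bar\Omega=\Omega-\eta^k,$$ where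 $X=\varrho(\hat X)$, $Y=\varrho(\hat Y)$, and for $z\in TM_0$ let $$N^k_z=\{\hat X\in\mathcal H_zTM:\ \bar\Omega(\hat X,\hat Y)=0\ \text{ for all } \hat Y\in\mathcal H_zTM\}.$$ Let $U\subseteq M$ be an open set on which the $k$-nullity spaces are well defined, that is, for each $x\in U$ the subspace $\varrho(N^k_z)\subseteq T_xM$ is the same for all $z\in\pi^{-1}(x)$; denote it by $\mathcal N^k_x$. Suppose that the index of $k$-nullity $\mu_k(x)=\dim\mathcal N^k_x$ is constant on $U$. Then the $k$-nullity distribution $x\mapsto\mathcal N^k_x$ on $U$ is involutive (the Lie bracket of two smooth vector fields tangent to it, given on an open subset of $U$, is again tangent to it) and completely integrable (every point of $U$ has a smooth chart, with domain inside $U$, that carries $\mathcal N^k$ to a constant field of subspaces, so that slices of the chart are integral manifolds). -/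

import Mathlib

set_option maxSynthPendingDepth 3

open scoped Manifold ContDiff

noncomputable section

namespace FinslerNullity

/-! ### Local computations

Coordinates `(x, v)` on the tangent bundle over a chart domain are points of `E × E`, and `f` is the
local expression of a Finsler structure. Vectors tangent to the tangent bundle are pairs `(a, b)`,
meaning `a` in the base directions `∂/∂x` and `b` in the fibre directions `∂/∂v`. -/

section Local

variable {E : Type*} [NormedAddCommGroup E] [NormedSpace ℝ E]
variable {G : Type*} [NormedAddCommGroup G] [NormedSpace ℝ G]

/-- The partial derivative in the base variable `x`. -/
def dBase (h : E × E → G) (p : E × E) : E →L[ℝ] G :=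
  (fderiv ℝ h p).comp (ContinuousLinearMap.inl ℝ E E)

/-- The partial derivative in the fibre variable `v`. -/
def dFibre (h : E × E → G) (p : E × E) : E →L[ℝ] G :=
  (fderiv ℝ h p).comp (ContinuousLinearMap.inr ℝ E E)

/-- The energy `F² / 2`. -/
def energy (f : E × E → ℝ) (p : E × E) : ℝ := f p ^ 2 / 2

/-- The fundamental tensor `g_{ij} = (1/2) ∂²F² / ∂vⁱ∂vʲ`, as the map `a ↦ g(a, ·)`. -/
def fundTensor (f : E × E → ℝ) (p : E × E) : E →L[ℝ] E →L[ℝ] ℝ :=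
  dFibre (dFibre (energy f)) p

/-- Raising an index: the inverse of `a ↦ g(a, ·)`. -/
def sharp (f : E × E → ℝ) (p : E × E) : (E →L[ℝ] ℝ) →L[ℝ] E :=
  (fundTensor f p).inverse

/-- The spray coefficients
`Gⁱ = (1/4) gⁱˡ (vʲ ∂²F²/∂xʲ∂vˡ - ∂F²/∂xˡ)`; geodesics satisfy `x'' + 2 G(x, x') = 0`. -/
def spray (f : E × E → ℝ) (p : E × E) : E :=
  (1 / 2 : ℝ) • sharp f p (dBase (dFibre (energy f)) p p.2 - dBase (energy f) p)

/-- The nonlinear connection `Nⁱⱼ = ∂Gⁱ/∂vʲ`. -/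
def nonlin (f : E × E → ℝ) (p : E × E) : E →L[ℝ] E :=
  dFibre (spray f) p

/-- The horizontal lift `a ↦ aʲ δⱼ`, where `δⱼ = ∂ⱼ - Nⁱⱼ ∂/∂vⁱ`. -/
def horLift (f : E × E → ℝ) (p : E × E) : E →L[ℝ] E × E :=
  (ContinuousLinearMap.id ℝ E).prod (-nonlin f p)

/-- The horizontal derivative of the fundamental tensor: `a, b, c ↦ aⁱ bʲ cˡ δᵢ g_{jl}`. -/
def horDerivFund (f : E × E → ℝ) (p : E × E) : E →L[ℝ] E →L[ℝ] E →L[ℝ] ℝ :=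
  (fderiv ℝ (fundTensor f) p).comp (horLift f p)

/-- `a, c, w ↦ (1/2) (δ_a g(c, w) + δ_c g(a, w) - δ_w g(a, c))`. -/
def christoffelLower (f : E × E → ℝ) (p : E × E) : E →L[ℝ] E →L[ℝ] E →L[ℝ] ℝ :=
  (1 / 2 : ℝ) • (horDerivFund f p + (horDerivFund f p).flip -
    ((ContinuousLinearMap.flipₗᵢ ℝ E E ℝ).toContinuousLinearEquiv :
      (E →L[ℝ] E →L[ℝ] ℝ) →L[ℝ] (E →L[ℝ] E →L[ℝ] ℝ)).comp (horDerivFund f p).flip)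

/-- The horizontal coefficients of the Cartan connection, `∇_{δⱼ} ∂ᵢ = *Γᵏᵢⱼ ∂ₖ`, where
`*Γᵏᵢⱼ = (1/2) gᵏˡ (δⱼ g_{il} + δᵢ g_{jl} - δₗ g_{ij})`. -/
def christoffel (f : E × E → ℝ) (p : E × E) : E →L[ℝ] E →L[ℝ] E :=
  (ContinuousLinearMap.compL ℝ E (E →L[ℝ] ℝ) E (sharp f p)).comp (christoffelLower f p)

/-- The Cartan tensor `Cᵏᵢⱼ = (1/2) gᵏˡ ∂g_{il}/∂vʲ`; it gives the vertical coefficients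
`∇_{∂/∂vʲ} ∂ᵢ = Cᵏᵢⱼ ∂ₖ` of the Cartan connection. -/
def cartanTensor (f : E × E → ℝ) (p : E × E) : E →L[ℝ] E →L[ℝ] E :=
  (1 / 2 : ℝ) • (ContinuousLinearMap.compL ℝ E (E →L[ℝ] ℝ) E (sharp f p)).comp
    (dFibre (fundTensor f) p)

/-- The connection form of the Cartan connection in the frame `∂ᵢ` of the pulled-back tangent
bundle: `∇_A Z = dZ(A) + ω(A) Z`. A vector `A = (a, b)` decomposes as the horizontal lift of `a`
plus the vertical vector `(0, b + N a)`. -/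
def connForm (f : E × E → ℝ) (p : E × E) : E × E →L[ℝ] E →L[ℝ] E :=
  (christoffel f p).comp (ContinuousLinearMap.fst ℝ E E) +
    (cartanTensor f p).comp
      (ContinuousLinearMap.snd ℝ E E + (nonlin f p).comp (ContinuousLinearMap.fst ℝ E E))

/-- `μ(A) = ∇_A 𝐯`, where `𝐯 = vⁱ∂ᵢ` is the canonical section. -/
def muMap (f : E × E → ℝ) (p : E × E) : E × E →L[ℝ] E :=
  ContinuousLinearMap.snd ℝ E E + (connForm f p).flip p.2

/-- The curvature `Ω(A, B) = ∇_A ∇_B - ∇_B ∇_A - ∇_{[A, B]}` of the Cartan connection,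
computed with constant coefficient extensions of `A` and `B`. -/
def curv (f : E × E → ℝ) (p A B : E × E) : E →L[ℝ] E :=
  fderiv ℝ (connForm f) p A B - fderiv ℝ (connForm f) p B A +
    (connForm f p A).comp (connForm f p B) - (connForm f p B).comp (connForm f p A)

/-- The `hv`-curvature `P(a, b) = Ω(H, V)`, with `H` the horizontal vector over `a` and `V` the
vertical vector such that `μ(V) = b`. -/
def hvCurv (f : E × E → ℝ) (p : E × E) (a b : E) : E →L[ℝ] E :=
  curv f p (horLift f p a) (0, b)

/-- The anti-symmetric part of the `hv`-curvature. -/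
def hvCurvAnti (f : E × E → ℝ) (p : E × E) (a b : E) : E →L[ℝ] E :=
  (1 / 2 : ℝ) • (hvCurv f p a b - hvCurv f p b a)

/-- `ηᵏ(A, B) Z = k (g(Y, Z) X - g(X, Z) Y) + ᵃP(X, μ(B)) Z`, where `X`, `Y` are the projections
of `A`, `B`. -/
def etaTensor (f : E × E → ℝ) (k : ℝ) (p A B : E × E) : E →L[ℝ] E :=
  k • ((fundTensor f p B.1).smulRight A.1 - (fundTensor f p A.1).smulRight B.1) +
    hvCurvAnti f p A.1 (muMap f p B)

/-- The modified curvature `Ω - ηᵏ`. -/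
def modCurv (f : E × E → ℝ) (k : ℝ) (p A B : E × E) : E →L[ℝ] E :=
  curv f p A B - etaTensor f k p A B

theorem curv_add (f : E × E → ℝ) (p A A' B : E × E) :
    curv f p (A + A') B = curv f p A B + curv f p A' B := by
  ext c
  simp only [curv, map_add, _root_.add_apply, _root_.sub_apply,
    ContinuousLinearMap.comp_apply]
  abel

theorem curv_smul (f : E × E → ℝ) (r : ℝ) (p A B : E × E) :
    curv f p (r • A) B = r • curv f p A B := by
  ext c
  simp only [curv, map_smul, _root_.add_apply, _root_.sub_apply,
    ContinuousLinearMap.comp_apply, _root_.smul_apply, smul_sub, smul_add]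

theorem curv_add_right (f : E × E → ℝ) (p A B B' : E × E) :
    curv f p A (B + B') = curv f p A B + curv f p A B' := by
  ext c
  simp only [curv, map_add, _root_.add_apply, _root_.sub_apply,
    ContinuousLinearMap.comp_apply]
  abel

theorem curv_smul_right (f : E × E → ℝ) (r : ℝ) (p A B : E × E) :
    curv f p A (r • B) = r • curv f p A B := by
  ext c
  simp only [curv, map_smul, _root_.add_apply, _root_.sub_apply,
    ContinuousLinearMap.comp_apply, _root_.smul_apply, smul_sub, smul_add]

theorem modCurv_add (f : E × E → ℝ) (k : ℝ) (p A A' B : E × E) :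
    modCurv f k p (A + A') B = modCurv f k p A B + modCurv f k p A' B := by
  have h : ∀ b : E, ((0, b) : E × E) = ContinuousLinearMap.inr ℝ E E b := fun _ => rfl
  ext c
  simp only [modCurv, etaTensor, hvCurvAnti, hvCurv, curv_add, curv_add_right, map_add, h,
    Prod.fst_add, _root_.add_apply, _root_.sub_apply,
    _root_.smul_apply, ContinuousLinearMap.smulRight_apply, smul_add, smul_sub,
    add_smul]
  abel

theorem modCurv_smul (f : E × E → ℝ) (k r : ℝ) (p A B : E × E) :
    modCurv f k p (r • A) B = r • modCurv f k p A B := by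
  have h : ∀ b : E, ((0, b) : E × E) = ContinuousLinearMap.inr ℝ E E b := fun _ => rfl
  ext c
  simp only [modCurv, etaTensor, hvCurvAnti, hvCurv, curv_smul, curv_smul_right, map_smul, h,
    Prod.smul_fst, _root_.add_apply, _root_.sub_apply,
    _root_.smul_apply, ContinuousLinearMap.smulRight_apply, smul_add, smul_sub,
    smul_smul, smul_eq_mul]
  module

/-- The space of the horizontal vectors `A` (those with `μ(A) = 0`) such that
`(Ω - ηᵏ)(A, B) = 0` for all horizontal `B`. -/
def horNullity (f : E × E → ℝ) (k : ℝ) (p : E × E) : Submodule ℝ (E × E) where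
  carrier := {A | muMap f p A = 0 ∧ ∀ B : E × E, muMap f p B = 0 → modCurv f k p A B = 0}
  zero_mem' := ⟨map_zero _, fun B _ => by simpa using modCurv_smul f k 0 p 0 B⟩
  add_mem' := fun {A A'} hA hA' => ⟨by rw [map_add, hA.1, hA'.1, add_zero], fun B hB => by
    rw [modCurv_add, hA.2 B hB, hA'.2 B hB, add_zero]⟩
  smul_mem' := fun r A hA => ⟨by rw [map_smul, hA.1, smul_zero], fun B hB => by
    rw [modCurv_smul, hA.2 B hB, smul_zero]⟩

end Local

section Manifold

variable {E : Type*} [NormedAddCommGroup E] [NormedSpace ℝ E]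
variable {M : Type*} [TopologicalSpace M] [ChartedSpace E M]

/-- A Finsler structure on `M`: a function on the tangent bundle of which only the values at nonzero
vectors matter. -/
structure IsFinsler [IsManifold 𝓘(ℝ, E) ∞ M] (F : TangentBundle 𝓘(ℝ, E) M → ℝ) : Prop where
  pos : ∀ (x : M) (v : TangentSpace 𝓘(ℝ, E) x), v ≠ 0 → 0 < F ⟨x, v⟩
  smooth : ContMDiffOn 𝓘(ℝ, E).tangent 𝓘(ℝ, ℝ) ∞ F {z | z.2 ≠ 0}
  homogeneous : ∀ (x : M) (v : TangentSpace 𝓘(ℝ, E) x) (c : ℝ), v ≠ 0 → 0 < c →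
    F ⟨x, c • v⟩ = c * F ⟨x, v⟩
  posDef : ∀ (x : M) (v w : E), v ≠ 0 → w ≠ 0 →
    0 < fderiv ℝ (fderiv ℝ (fun u : E => F ⟨x, u⟩ ^ 2 / 2)) v w w

/-- `ϱ(Nᵏ_z)`: the projection to the tangent space of `M` of the horizontal nullity space `Nᵏ_z` at
`z = (x, v)`, computed in the chart of the tangent bundle at `z`, which is the one induced by the
preferred chart of `M` at `x`. (A tangent space of `M` or of its tangent bundle is, by definition,
the model space `E` or `E × E`, through that preferred chart.) -/
def nullityAt [IsManifold 𝓘(ℝ, E) ∞ M] (F : TangentBundle 𝓘(ℝ, E) M → ℝ) (k : ℝ)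
    (z : TangentBundle 𝓘(ℝ, E) M) : Submodule ℝ (TangentSpace 𝓘(ℝ, E) z.proj) :=
  (horNullity (F ∘ (extChartAt 𝓘(ℝ, E).tangent z).symm) k
    (extChartAt 𝓘(ℝ, E).tangent z z)).map (LinearMap.fst ℝ E E)

/-- The `k`-nullity space at `x`: the vectors that lie in `ϱ(Nᵏ_z)` for every nonzero `z` over
`x`. -/
def nullitySpace [IsManifold 𝓘(ℝ, E) ∞ M] (F : TangentBundle 𝓘(ℝ, E) M → ℝ) (k : ℝ) (x : M) :
    Submodule ℝ (TangentSpace 𝓘(ℝ, E) x) :=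
  ⨅ (v : TangentSpace 𝓘(ℝ, E) x) (_ : v ≠ 0), nullityAt F k ⟨x, v⟩

/-- `ϱ(Nᵏ_z)` depends only on the base point `x` of `z`; it is then the `k`-nullity space at `x`. -/
def NullityWellDefinedAt [IsManifold 𝓘(ℝ, E) ∞ M] (F : TangentBundle 𝓘(ℝ, E) M → ℝ) (k : ℝ)
    (x : M) : Prop :=
  ∀ v : TangentSpace 𝓘(ℝ, E) x, v ≠ 0 → nullityAt F k ⟨x, v⟩ = nullitySpace F k x

/-- The index of `k`-nullity. -/
def nullityIndex [IsManifold 𝓘(ℝ, E) ∞ M] (F : TangentBundle 𝓘(ℝ, E) M → ℝ) (k : ℝ) (x : M) : ℕ :=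
  Module.finrank ℝ (nullitySpace F k x)

/-- A field of tangent subspaces is involutive on `U`: the Lie bracket of any two smooth vector
fields tangent to it, given on an open subset of `U`, is again tangent to it. -/
def IsInvolutiveOn [IsManifold 𝓘(ℝ, E) ∞ M]
    (D : (x : M) → Submodule ℝ (TangentSpace 𝓘(ℝ, E) x)) (U : Set M) : Prop :=
  ∀ V : Set M, IsOpen V → V ⊆ U → ∀ X Y : (x : M) → TangentSpace 𝓘(ℝ, E) x,
    ContMDiffOn 𝓘(ℝ, E) 𝓘(ℝ, E).tangent ∞ (fun x => (⟨x, X x⟩ : TangentBundle 𝓘(ℝ, E) M)) V →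
    ContMDiffOn 𝓘(ℝ, E) 𝓘(ℝ, E).tangent ∞ (fun x => (⟨x, Y x⟩ : TangentBundle 𝓘(ℝ, E) M)) V →
    (∀ x ∈ V, X x ∈ D x) → (∀ x ∈ V, Y x ∈ D x) →
    ∀ x ∈ V, VectorField.mlieBracket 𝓘(ℝ, E) X Y x ∈ D x

/-- A field of tangent subspaces is completely integrable on `U`: `U` is covered by smooth charts
which carry it to a constant field of subspaces `W` (its integral manifolds in such a chart are the
slices parallel to `W`). -/
def IsCompletelyIntegrableOn [IsManifold 𝓘(ℝ, E) ∞ M]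
    (D : (x : M) → Submodule ℝ (TangentSpace 𝓘(ℝ, E) x)) (U : Set M) : Prop :=
  ∀ x ∈ U, ∃ φ ∈ IsManifold.maximalAtlas 𝓘(ℝ, E) ∞ M, x ∈ φ.source ∧ φ.source ⊆ U ∧
    ∃ W : Submodule ℝ E, ∀ y ∈ φ.source, ∀ w : TangentSpace 𝓘(ℝ, E) y,
      w ∈ D y ↔ (mfderiv 𝓘(ℝ, E) 𝓘(ℝ, E) φ y w : E) ∈ W

end Manifold

end FinslerNullity

end

/-! Notation: R, P, Q are the hh-, hv- and vv-curvatures, C is the Cartan tensor, L the Landsberg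
tensor (the covariant derivative of C along the geodesic spray S), and R̄ = `modHH` is R minus its
constant curvature model. Since `μ` kills horizontal vectors, the ᵃP term of `η` drops out on them,
and a vector a lies in the nullity space at (x, v) exactly when R̄(a, ·) = 0 there
(`mem_map_horNullity_iff`).

Involutivity. Let X, Y be fields of nullity vectors with X ≠ 0 at x, and evaluate all tensors in the
direction v = X(x). There P(v, ·) = 0 and P(·, v) = 0, and the second Bianchi identity on X, Y, c
becomes R̄([X, Y], c) = -k g(v, v) (P(Y, c) - P(c, Y)). So the obstruction is k times the
antisymmetric part of P. It is removed as follows. (1) Always P(a, b) - P(b, a) = [L_a, C_b] + [C_a,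
L_b] (`hvCurvL_sub`), because Q = -[C, C]. (2) In a null direction ∇_S L = -k g(v, v) C
(`sprayDerivForm_landsberg`). Computing the spray derivative of (1) in two ways then gives [L_a,
L_b] = 0 (`opComm_landsberg`). (3) The vector u = ∇_X X is again null: R̄(b, c)u = 0 by
`modHH_geodesic`, and pair symmetry of R̄ in null directions turns this into R̄(u, ·) = 0
(`modHH_eq_zero_of_apply`). Direction independence makes u null in every direction. (4)
Differentiate [L_a, L_b] = 0 along the section X. The part along u vanishes, since the directions v
+ tu are null as well. The spray part is -k g(v, v) times (1), so k (P(a, b) - P(b, a)) = 0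
(`hvCurvL_symm_of_null`).

Integrability. In a chart and for a fixed v ≠ 0, the nullity spaces are kernels of the smooth family
y ↦ R̄ at (y, v), of constant rank, so the Frobenius theorem applies (`exists_chart_of_involutive`).
It is proved by choosing a commuting frame and straightening it with flows; smooth dependence on
parameters comes from the inverse function theorem on a space of continuous paths.

The nullity spaces are defined in the preferred chart at each point, so the transformation laws of
spray, connection and curvature are needed to compare them inside one chart (`IsChartChange`). -/

open Filter Topology

noncomputable section

namespace FinslerNullity

/-! ### Derivatives of operator valued maps; Bianchi identity for a connection form -/

section Calculus

variable {V : Type*} [NormedAddCommGroup V] [NormedSpace ℝ V]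
variable {E : Type*} [NormedAddCommGroup E] [NormedSpace ℝ E]
variable {G : Type*} [NormedAddCommGroup G] [NormedSpace ℝ G]
variable {H : Type*} [NormedAddCommGroup H] [NormedSpace ℝ H]

theorem differentiableAt_of_contDiffOn {S : Set V} (hS : IsOpen S) {h : V → G}
    (hh : ContDiffOn ℝ ∞ h S) {p : V} (hp : p ∈ S) : DifferentiableAt ℝ h p :=
  (hh.contDiffAt (hS.mem_nhds hp)).differentiableAt (by simp)

theorem contDiffOn_fderiv {S : Set V} (hS : IsOpen S) {h : V → G}
    (hh : ContDiffOn ℝ ∞ h S) : ContDiffOn ℝ ∞ (fderiv ℝ h) S :=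
  hh.fderiv_of_isOpen hS (by simp)

theorem differentiableAt_fderiv {S : Set V} (hS : IsOpen S) {h : V → G}
    (hh : ContDiffOn ℝ ∞ h S) {p : V} (hp : p ∈ S) : DifferentiableAt ℝ (fderiv ℝ h) p :=
  differentiableAt_of_contDiffOn hS (contDiffOn_fderiv hS hh) hp

theorem fderiv_fderiv_comm {S : Set V} (hS : IsOpen S) {h : V → G}
    (hh : ContDiffOn ℝ ∞ h S) {p : V} (hp : p ∈ S) (A B : V) :
    fderiv ℝ (fderiv ℝ h) p A B = fderiv ℝ (fderiv ℝ h) p B A :=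
  ((hh.contDiffAt (hS.mem_nhds hp)).isSymmSndFDerivAt (by simpa using (WithTop.coe_le_coe.2 (le_top : (2 : ℕ∞) ≤ ⊤)))).eq A B

theorem fderiv_congr_of_isOpen {S : Set V} (hS : IsOpen S) {h h' : V → G}
    (hh : ∀ q ∈ S, h q = h' q) {p : V} (hp : p ∈ S) : fderiv ℝ h p = fderiv ℝ h' p :=
  Filter.EventuallyEq.fderiv_eq (by filter_upwards [hS.mem_nhds hp] with q hq using hh q hq)

theorem fderiv_apply_apply {Φ : V → G →L[ℝ] H} {w : V → G} {p : V}
    (hΦ : DifferentiableAt ℝ Φ p) (hw : DifferentiableAt ℝ w p) (A : V) :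
    fderiv ℝ (fun q => Φ q (w q)) p A = fderiv ℝ Φ p A (w p) + Φ p (fderiv ℝ w p A) := by
  rw [fderiv_clm_apply hΦ hw]
  simp [add_comm]

theorem fderiv_apply_const {Φ : V → G →L[ℝ] H} {p : V}
    (hΦ : DifferentiableAt ℝ Φ p) (w : G) (A : V) :
    fderiv ℝ (fun q => Φ q w) p A = fderiv ℝ Φ p A w := by
  rw [fderiv_apply_apply hΦ (differentiableAt_const w)]
  simp

theorem fderiv_mul_apply {Φ Θ : V → G →L[ℝ] G} {p : V}
    (hΦ : DifferentiableAt ℝ Φ p) (hΘ : DifferentiableAt ℝ Θ p) (A : V) :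
    fderiv ℝ (fun q => (Φ q).comp (Θ q)) p A =
      (fderiv ℝ Φ p A).comp (Θ p) + (Φ p).comp (fderiv ℝ Θ p A) := by
  rw [fderiv_clm_comp hΦ hΘ]
  simp [add_comm]

theorem contDiffOn_flip {F G H : Type*} [NormedAddCommGroup F] [NormedSpace ℝ F]
    [NormedAddCommGroup G] [NormedSpace ℝ G] [NormedAddCommGroup H] [NormedSpace ℝ H]
    {Φ : V → F →L[ℝ] G →L[ℝ] H} {S : Set V} (h : ContDiffOn ℝ ∞ Φ S) :
    ContDiffOn ℝ ∞ (fun q => (Φ q).flip) S :=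
  (ContinuousLinearMap.flipₗᵢ ℝ F G H).contDiff.comp_contDiffOn h

/-- The curvature `dθ + θ ∧ θ` of a matrix valued one-form. -/
def formCurv (θ : V → V →L[ℝ] E →L[ℝ] E) (p A B : V) : E →L[ℝ] E :=
  fderiv ℝ θ p A B - fderiv ℝ θ p B A + (θ p A).comp (θ p B) - (θ p B).comp (θ p A)

theorem fderiv_formCurv {S : Set V} (hS : IsOpen S) {θ : V → V →L[ℝ] E →L[ℝ] E}
    (hθ : ContDiffOn ℝ ∞ θ S) {p : V} (hp : p ∈ S) (A B C : V) :
    fderiv ℝ (fun q => formCurv θ q B C) p A =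
      fderiv ℝ (fderiv ℝ θ) p A B C - fderiv ℝ (fderiv ℝ θ) p A C B
      + ((fderiv ℝ θ p A B).comp (θ p C) + (θ p B).comp (fderiv ℝ θ p A C))
      - ((fderiv ℝ θ p A C).comp (θ p B) + (θ p C).comp (fderiv ℝ θ p A B)) := by
  have d1 := differentiableAt_of_contDiffOn hS hθ hp
  have d2 := differentiableAt_fderiv hS hθ hp
  have e1 : ∀ X : V, DifferentiableAt ℝ (fun q => θ q X) p := fun X =>
    d1.clm_apply (differentiableAt_const X)
  have e2 : ∀ X Y : V, DifferentiableAt ℝ (fun q => fderiv ℝ θ q X Y) p := fun X Y =>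
    (d2.clm_apply (differentiableAt_const X)).clm_apply (differentiableAt_const Y)
  have e3 : ∀ X : V, DifferentiableAt ℝ (fun q => fderiv ℝ θ q X) p := fun X =>
    (d2.clm_apply (differentiableAt_const X))
  have e4 : ∀ X Y : V, fderiv ℝ (fun q => fderiv ℝ θ q X Y) p A =
      fderiv ℝ (fderiv ℝ θ) p A X Y := fun X Y => by
    rw [fderiv_apply_const (e3 X), fderiv_apply_const d2]
  have e5 : ∀ X Y : V, DifferentiableAt ℝ (fun q => (θ q X).comp (θ q Y)) p := fun X Y =>
    (e1 X).clm_comp (e1 Y)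
  have e6 : ∀ X Y : V, fderiv ℝ (fun q => (θ q X).comp (θ q Y)) p A =
      (fderiv ℝ θ p A X).comp (θ p Y) + (θ p X).comp (fderiv ℝ θ p A Y) := fun X Y => by
    rw [fderiv_mul_apply (e1 X) (e1 Y), fderiv_apply_const d1, fderiv_apply_const d1]
  unfold formCurv
  rw [fderiv_fun_sub (((e2 B C).fun_sub (e2 C B)).fun_add (e5 B C)) (e5 C B),
    fderiv_fun_add ((e2 B C).fun_sub (e2 C B)) (e5 B C), fderiv_fun_sub (e2 B C) (e2 C B)]
  simp only [_root_.sub_apply, _root_.add_apply, e4, e6]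

/-- The second Bianchi identity. -/
theorem bianchi_second {S : Set V} (hS : IsOpen S) {θ : V → V →L[ℝ] E →L[ℝ] E}
    (hθ : ContDiffOn ℝ ∞ θ S) {p : V} (hp : p ∈ S) (A B C : V) :
    (fderiv ℝ (fun q => formCurv θ q B C) p A
      + ((θ p A).comp (formCurv θ p B C) - (formCurv θ p B C).comp (θ p A)))
    + (fderiv ℝ (fun q => formCurv θ q C A) p B
      + ((θ p B).comp (formCurv θ p C A) - (formCurv θ p C A).comp (θ p B)))
    + (fderiv ℝ (fun q => formCurv θ q A B) p C
      + ((θ p C).comp (formCurv θ p A B) - (formCurv θ p A B).comp (θ p C))) = 0 := by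
  rw [fderiv_formCurv hS hθ hp, fderiv_formCurv hS hθ hp, fderiv_formCurv hS hθ hp,
    fderiv_fderiv_comm hS hθ hp B C, fderiv_fderiv_comm hS hθ hp B A,
    fderiv_fderiv_comm hS hθ hp C A]
  ext c
  simp only [formCurv, _root_.sub_apply, _root_.add_apply, ContinuousLinearMap.comp_apply,
    map_add, map_sub, _root_.zero_apply]
  abel

/-- A metric that is parallel has skew-symmetric curvature. -/
theorem formCurv_skew {S : Set V} (hS : IsOpen S) {θ : V → V →L[ℝ] E →L[ℝ] E}
    (hθ : ContDiffOn ℝ ∞ θ S) {g : V → E →L[ℝ] E →L[ℝ] ℝ} (hg : ContDiffOn ℝ ∞ g S)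
    (hm : ∀ q ∈ S, ∀ A c d, fderiv ℝ g q A c d = g q (θ q A c) d + g q c (θ q A d))
    {p : V} (hp : p ∈ S) (A B : V) (c d : E) :
    g p (formCurv θ p A B c) d + g p c (formCurv θ p A B d) = 0 := by
  have d0 := differentiableAt_of_contDiffOn hS hg hp
  have d1 := differentiableAt_of_contDiffOn hS hθ hp
  have d2 := differentiableAt_fderiv hS hg hp
  -- The metric condition differentiated once more. The mixed terms g(θ_A c, θ_B d) are symmetric in
  -- A and B, so symmetry of the second derivative of g leaves exactly the curvature.
  have key : ∀ A B : V, fderiv ℝ (fderiv ℝ g) p A B c d =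
      (fderiv ℝ g p A (θ p B c) d + g p (fderiv ℝ θ p A B c) d) +
      (fderiv ℝ g p A c (θ p B d) + g p c (fderiv ℝ θ p A B d)) := by
    intro A B
    have e1 : ∀ X : V, DifferentiableAt ℝ (fun q => θ q X) p := fun X =>
      d1.clm_apply (differentiableAt_const X)
    have e2 : ∀ (X : V) (y : E), DifferentiableAt ℝ (fun q => θ q X y) p := fun X y =>
      (e1 X).clm_apply (differentiableAt_const y)
    have e3 : ∀ (X : V) (y : E), fderiv ℝ (fun q => θ q X y) p A = fderiv ℝ θ p A X y :=
      fun X y => by rw [fderiv_apply_const (e1 X), fderiv_apply_const d1]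
    have h1 : fderiv ℝ (fun q => fderiv ℝ g q B c d) p A = fderiv ℝ (fderiv ℝ g) p A B c d := by
      rw [fderiv_apply_const ((d2.clm_apply (differentiableAt_const B)).clm_apply
        (differentiableAt_const c)), fderiv_apply_const (d2.clm_apply (differentiableAt_const B)),
        fderiv_apply_const d2]
    have h2 : fderiv ℝ (fun q => fderiv ℝ g q B c d) p =
        fderiv ℝ (fun q => g q (θ q B c) d + g q c (θ q B d)) p :=
      fderiv_congr_of_isOpen hS (fun q hq => hm q hq B c d) hp
    rw [← h1, h2, fderiv_fun_add ((d0.clm_apply (e2 B c)).clm_apply (differentiableAt_const d))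
      ((d0.clm_apply (differentiableAt_const c)).clm_apply (e2 B d)), _root_.add_apply,
      fderiv_apply_const (d0.clm_apply (e2 B c)), fderiv_apply_apply d0 (e2 B c),
      fderiv_apply_apply (d0.clm_apply (differentiableAt_const c)) (e2 B d),
      fderiv_apply_const d0, e3, e3]
    simp
  have hs := congrArg (fun L => L c d) (fderiv_fderiv_comm hS hg hp A B)
  simp only [key, hm p hp] at hs
  simp only [formCurv, _root_.sub_apply, _root_.add_apply, ContinuousLinearMap.comp_apply,
    map_add, map_sub]
  linarith

end Calculus

/-! ### Partial derivatives and Euler's relation -/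

section Partial

variable {E : Type*} [NormedAddCommGroup E] [NormedSpace ℝ E]
variable {G : Type*} [NormedAddCommGroup G] [NormedSpace ℝ G]

theorem dBase_apply (h : E × E → G) (p : E × E) (a : E) : dBase h p a = fderiv ℝ h p (a, 0) := rfl

theorem dFibre_apply (h : E × E → G) (p : E × E) (b : E) : dFibre h p b = fderiv ℝ h p (0, b) := rfl

theorem contDiffOn_dBase {S : Set (E × E)} (hS : IsOpen S) {h : E × E → G}
    (hh : ContDiffOn ℝ ∞ h S) : ContDiffOn ℝ ∞ (dBase h) S :=
  (contDiffOn_fderiv hS hh).clm_comp contDiffOn_const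

theorem contDiffOn_dFibre {S : Set (E × E)} (hS : IsOpen S) {h : E × E → G}
    (hh : ContDiffOn ℝ ∞ h S) : ContDiffOn ℝ ∞ (dFibre h) S :=
  (contDiffOn_fderiv hS hh).clm_comp contDiffOn_const

theorem fderiv_dFibre {S : Set (E × E)} (hS : IsOpen S) {h : E × E → G}
    (hh : ContDiffOn ℝ ∞ h S) {p : E × E} (hp : p ∈ S) (A : E × E) (b : E) :
    fderiv ℝ (dFibre h) p A b = fderiv ℝ (fderiv ℝ h) p A (0, b) := by
  have d2 := differentiableAt_fderiv hS hh hp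
  unfold dFibre
  rw [fderiv_clm_comp d2 (differentiableAt_const _)]
  simp

theorem dFibre_dFibre_comm {S : Set (E × E)} (hS : IsOpen S) {h : E × E → G}
    (hh : ContDiffOn ℝ ∞ h S) {p : E × E} (hp : p ∈ S) (a b : E) :
    fderiv ℝ (dFibre h) p (0, a) b = fderiv ℝ (dFibre h) p (0, b) a := by
  rw [fderiv_dFibre hS hh hp, fderiv_dFibre hS hh hp, fderiv_fderiv_comm hS hh hp]

/-- Euler's relation differentiated: if `h` is fibrewise homogeneous of degree `r` in the
infinitesimal sense, the derivative of `h` along the fibre is so of degree `r - 1`. -/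
theorem euler_fderiv {S : Set (E × E)} (hS : IsOpen S) {h : E × E → G}
    (hh : ContDiffOn ℝ ∞ h S) {r : ℝ} (he : ∀ q ∈ S, fderiv ℝ h q (0, q.2) = r • h q)
    {p : E × E} (hp : p ∈ S) (A : E × E) :
    fderiv ℝ (fderiv ℝ h) p A (0, p.2) + fderiv ℝ h p (0, A.2) = r • fderiv ℝ h p A := by
  have d1 := differentiableAt_of_contDiffOn hS hh hp
  have d2 := differentiableAt_fderiv hS hh hp
  have h1 := congrArg (fun L => L A) (fderiv_congr_of_isOpen hS he hp)
  have h0 : HasFDerivAt (fun q : E × E => ((0 : E), q.2))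
      ((0 : E × E →L[ℝ] E).prod (ContinuousLinearMap.snd ℝ E E)) p :=
    ((0 : E × E →L[ℝ] E).prod (ContinuousLinearMap.snd ℝ E E)).hasFDerivAt
  have h2 : fderiv ℝ (fun q : E × E => ((0 : E), q.2)) p A = (0, A.2) := by
    rw [h0.fderiv]; simp

  rw [fderiv_apply_apply d2 h0.differentiableAt, h2, fderiv_fun_const_smul d1] at h1
  simpa using h1

end Partial

/-! ### Local Finsler structures: metric, spray, nonlinear connection, Cartan connection -/

section LocalFinsler

variable {E : Type*} [NormedAddCommGroup E] [NormedSpace ℝ E]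

/-- The nonzero vectors over an open set of the model space. -/
def slit (O : Set E) : Set (E × E) := O ×ˢ {0}ᶜ

omit [NormedSpace ℝ E] in
theorem mem_slit {O : Set E} {p : E × E} : p ∈ slit O ↔ p.1 ∈ O ∧ p.2 ≠ 0 := by
  simp [slit, Set.mem_prod]

/-- The local expression over `O` of a Finsler structure. -/
structure IsLocalFinsler (f : E × E → ℝ) (O : Set E) : Prop where
  isOpen_base : IsOpen O
  smooth : ContDiffOn ℝ ∞ f (slit O)
  homogeneous : ∀ p ∈ slit O, ∀ c : ℝ, 0 < c → f (p.1, c • p.2) = c * f p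
  posDef : ∀ p ∈ slit O, ∀ w : E, w ≠ 0 → 0 < fundTensor f p w w

namespace IsLocalFinsler

variable {f : E × E → ℝ} {O : Set E} (hf : IsLocalFinsler f O) {p : E × E}
include hf

theorem isOpen : IsOpen (slit O) := hf.isOpen_base.prod isOpen_compl_singleton

theorem contDiffOn_energy : ContDiffOn ℝ ∞ (energy f) (slit O) :=
  (hf.smooth.pow 2).div_const 2

theorem contDiffOn_dFibre_energy : ContDiffOn ℝ ∞ (dFibre (energy f)) (slit O) :=
  contDiffOn_dFibre hf.isOpen hf.contDiffOn_energy

theorem contDiffOn_fundTensor : ContDiffOn ℝ ∞ (fundTensor f) (slit O) :=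
  contDiffOn_dFibre hf.isOpen hf.contDiffOn_dFibre_energy

/-- Along the ray c ↦ (x, cv) with c > 0 the energy is c² times its value at c = 1; compare
derivatives there. -/
theorem energy_euler (hp : p ∈ slit O) :
    fderiv ℝ (energy f) p (0, p.2) = (2 : ℝ) • energy f p := by
  have d := differentiableAt_of_contDiffOn hf.isOpen hf.contDiffOn_energy hp
  have h1 : HasDerivAt (fun c : ℝ => ((p.1, c • p.2) : E × E)) (0, p.2) 1 := by
    have := (hasDerivAt_const (1 : ℝ) p.1).prodMk ((hasDerivAt_id (1 : ℝ)).smul_const p.2)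
    simpa using this
  have h2 : HasFDerivAt (energy f) (fderiv ℝ (energy f) p) (p.1, (1 : ℝ) • p.2) := by
    simpa using d.hasFDerivAt
  have h3 := h2.comp_hasDerivAt (1 : ℝ) h1
  have h4 : HasDerivAt (fun c : ℝ => c ^ 2 * energy f p) (2 * energy f p) 1 := by
    simpa using (hasDerivAt_pow 2 (1 : ℝ)).mul_const (energy f p)
  have h5 : (energy f ∘ fun c : ℝ => ((p.1, c • p.2) : E × E)) =ᶠ[𝓝 1]
      fun c : ℝ => c ^ 2 * energy f p := by
    filter_upwards [lt_mem_nhds (zero_lt_one' ℝ)] with c hc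
    simp only [Function.comp, energy, hf.homogeneous p hp c hc]
    ring
  exact (h3.congr_of_eventuallyEq h5.symm).unique h4

theorem fundTensor_symm (hp : p ∈ slit O) (a b : E) : fundTensor f p a b = fundTensor f p b a :=
  dFibre_dFibre_comm hf.isOpen hf.contDiffOn_energy hp a b

theorem fundTensor_vec (hp : p ∈ slit O) (a : E) :
    fundTensor f p a p.2 = dFibre (energy f) p a := by
  have h := euler_fderiv hf.isOpen hf.contDiffOn_energy (fun q hq => hf.energy_euler hq) hp (0, a)
  have h2 := fderiv_dFibre hf.isOpen hf.contDiffOn_energy hp (0, a) p.2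
  change fderiv ℝ (dFibre (energy f)) p (0, a) p.2 = _
  rw [h2]
  simp only [smul_eq_mul] at h
  rw [dFibre_apply]
  change _ + fderiv ℝ (energy f) p (0, a) = 2 * fderiv ℝ (energy f) p (0, a) at h
  linarith

theorem differentiableAt_fundTensor (hp : p ∈ slit O) : DifferentiableAt ℝ (fundTensor f) p :=
  differentiableAt_of_contDiffOn hf.isOpen hf.contDiffOn_fundTensor hp

theorem fderiv_fundTensor_symm (hp : p ∈ slit O) (A : E × E) (b c : E) :
    fderiv ℝ (fundTensor f) p A b c = fderiv ℝ (fundTensor f) p A c b := by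
  have d := hf.differentiableAt_fundTensor hp
  have h := congrArg (fun L => L A) (fderiv_congr_of_isOpen hf.isOpen
    (fun q hq => hf.fundTensor_symm hq b c) hp)
  beta_reduce at h
  rwa [fderiv_apply_const (d.clm_apply (differentiableAt_const _)), fderiv_apply_const d,
    fderiv_apply_const (d.clm_apply (differentiableAt_const _)), fderiv_apply_const d] at h

theorem fderiv_fundTensor_fibre_comm (hp : p ∈ slit O) (a b c : E) :
    fderiv ℝ (fundTensor f) p (0, a) b c = fderiv ℝ (fundTensor f) p (0, b) a c :=
  congrArg (fun L => L c) (dFibre_dFibre_comm hf.isOpen hf.contDiffOn_dFibre_energy hp a b)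

theorem fderiv_fundTensor_vec (hp : p ∈ slit O) (A : E × E) (b : E) :
    fderiv ℝ (fundTensor f) p A b p.2 + fundTensor f p b A.2 =
      fderiv ℝ (dFibre (energy f)) p A b := by
  have d := hf.differentiableAt_fundTensor hp
  have h := congrArg (fun L => L A) (fderiv_congr_of_isOpen hf.isOpen
    (fun q hq => hf.fundTensor_vec hq b) hp)
  beta_reduce at h
  rw [fderiv_apply_apply (d.clm_apply (differentiableAt_const _)) differentiableAt_snd,
    fderiv_apply_const d, fderiv_apply_const
      (differentiableAt_of_contDiffOn hf.isOpen hf.contDiffOn_dFibre_energy hp)] at h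
  simpa [fderiv_snd] using h

/-- The product rule for g(b, v) = ∂E(b) produces g(a, b) on both sides, which cancels. This is the
source of C(·, v) = 0. -/
theorem fderiv_fundTensor_fibre_vec (hp : p ∈ slit O) (a b : E) :
    fderiv ℝ (fundTensor f) p (0, a) b p.2 = 0 := by
  have h := hf.fderiv_fundTensor_vec hp (0, a) b
  have h2 : fderiv ℝ (dFibre (energy f)) p (0, a) b = fundTensor f p a b := rfl
  rw [h2, hf.fundTensor_symm hp a b] at h
  simpa using h

theorem fundTensor_injective (hp : p ∈ slit O) : Function.Injective (fundTensor f p) := by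
  rw [injective_iff_map_eq_zero]
  intro a ha
  by_contra h
  have := hf.posDef p hp a h
  rw [ha] at this
  simp at this

theorem fundTensor_ext (hp : p ∈ slit O) {a b : E}
    (h : ∀ w, fundTensor f p a w = fundTensor f p b w) : a = b :=
  hf.fundTensor_injective hp (ContinuousLinearMap.ext h)

section FiniteDim
variable [FiniteDimensional ℝ E]

theorem exists_equiv (hp : p ∈ slit O) :
    ∃ e : E ≃L[ℝ] (E →L[ℝ] ℝ), (e : E →L[ℝ] E →L[ℝ] ℝ) = fundTensor f p := by
  have hfin : Module.finrank ℝ E = Module.finrank ℝ (E →L[ℝ] ℝ) := by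
    rw [← (LinearMap.toContinuousLinearMap : (E →ₗ[ℝ] ℝ) ≃ₗ[ℝ] (E →L[ℝ] ℝ)).finrank_eq]
    exact (Subspace.dual_finrank_eq).symm
  let e := LinearEquiv.ofInjectiveOfFinrankEq (fundTensor f p : E →ₗ[ℝ] E →L[ℝ] ℝ)
    (hf.fundTensor_injective hp) hfin
  exact ⟨e.toContinuousLinearEquiv, by ext a b; rfl⟩

theorem fundTensor_sharp (hp : p ∈ slit O) (l : E →L[ℝ] ℝ) : fundTensor f p (sharp f p l) = l := by
  obtain ⟨e, he⟩ := hf.exists_equiv hp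
  rw [sharp, ← he, ContinuousLinearMap.inverse_equiv]
  simp

theorem contDiffOn_sharp : ContDiffOn ℝ ∞ (sharp f) (slit O) := by
  intro p hp
  obtain ⟨e, he⟩ := hf.exists_equiv hp
  have h : ContDiffAt ℝ ∞ ContinuousLinearMap.inverse (fundTensor f p) := by
    rw [← he]; exact contDiffAt_map_inverse e
  exact (h.comp p (hf.contDiffOn_fundTensor.contDiffAt (hf.isOpen.mem_nhds hp))).contDiffWithinAt

theorem contDiffOn_spray : ContDiffOn ℝ ∞ (spray f) (slit O) :=
  contDiffOn_const.smul (hf.contDiffOn_sharp.clm_apply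
    (((contDiffOn_dBase hf.isOpen hf.contDiffOn_dFibre_energy).clm_apply contDiff_snd.contDiffOn).sub
      (contDiffOn_dBase hf.isOpen hf.contDiffOn_energy)))

theorem contDiffOn_nonlin : ContDiffOn ℝ ∞ (nonlin f) (slit O) :=
  contDiffOn_dFibre hf.isOpen hf.contDiffOn_spray

theorem differentiableAt_nonlin (hp : p ∈ slit O) : DifferentiableAt ℝ (nonlin f) p :=
  differentiableAt_of_contDiffOn hf.isOpen hf.contDiffOn_nonlin hp

theorem contDiffOn_horLift : ContDiffOn ℝ ∞ (horLift f) (slit O) := by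
  have h : ContDiffOn ℝ ∞ (fun q => (ContinuousLinearMap.inl ℝ E E) -
      (ContinuousLinearMap.inr ℝ E E).comp (nonlin f q)) (slit O) :=
    contDiffOn_const.sub (contDiffOn_const.clm_comp hf.contDiffOn_nonlin)
  refine h.congr fun q _ => ?_
  ext a <;> simp [horLift]

theorem contDiffOn_horDerivFund : ContDiffOn ℝ ∞ (horDerivFund f) (slit O) :=
  (contDiffOn_fderiv hf.isOpen hf.contDiffOn_fundTensor).clm_comp hf.contDiffOn_horLift

theorem contDiffOn_christoffelLower : ContDiffOn ℝ ∞ (christoffelLower f) (slit O) := by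
  have h := hf.contDiffOn_horDerivFund
  exact ContDiffOn.const_smul (1 / 2 : ℝ) ((h.add (contDiffOn_flip h)).sub
    (contDiffOn_const.clm_comp (contDiffOn_flip h)))

theorem contDiffOn_christoffel : ContDiffOn ℝ ∞ (christoffel f) (slit O) :=
  ((ContinuousLinearMap.compL ℝ E (E →L[ℝ] ℝ) E).contDiff.comp_contDiffOn
    hf.contDiffOn_sharp).clm_comp hf.contDiffOn_christoffelLower

theorem contDiffOn_cartanTensor : ContDiffOn ℝ ∞ (cartanTensor f) (slit O) :=
  ContDiffOn.const_smul (1 / 2 : ℝ) (((ContinuousLinearMap.compL ℝ E (E →L[ℝ] ℝ) E).contDiff.comp_contDiffOn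
    hf.contDiffOn_sharp).clm_comp (contDiffOn_dFibre hf.isOpen hf.contDiffOn_fundTensor))

theorem contDiffOn_connForm : ContDiffOn ℝ ∞ (connForm f) (slit O) :=
  (hf.contDiffOn_christoffel.clm_comp contDiffOn_const).add
    (hf.contDiffOn_cartanTensor.clm_comp
      (contDiffOn_const.add (hf.contDiffOn_nonlin.clm_comp contDiffOn_const)))

omit hf [FiniteDimensional ℝ E] in
theorem horLift_apply (p : E × E) (a : E) : horLift f p a = (a, -nonlin f p a) := rfl

omit hf [FiniteDimensional ℝ E] in
theorem connForm_apply (p A : E × E) :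
    connForm f p A = christoffel f p A.1 + cartanTensor f p (A.2 + nonlin f p A.1) := rfl

omit hf [FiniteDimensional ℝ E] in
theorem connForm_horLift (p : E × E) (a : E) :
    connForm f p (horLift f p a) = christoffel f p a := by
  rw [connForm_apply]; simp [horLift_apply]

omit hf [FiniteDimensional ℝ E] in
theorem connForm_fibre (p : E × E) (b : E) :
    connForm f p (0, b) = cartanTensor f p b := by
  rw [connForm_apply]; simp

theorem fundTensor_spray (hp : p ∈ slit O) (w : E) :
    2 * fundTensor f p (spray f p) w =
      fderiv ℝ (dFibre (energy f)) p (p.2, 0) w - fderiv ℝ (energy f) p (w, 0) := by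
  rw [spray, map_smul, hf.fundTensor_sharp hp]
  simp [dBase_apply]

/-- Fibre derivative of the lowered spray formula; in this form N is accessible without
differentiating the inverse metric. -/
theorem fundTensor_nonlin (hp : p ∈ slit O) (a w : E) :
    2 * fderiv ℝ (fundTensor f) p (0, a) (spray f p) w + 2 * fundTensor f p (nonlin f p a) w =
      fderiv ℝ (fundTensor f) p (p.2, 0) a w + fderiv ℝ (dFibre (energy f)) p (a, 0) w
        - fderiv ℝ (dFibre (energy f)) p (w, 0) a := by
  have d := hf.differentiableAt_fundTensor hp
  have ds := differentiableAt_of_contDiffOn hf.isOpen hf.contDiffOn_spray hp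
  have d2 := differentiableAt_fderiv hf.isOpen hf.contDiffOn_dFibre_energy hp
  have d3 := differentiableAt_fderiv hf.isOpen hf.contDiffOn_energy hp
  have h0 : HasFDerivAt (fun q : E × E => (q.2, (0 : E)))
      ((ContinuousLinearMap.snd ℝ E E).prod (0 : E × E →L[ℝ] E)) p :=
    ((ContinuousLinearMap.snd ℝ E E).prod (0 : E × E →L[ℝ] E)).hasFDerivAt
  have h := congrArg (fun L => L (0, a)) (fderiv_congr_of_isOpen hf.isOpen
    (fun q hq => hf.fundTensor_spray hq w) hp)
  have e1 := d2.clm_apply h0.differentiableAt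
  beta_reduce at h
  rw [fderiv_const_mul ((d.clm_apply ds).clm_apply (differentiableAt_const w)),
    fderiv_fun_sub (e1.clm_apply (differentiableAt_const w))
      (d3.clm_apply (differentiableAt_const _)), _root_.smul_apply, _root_.sub_apply,
    fderiv_apply_const (d.clm_apply ds), fderiv_apply_apply d ds, fderiv_apply_const e1,
    fderiv_apply_apply d2 h0.differentiableAt, fderiv_apply_const d3, h0.fderiv,
    fderiv_fderiv_comm hf.isOpen hf.contDiffOn_dFibre_energy hp,
    fderiv_fderiv_comm hf.isOpen hf.contDiffOn_energy hp,
    ← fderiv_dFibre hf.isOpen hf.contDiffOn_energy hp,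
    ← fderiv_dFibre hf.isOpen hf.contDiffOn_dFibre_energy hp] at h
  have e2 : fderiv ℝ (spray f) p (0, a) = nonlin f p a := rfl
  have e3 : fderiv ℝ (dFibre (dFibre (energy f))) p = fderiv ℝ (fundTensor f) p := rfl
  rw [e2, e3] at h
  simp only [smul_eq_mul, _root_.add_apply, ContinuousLinearMap.prod_apply,
    ContinuousLinearMap.coe_snd', _root_.zero_apply] at h
  linarith

/-- Degree-two homogeneity of the spray, read off from the lowered formulas, in which the fibre
derivative of g contracted with v vanishes. -/
theorem nonlin_vec (hp : p ∈ slit O) : nonlin f p p.2 = (2 : ℝ) • spray f p := by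
  refine hf.fundTensor_ext hp fun w => ?_
  have h1 := hf.fundTensor_nonlin hp p.2 w
  have h2 := hf.fundTensor_spray hp w
  have h3 := hf.fderiv_fundTensor_vec hp (p.2, 0) w
  rw [hf.fderiv_fundTensor_fibre_comm hp, hf.fderiv_fundTensor_symm hp,
    hf.fderiv_fundTensor_fibre_vec hp, hf.fderiv_fundTensor_symm hp,
    fderiv_dFibre hf.isOpen hf.contDiffOn_energy hp (w, 0)] at h1
  have h4 := euler_fderiv hf.isOpen hf.contDiffOn_energy (fun q hq => hf.energy_euler hq) hp (w, 0)
  simp only [map_zero, Prod.mk_zero_zero, add_zero, smul_eq_mul] at h3 h4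
  rw [map_smul, _root_.smul_apply, smul_eq_mul]
  linarith

/-- Differentiating N v = 2G along b gives dN(b)v + N b = 2 N b, since the fibre derivative of G is
N. -/
theorem fderiv_nonlin_fibre_vec (hp : p ∈ slit O) (b : E) :
    fderiv ℝ (nonlin f) p (0, b) p.2 = nonlin f p b := by
  have ds := differentiableAt_of_contDiffOn hf.isOpen hf.contDiffOn_spray hp
  have h := congrArg (fun L => L (0, b)) (fderiv_congr_of_isOpen hf.isOpen
    (fun q hq => hf.nonlin_vec hq) hp)
  beta_reduce at h
  rw [fderiv_apply_apply (hf.differentiableAt_nonlin hp) differentiableAt_snd,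
    fderiv_fun_const_smul ds, fderiv_snd, _root_.smul_apply] at h
  have e2 : fderiv ℝ (spray f) p (0, b) = nonlin f p b := rfl
  rw [e2, two_smul] at h
  simpa using h

theorem fundTensor_christoffel (hp : p ∈ slit O) (a c w : E) :
    2 * fundTensor f p (christoffel f p a c) w =
      fderiv ℝ (fundTensor f) p (horLift f p a) c w + fderiv ℝ (fundTensor f) p (horLift f p c) a w
        - fderiv ℝ (fundTensor f) p (horLift f p w) a c := by
  have h : christoffel f p a c = sharp f p (christoffelLower f p a c) := rfl
  rw [h, hf.fundTensor_sharp hp]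
  have h2 : christoffelLower f p a c w = (1 / 2 : ℝ) * (horDerivFund f p a c w
    + horDerivFund f p c a w - horDerivFund f p w a c) := rfl
  rw [h2]
  simp only [horDerivFund, ContinuousLinearMap.comp_apply]
  ring

theorem fundTensor_cartanTensor (hp : p ∈ slit O) (b c w : E) :
    2 * fundTensor f p (cartanTensor f p b c) w = fderiv ℝ (fundTensor f) p (0, b) c w := by
  have h : cartanTensor f p b c = (1 / 2 : ℝ) • sharp f p (dFibre (fundTensor f) p b c) := rfl
  rw [h, map_smul, hf.fundTensor_sharp hp, dFibre_apply]
  simp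

theorem christoffel_symm (hp : p ∈ slit O) (a c : E) :
    christoffel f p a c = christoffel f p c a := by
  refine hf.fundTensor_ext hp fun w => ?_
  have h1 := hf.fundTensor_christoffel hp a c w
  have h2 := hf.fundTensor_christoffel hp c a w
  rw [hf.fderiv_fundTensor_symm hp (horLift f p w)] at h1
  linarith

theorem cartanTensor_symm (hp : p ∈ slit O) (a c : E) :
    cartanTensor f p a c = cartanTensor f p c a := by
  refine hf.fundTensor_ext hp fun w => ?_
  have h1 := hf.fundTensor_cartanTensor hp a c w
  have h2 := hf.fundTensor_cartanTensor hp c a w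
  rw [hf.fderiv_fundTensor_fibre_comm hp] at h1
  linarith

theorem fundTensor_cartanTensor_comm (hp : p ∈ slit O) (a b c : E) :
    fundTensor f p (cartanTensor f p a b) c = fundTensor f p (cartanTensor f p a c) b := by
  have h1 := hf.fundTensor_cartanTensor hp a b c
  have h2 := hf.fundTensor_cartanTensor hp a c b
  rw [hf.fderiv_fundTensor_symm hp] at h1
  linarith

theorem cartanTensor_vec (hp : p ∈ slit O) (a : E) : cartanTensor f p a p.2 = 0 := by
  refine hf.fundTensor_ext hp fun w => ?_
  have h1 := hf.fundTensor_cartanTensor hp a p.2 w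
  rw [hf.fderiv_fundTensor_symm hp, hf.fderiv_fundTensor_fibre_vec hp] at h1
  rw [map_zero, _root_.zero_apply]
  linarith

theorem cartanTensor_vec' (hp : p ∈ slit O) (a : E) : cartanTensor f p p.2 a = 0 := by
  rw [hf.cartanTensor_symm hp, hf.cartanTensor_vec hp]

theorem cartanTensor_vec_eq_zero (hp : p ∈ slit O) : cartanTensor f p p.2 = 0 :=
  ContinuousLinearMap.ext fun a => hf.cartanTensor_vec' hp a

/-- Ties the linear connection to the nonlinear one: together with C(·, v) = 0 it makes `μ` the
vertical part, so that the kernel of `μ` consists of the lifts `horLift`. -/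
theorem christoffel_vec (hp : p ∈ slit O) (a : E) :
    christoffel f p a p.2 = nonlin f p a := by
  refine hf.fundTensor_ext hp fun w => ?_
  have h1 := hf.fundTensor_christoffel hp a p.2 w
  have hor : ∀ b, horLift f p b = (b, 0) - (0, nonlin f p b) := fun b => by
    simp [horLift_apply]
  have h2 : ∀ b c, fderiv ℝ (fundTensor f) p (horLift f p b) c p.2 =
      fderiv ℝ (dFibre (energy f)) p (b, 0) c := by
    intro b c
    have h3 := hf.fderiv_fundTensor_vec hp (horLift f p b) c
    have h4 : fderiv ℝ (dFibre (energy f)) p (0, nonlin f p b) c =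
      fundTensor f p (nonlin f p b) c := rfl
    have h5 : (horLift f p b).2 = - nonlin f p b := rfl
    rw [h5, map_neg, hf.fundTensor_symm hp c] at h3
    nth_rewrite 2 [hor] at h3
    rw [map_sub, _root_.sub_apply, h4] at h3
    linarith
  have h6 := hf.fundTensor_nonlin hp a w
  rw [hf.fderiv_fundTensor_symm hp (horLift f p a), h2, h2, hor p.2, map_sub, _root_.sub_apply,
    _root_.sub_apply, hf.nonlin_vec hp] at h1
  -- The lift of v has vertical part -N v = -2G; its contribution is the spray term of
  -- `fundTensor_nonlin`.
  have h7 : fderiv ℝ (fundTensor f) p (0, (2 : ℝ) • spray f p) a w =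
      2 * fderiv ℝ (fundTensor f) p (0, a) (spray f p) w := by
    rw [hf.fderiv_fundTensor_fibre_comm hp, map_smul]; rfl
  linarith

theorem christoffel_vec' (hp : p ∈ slit O) (a : E) :
    christoffel f p p.2 a = nonlin f p a := by
  rw [hf.christoffel_symm hp, hf.christoffel_vec hp]

/-- The Cartan connection is metric. -/
theorem fderiv_fundTensor (hp : p ∈ slit O) (A : E × E) (c d : E) :
    fderiv ℝ (fundTensor f) p A c d =
      fundTensor f p (connForm f p A c) d + fundTensor f p c (connForm f p A d) := by
  have hA : A = horLift f p A.1 + (0, A.2 + nonlin f p A.1) := by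
    ext <;> simp [horLift_apply]
  have h1 := hf.fundTensor_christoffel hp A.1 c d
  have h2 := hf.fundTensor_christoffel hp A.1 d c
  have h3 := hf.fundTensor_cartanTensor hp (A.2 + nonlin f p A.1) c d
  have h4 := hf.fundTensor_cartanTensor hp (A.2 + nonlin f p A.1) d c
  rw [hf.fundTensor_symm hp c, connForm_apply]
  rw [hf.fderiv_fundTensor_symm hp (horLift f p A.1) d c] at h2
  rw [hf.fderiv_fundTensor_symm hp _ d c] at h4
  nth_rewrite 1 [hA]
  simp only [map_add, _root_.add_apply] at *
  linarith

theorem muMap_apply (hp : p ∈ slit O) (A : E × E) : muMap f p A = A.2 + nonlin f p A.1 := by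
  have h : muMap f p A = A.2 + connForm f p A p.2 := rfl
  rw [h, connForm_apply, _root_.add_apply, hf.christoffel_vec hp, hf.cartanTensor_vec hp, add_zero]

theorem muMap_eq_zero_iff (hp : p ∈ slit O) (A : E × E) :
    muMap f p A = 0 ↔ A = horLift f p A.1 := by
  rw [hf.muMap_apply hp, horLift_apply, Prod.ext_iff, add_eq_zero_iff_eq_neg]
  simp

theorem muMap_horLift (hp : p ∈ slit O) (a : E) : muMap f p (horLift f p a) = 0 := by
  rw [hf.muMap_eq_zero_iff hp]; rfl

end FiniteDim

end IsLocalFinsler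

end LocalFinsler

/-! ### Curvature as a smooth bilinear map -/

section CurvatureForms

variable {V : Type*} [NormedAddCommGroup V] [NormedSpace ℝ V]
variable {E : Type*} [NormedAddCommGroup E] [NormedSpace ℝ E]

theorem contDiffOn_bilinearComp {F F' G G' H : Type*} [NormedAddCommGroup F] [NormedSpace ℝ F]
    [NormedAddCommGroup G] [NormedSpace ℝ G] [NormedAddCommGroup H] [NormedSpace ℝ H]
    [NormedAddCommGroup F'] [NormedSpace ℝ F'] [NormedAddCommGroup G'] [NormedSpace ℝ G']
    {Φ : V → F →L[ℝ] G →L[ℝ] H} {X : V → F' →L[ℝ] F} {Y : V → G' →L[ℝ] G} {S : Set V}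
    (h : ContDiffOn ℝ ∞ Φ S) (hX : ContDiffOn ℝ ∞ X S) (hY : ContDiffOn ℝ ∞ Y S) :
    ContDiffOn ℝ ∞ (fun q => (Φ q).bilinearComp (X q) (Y q)) S :=
  contDiffOn_flip ((contDiffOn_flip (h.clm_comp hX)).clm_comp hY)

/-- The curvature of a matrix valued one-form, as a continuous bilinear map. -/
def formCurvL (θ : V → V →L[ℝ] E →L[ℝ] E) (p : V) : V →L[ℝ] V →L[ℝ] E →L[ℝ] E :=
  fderiv ℝ θ p - (fderiv ℝ θ p).flip + (ContinuousLinearMap.compL ℝ E E E).bilinearComp (θ p) (θ p)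
    - ((ContinuousLinearMap.compL ℝ E E E).bilinearComp (θ p) (θ p)).flip

theorem contDiffOn_formCurvL {S : Set V} (hS : IsOpen S) {θ : V → V →L[ℝ] E →L[ℝ] E}
    (hθ : ContDiffOn ℝ ∞ θ S) : ContDiffOn ℝ ∞ (formCurvL θ) S := by
  have h1 := contDiffOn_fderiv hS hθ
  have h2 : ContDiffOn ℝ ∞ (fun q => (ContinuousLinearMap.compL ℝ E E E).bilinearComp
    (θ q) (θ q)) S := contDiffOn_bilinearComp contDiffOn_const hθ hθ
  exact ((h1.sub (contDiffOn_flip h1)).add h2).sub (contDiffOn_flip h2)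

theorem formCurv_antisymm (θ : V → V →L[ℝ] E →L[ℝ] E) (p A B : V) :
    formCurv θ p A B = - formCurv θ p B A := by
  unfold formCurv; abel

theorem fderiv_apply_apply_const {F G H : Type*} [NormedAddCommGroup F] [NormedSpace ℝ F]
    [NormedAddCommGroup G] [NormedSpace ℝ G] [NormedAddCommGroup H] [NormedSpace ℝ H]
    {Φ : V → F →L[ℝ] G →L[ℝ] H} {p : V} (h : DifferentiableAt ℝ Φ p) (a : F) (b : G) (A : V) :
    fderiv ℝ (fun q => Φ q a b) p A = fderiv ℝ Φ p A a b := by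
  rw [fderiv_apply_const (h.clm_apply (differentiableAt_const _)), fderiv_apply_const h]

theorem fderiv_apply_apply₂ {F G H : Type*} [NormedAddCommGroup F] [NormedSpace ℝ F]
    [NormedAddCommGroup G] [NormedSpace ℝ G] [NormedAddCommGroup H] [NormedSpace ℝ H]
    {Φ : V → F →L[ℝ] G →L[ℝ] H} {a : V → F} {b : V → G} {p : V} (h : DifferentiableAt ℝ Φ p)
    (ha : DifferentiableAt ℝ a p) (hb : DifferentiableAt ℝ b p) (A : V) :
    fderiv ℝ (fun q => Φ q (a q) (b q)) p A = fderiv ℝ Φ p A (a p) (b p) +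
      Φ p (fderiv ℝ a p A) (b p) + Φ p (a p) (fderiv ℝ b p A) := by
  rw [fderiv_apply_apply (h.clm_apply ha) hb, fderiv_apply_apply h ha, _root_.add_apply]

end CurvatureForms

/-! ### Curvature blocks of the Cartan connection and their Bianchi identities -/

section CartanCurvature

variable {E : Type*} [NormedAddCommGroup E] [NormedSpace ℝ E]

/-- The component of a tangent vector in the fibre directions along the horizontal space. -/
def vertPart (f : E × E → ℝ) (p : E × E) : E × E →L[ℝ] E :=
  ContinuousLinearMap.snd ℝ E E + (nonlin f p).comp (ContinuousLinearMap.fst ℝ E E)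

/-- The curvature of the Cartan connection as a continuous bilinear map. -/
def curvL (f : E × E → ℝ) (p : E × E) : E × E →L[ℝ] E × E →L[ℝ] E →L[ℝ] E :=
  formCurvL (connForm f) p

/-- The `hh`-curvature. -/
def hhCurv (f : E × E → ℝ) (p : E × E) : E →L[ℝ] E →L[ℝ] E →L[ℝ] E :=
  (curvL f p).bilinearComp (horLift f p) (horLift f p)

/-- The `hv`-curvature as a continuous bilinear map. -/
def hvCurvL (f : E × E → ℝ) (p : E × E) : E →L[ℝ] E →L[ℝ] E →L[ℝ] E :=
  (curvL f p).bilinearComp (horLift f p) (ContinuousLinearMap.inr ℝ E E)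

/-- The `vv`-curvature. -/
def vvCurv (f : E × E → ℝ) (p : E × E) : E →L[ℝ] E →L[ℝ] E →L[ℝ] E :=
  (curvL f p).bilinearComp (ContinuousLinearMap.inr ℝ E E) (ContinuousLinearMap.inr ℝ E E)

theorem hhCurv_apply (f : E × E → ℝ) (p : E × E) (a b : E) :
    hhCurv f p a b = curv f p (horLift f p a) (horLift f p b) := rfl

theorem hvCurvL_apply (f : E × E → ℝ) (p : E × E) (a b : E) :
    hvCurvL f p a b = curv f p (horLift f p a) (0, b) := rfl

theorem vvCurv_apply (f : E × E → ℝ) (p : E × E) (a b : E) :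
    vvCurv f p a b = curv f p (0, a) (0, b) := rfl

theorem curv_eq_formCurv (f : E × E → ℝ) (p A B : E × E) :
    curv f p A B = formCurv (connForm f) p A B := rfl

theorem curv_antisymm (f : E × E → ℝ) (p A B : E × E) : curv f p A B = - curv f p B A :=
  formCurv_antisymm _ _ _ _

theorem hhCurv_antisymm (f : E × E → ℝ) (p : E × E) (a b : E) :
    hhCurv f p a b = - hhCurv f p b a := curv_antisymm _ _ _ _

theorem vvCurv_antisymm (f : E × E → ℝ) (p : E × E) (a b : E) :
    vvCurv f p a b = - vvCurv f p b a := curv_antisymm _ _ _ _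

theorem vertPart_apply (f : E × E → ℝ) (p A : E × E) :
    vertPart f p A = A.2 + nonlin f p A.1 := rfl

theorem vertPart_horLift (f : E × E → ℝ) (p : E × E) (a : E) :
    vertPart f p (horLift f p a) = 0 := by
  change - nonlin f p a + nonlin f p a = 0
  simp

theorem vertPart_fibre (f : E × E → ℝ) (p : E × E) (b : E) : vertPart f p (0, b) = b := by
  simp [vertPart_apply]

theorem horLift_add_vertPart (f : E × E → ℝ) (p A : E × E) :
    horLift f p A.1 + (0, vertPart f p A) = A := by
  ext <;> simp [IsLocalFinsler.horLift_apply, vertPart_apply]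

/-- The Bianchi identity is available for constant fields B, C, whose brackets vanish. Splitting
them into horizontal and vertical parts moves the noncommutativity into the derivative of
`vertPart`, that is, into dN. -/
theorem curv_decomp (f : E × E → ℝ) (p B C : E × E) :
    curv f p B C = hhCurv f p B.1 C.1 + hvCurvL f p B.1 (vertPart f p C)
      - hvCurvL f p C.1 (vertPart f p B) + vvCurv f p (vertPart f p B) (vertPart f p C) := by
  nth_rewrite 1 [← horLift_add_vertPart f p B, ← horLift_add_vertPart f p C]
  rw [curv_add, curv_add_right, curv_add_right, hvCurvL_apply f p C.1,
    curv_antisymm f p (horLift f p C.1), ← hvCurvL_apply, ← hhCurv_apply, ← vvCurv_apply]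
  abel

namespace IsLocalFinsler

variable {f : E × E → ℝ} {O : Set E} (hf : IsLocalFinsler f O) {p : E × E}
variable [FiniteDimensional ℝ E]
include hf

theorem contDiffOn_curvL : ContDiffOn ℝ ∞ (curvL f) (slit O) :=
  contDiffOn_formCurvL hf.isOpen hf.contDiffOn_connForm

theorem contDiffOn_hhCurv : ContDiffOn ℝ ∞ (hhCurv f) (slit O) :=
  contDiffOn_bilinearComp hf.contDiffOn_curvL hf.contDiffOn_horLift hf.contDiffOn_horLift

theorem contDiffOn_hvCurvL : ContDiffOn ℝ ∞ (hvCurvL f) (slit O) :=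
  contDiffOn_bilinearComp hf.contDiffOn_curvL hf.contDiffOn_horLift contDiffOn_const

theorem contDiffOn_vvCurv : ContDiffOn ℝ ∞ (vvCurv f) (slit O) :=
  contDiffOn_bilinearComp hf.contDiffOn_curvL contDiffOn_const contDiffOn_const

theorem contDiffOn_vertPart : ContDiffOn ℝ ∞ (vertPart f) (slit O) :=
  contDiffOn_const.add (hf.contDiffOn_nonlin.clm_comp contDiffOn_const)

theorem differentiableAt_hhCurv (hp : p ∈ slit O) : DifferentiableAt ℝ (hhCurv f) p :=
  differentiableAt_of_contDiffOn hf.isOpen hf.contDiffOn_hhCurv hp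

theorem differentiableAt_hvCurvL (hp : p ∈ slit O) : DifferentiableAt ℝ (hvCurvL f) p :=
  differentiableAt_of_contDiffOn hf.isOpen hf.contDiffOn_hvCurvL hp

theorem differentiableAt_vvCurv (hp : p ∈ slit O) : DifferentiableAt ℝ (vvCurv f) p :=
  differentiableAt_of_contDiffOn hf.isOpen hf.contDiffOn_vvCurv hp

theorem differentiableAt_cartanTensor (hp : p ∈ slit O) : DifferentiableAt ℝ (cartanTensor f) p :=
  differentiableAt_of_contDiffOn hf.isOpen hf.contDiffOn_cartanTensor hp

theorem differentiableAt_connForm (hp : p ∈ slit O) : DifferentiableAt ℝ (connForm f) p :=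
  differentiableAt_of_contDiffOn hf.isOpen hf.contDiffOn_connForm hp

theorem differentiableAt_vertPart (hp : p ∈ slit O) : DifferentiableAt ℝ (vertPart f) p :=
  differentiableAt_of_contDiffOn hf.isOpen hf.contDiffOn_vertPart hp

theorem fderiv_vertPart (hp : p ∈ slit O) (A C : E × E) :
    fderiv ℝ (fun q => vertPart f q C) p A = fderiv ℝ (nonlin f) p A C.1 := by
  simp only [vertPart_apply]
  rw [fderiv_const_add, fderiv_apply_const (hf.differentiableAt_nonlin hp)]

theorem fderiv_curv (hp : p ∈ slit O) (A B C : E × E) :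
    fderiv ℝ (fun q => curv f q B C) p A =
      fderiv ℝ (hhCurv f) p A B.1 C.1
      + (fderiv ℝ (hvCurvL f) p A B.1 (vertPart f p C)
        + hvCurvL f p B.1 (fderiv ℝ (nonlin f) p A C.1))
      - (fderiv ℝ (hvCurvL f) p A C.1 (vertPart f p B)
        + hvCurvL f p C.1 (fderiv ℝ (nonlin f) p A B.1))
      + (fderiv ℝ (vvCurv f) p A (vertPart f p B) (vertPart f p C)
        + vvCurv f p (fderiv ℝ (nonlin f) p A B.1) (vertPart f p C)
        + vvCurv f p (vertPart f p B) (fderiv ℝ (nonlin f) p A C.1)) := by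
  have d1 := hf.differentiableAt_hhCurv hp
  have d2 := hf.differentiableAt_hvCurvL hp
  have d3 := hf.differentiableAt_vvCurv hp
  have d4 : ∀ X : E × E, DifferentiableAt ℝ (fun q => vertPart f q X) p := fun X =>
    (hf.differentiableAt_vertPart hp).clm_apply (differentiableAt_const _)
  have c : ∀ x : E, DifferentiableAt ℝ (fun _ : E × E => x) p := fun x => differentiableAt_const x
  have e1 := (d1.clm_apply (c B.1)).clm_apply (c C.1)
  have e2 : ∀ x X, DifferentiableAt ℝ (fun q => hvCurvL f q x (vertPart f q X)) p := fun x X =>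
    (d2.clm_apply (c x)).clm_apply (d4 X)
  have e3 := (d3.clm_apply (d4 B)).clm_apply (d4 C)
  simp only [curv_decomp f _ B C]
  rw [fderiv_fun_add ((e1.fun_add (e2 _ _)).fun_sub (e2 _ _)) e3,
    fderiv_fun_sub (e1.fun_add (e2 _ _)) (e2 _ _), fderiv_fun_add e1 (e2 _ _)]
  simp only [_root_.add_apply, _root_.sub_apply]
  rw [fderiv_apply_apply_const d1, fderiv_apply_apply₂ d2 (c _) (d4 _),
    fderiv_apply_apply₂ d2 (c _) (d4 _), fderiv_apply_apply₂ d3 (d4 _) (d4 _)]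
  simp [hf.fderiv_vertPart hp]

/-- The covariant exterior derivative of ∇𝐯 is Ω𝐯, and ∇𝐯 is `vertPart`. -/
theorem fderiv_nonlin_antisymm (hp : p ∈ slit O) (A B : E × E) :
    fderiv ℝ (nonlin f) p A B.1 - fderiv ℝ (nonlin f) p B A.1 =
      curv f p A B p.2 - connForm f p A (vertPart f p B) + connForm f p B (vertPart f p A) := by
  have d := hf.differentiableAt_connForm hp
  have key : ∀ A B : E × E, fderiv ℝ (nonlin f) p A B.1 =
      fderiv ℝ (connForm f) p A B p.2 + connForm f p B A.2 := by
    intro A B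
    have h := congrArg (fun L => L A) (fderiv_congr_of_isOpen hf.isOpen
      (fun q hq => (hf.muMap_apply hq B).symm.trans
        (show muMap f q B = B.2 + connForm f q B q.2 from rfl)) hp)
    beta_reduce at h
    rw [fderiv_const_add, fderiv_const_add, fderiv_apply_const (hf.differentiableAt_nonlin hp),
      fderiv_apply_apply (d.clm_apply (differentiableAt_const _)) differentiableAt_snd,
      fderiv_apply_const d, fderiv_snd] at h
    simpa using h
  have h2 : ∀ A : E × E, vertPart f p A = A.2 + connForm f p A p.2 := fun A =>
    (hf.muMap_apply hp A).symm.trans rfl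
  rw [key A B, key B A, h2, h2]
  simp only [curv, _root_.add_apply, _root_.sub_apply, ContinuousLinearMap.comp_apply, map_add]
  abel

/-- Up to sign the left side is the bracket of the lifts of a and b, which is vertical. It is how
R(·, ·)v enters every Bianchi identity below. -/
theorem fderiv_nonlin_horLift (hp : p ∈ slit O) (a b : E) :
    fderiv ℝ (nonlin f) p (horLift f p a) b - fderiv ℝ (nonlin f) p (horLift f p b) a =
      hhCurv f p a b p.2 := by
  have h := hf.fderiv_nonlin_antisymm hp (horLift f p a) (horLift f p b)
  rw [vertPart_horLift, vertPart_horLift, map_zero, map_zero, sub_zero, add_zero] at h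
  exact h

/-- The horizontal coefficients are symmetric and cancel; only the Cartan tensor produces torsion.
-/
theorem torsion (hp : p ∈ slit O) (A B : E × E) :
    connForm f p A B.1 - connForm f p B A.1 =
      cartanTensor f p (vertPart f p A) B.1 - cartanTensor f p (vertPart f p B) A.1 := by
  rw [connForm_apply, connForm_apply, _root_.add_apply, _root_.add_apply,
    hf.christoffel_symm hp A.1 B.1, vertPart_apply, vertPart_apply]
  abel

theorem fderiv_torsion (hp : p ∈ slit O) (A B C : E × E) :
    fderiv ℝ (connForm f) p A B C.1 - fderiv ℝ (connForm f) p A C B.1 =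
      (fderiv ℝ (cartanTensor f) p A (vertPart f p B) C.1
        + cartanTensor f p (fderiv ℝ (nonlin f) p A B.1) C.1)
      - (fderiv ℝ (cartanTensor f) p A (vertPart f p C) B.1
        + cartanTensor f p (fderiv ℝ (nonlin f) p A C.1) B.1) := by
  have d := hf.differentiableAt_connForm hp
  have d2 := hf.differentiableAt_cartanTensor hp
  have d4 : ∀ X : E × E, DifferentiableAt ℝ (fun q => vertPart f q X) p := fun X =>
    (hf.differentiableAt_vertPart hp).clm_apply (differentiableAt_const _)
  have c : ∀ x : E, DifferentiableAt ℝ (fun _ : E × E => x) p := fun x => differentiableAt_const x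
  have h := congrArg (fun L => L A) (fderiv_congr_of_isOpen hf.isOpen
    (fun q hq => hf.torsion hq B C) hp)
  beta_reduce at h
  have e1 : ∀ (X : E × E) (x : E), DifferentiableAt ℝ (fun q => connForm f q X x) p := fun X x =>
    (d.clm_apply (differentiableAt_const _)).clm_apply (c _)
  have e2 : ∀ (X : E × E) (x : E), DifferentiableAt ℝ
    (fun q => cartanTensor f q (vertPart f q X) x) p := fun X x => (d2.clm_apply (d4 X)).clm_apply (c _)
  rw [fderiv_fun_sub (e1 _ _) (e1 _ _), fderiv_fun_sub (e2 _ _) (e2 _ _)] at h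
  simp only [_root_.sub_apply] at h
  rw [fderiv_apply_apply_const d, fderiv_apply_apply_const d,
    fderiv_apply_apply₂ d2 (d4 _) (c _), fderiv_apply_apply₂ d2 (d4 _) (c _)] at h
  simpa [hf.fderiv_vertPart hp] using h

/-- The first Bianchi identity. -/
theorem bianchi_first (hp : p ∈ slit O) (A B C : E × E) :
    curv f p A B C.1 + curv f p B C A.1 + curv f p C A B.1 =
      (fderiv ℝ (cartanTensor f) p A (vertPart f p B) C.1
        + cartanTensor f p (fderiv ℝ (nonlin f) p A B.1) C.1
      - (fderiv ℝ (cartanTensor f) p A (vertPart f p C) B.1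
        + cartanTensor f p (fderiv ℝ (nonlin f) p A C.1) B.1)
      + connForm f p A (cartanTensor f p (vertPart f p B) C.1
        - cartanTensor f p (vertPart f p C) B.1))
      + (fderiv ℝ (cartanTensor f) p B (vertPart f p C) A.1
        + cartanTensor f p (fderiv ℝ (nonlin f) p B C.1) A.1
      - (fderiv ℝ (cartanTensor f) p B (vertPart f p A) C.1
        + cartanTensor f p (fderiv ℝ (nonlin f) p B A.1) C.1)
      + connForm f p B (cartanTensor f p (vertPart f p C) A.1
        - cartanTensor f p (vertPart f p A) C.1))
      + (fderiv ℝ (cartanTensor f) p C (vertPart f p A) B.1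
        + cartanTensor f p (fderiv ℝ (nonlin f) p C A.1) B.1
      - (fderiv ℝ (cartanTensor f) p C (vertPart f p B) A.1
        + cartanTensor f p (fderiv ℝ (nonlin f) p C B.1) A.1)
      + connForm f p C (cartanTensor f p (vertPart f p A) B.1
        - cartanTensor f p (vertPart f p B) A.1)) := by
  rw [← hf.fderiv_torsion hp A B C, ← hf.fderiv_torsion hp B C A, ← hf.fderiv_torsion hp C A B,
    ← hf.torsion hp B C, ← hf.torsion hp C A, ← hf.torsion hp A B]
  simp only [curv, _root_.add_apply, _root_.sub_apply, ContinuousLinearMap.comp_apply, map_sub]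
  abel

/-- Lifts have no vertical part at p, so of the torsion terms only those with dN survive, and they
assemble in pairs to R(·, ·)v. -/
theorem bianchi_first_hhh (hp : p ∈ slit O) (a b c : E) :
    hhCurv f p a b c + hhCurv f p b c a + hhCurv f p c a b =
      cartanTensor f p (hhCurv f p a b p.2) c + cartanTensor f p (hhCurv f p b c p.2) a
        + cartanTensor f p (hhCurv f p c a p.2) b := by
  have h := hf.bianchi_first hp (horLift f p a) (horLift f p b) (horLift f p c)
  rw [← hf.fderiv_nonlin_horLift hp, ← hf.fderiv_nonlin_horLift hp,
    ← hf.fderiv_nonlin_horLift hp]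
  have e : ∀ x, (horLift f p x).1 = x := fun _ => rfl
  simp only [vertPart_horLift, e, map_zero, _root_.zero_apply, zero_add, sub_self, add_zero] at h
  simp only [hhCurv_apply, map_sub, _root_.sub_apply, h]
  abel

theorem bianchi_first_vhh (hp : p ∈ slit O) (a b c : E) :
    hvCurvL f p c b a - hvCurvL f p a b c =
      cartanTensor f p (fderiv ℝ (nonlin f) p (0, b) a) c
      - cartanTensor f p (fderiv ℝ (nonlin f) p (0, b) c) a
      - fderiv ℝ (cartanTensor f) p (horLift f p a) b c
      - christoffel f p a (cartanTensor f p b c)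
      + fderiv ℝ (cartanTensor f) p (horLift f p c) b a
      + christoffel f p c (cartanTensor f p b a) := by
  have h := hf.bianchi_first hp (0, b) (horLift f p a) (horLift f p c)
  have e : ∀ x, (horLift f p x).1 = x := fun _ => rfl
  rw [curv_antisymm f p (0, b)] at h
  simp only [vertPart_horLift, vertPart_fibre, connForm_horLift, e, map_zero, _root_.zero_apply,
    zero_add, sub_self, add_zero, zero_sub, sub_zero, map_neg, _root_.neg_apply] at h
  simp only [hvCurvL_apply]
  rw [sub_eq_neg_add, h]
  abel

/-- The right side is not zero because lifts do not commute: their vertical bracket, given by R(·,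
·)v, is fed into P. -/
theorem bianchi_second_hhh (hp : p ∈ slit O) (a b c : E) :
    (fderiv ℝ (hhCurv f) p (horLift f p a) b c + ((christoffel f p a).comp (hhCurv f p b c)
      - (hhCurv f p b c).comp (christoffel f p a)))
    + (fderiv ℝ (hhCurv f) p (horLift f p b) c a + ((christoffel f p b).comp (hhCurv f p c a)
      - (hhCurv f p c a).comp (christoffel f p b)))
    + (fderiv ℝ (hhCurv f) p (horLift f p c) a b + ((christoffel f p c).comp (hhCurv f p a b)
      - (hhCurv f p a b).comp (christoffel f p c))) =
    hvCurvL f p a (hhCurv f p b c p.2) + hvCurvL f p b (hhCurv f p c a p.2)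
      + hvCurvL f p c (hhCurv f p a b p.2) := by
  have h := bianchi_second hf.isOpen hf.contDiffOn_connForm hp (horLift f p a) (horLift f p b)
    (horLift f p c)
  simp only [← curv_eq_formCurv, connForm_horLift] at h
  rw [hf.fderiv_curv hp, hf.fderiv_curv hp, hf.fderiv_curv hp] at h
  have e : ∀ x, (horLift f p x).1 = x := fun _ => rfl
  simp only [vertPart_horLift, e, map_zero, _root_.zero_apply, zero_add, add_zero] at h
  rw [← hf.fderiv_nonlin_horLift hp, ← hf.fderiv_nonlin_horLift hp,
    ← hf.fderiv_nonlin_horLift hp]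
  simp only [hhCurv_apply, map_sub]
  rw [← sub_eq_zero, ← h]
  abel

theorem bianchi_second_vhh (hp : p ∈ slit O) (b x y : E) :
    (fderiv ℝ (hhCurv f) p (0, b) x y + ((cartanTensor f p b).comp (hhCurv f p x y)
      - (hhCurv f p x y).comp (cartanTensor f p b)))
    + hvCurvL f p x (fderiv ℝ (nonlin f) p (0, b) y)
    - hvCurvL f p y (fderiv ℝ (nonlin f) p (0, b) x)
    + (fderiv ℝ (hvCurvL f) p (horLift f p x) y b + ((christoffel f p x).comp (hvCurvL f p y b)
      - (hvCurvL f p y b).comp (christoffel f p x)))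
    - (fderiv ℝ (hvCurvL f) p (horLift f p y) x b + ((christoffel f p y).comp (hvCurvL f p x b)
      - (hvCurvL f p x b).comp (christoffel f p y)))
    + vvCurv f p (hhCurv f p x y p.2) b = 0 := by
  have h := bianchi_second hf.isOpen hf.contDiffOn_connForm hp (0, b) (horLift f p x)
    (horLift f p y)
  simp only [← curv_eq_formCurv, connForm_horLift, connForm_fibre] at h
  rw [hf.fderiv_curv hp, hf.fderiv_curv hp, hf.fderiv_curv hp] at h
  have e : ∀ x, (horLift f p x).1 = x := fun _ => rfl
  rw [curv_antisymm f p (0, b)] at h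
  simp only [vertPart_horLift, vertPart_fibre, e, map_zero, _root_.zero_apply, zero_add, add_zero,
    sub_zero, zero_sub, ContinuousLinearMap.neg_comp, ContinuousLinearMap.comp_neg,
    ← hvCurvL_apply, ← hhCurv_apply] at h
  rw [vvCurv_antisymm f p b] at h
  rw [← hf.fderiv_nonlin_horLift hp]
  simp only [map_sub, _root_.sub_apply]
  rw [← h]
  abel

theorem bianchi_second_vvh (hp : p ∈ slit O) (a b c : E) :
    (fderiv ℝ (vvCurv f) p (horLift f p c) a b + ((christoffel f p c).comp (vvCurv f p a b)
      - (vvCurv f p a b).comp (christoffel f p c)))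
    + (fderiv ℝ (hvCurvL f) p (0, b) c a + ((cartanTensor f p b).comp (hvCurvL f p c a)
      - (hvCurvL f p c a).comp (cartanTensor f p b)))
    - (fderiv ℝ (hvCurvL f) p (0, a) c b + ((cartanTensor f p a).comp (hvCurvL f p c b)
      - (hvCurvL f p c b).comp (cartanTensor f p a)))
    + vvCurv f p (fderiv ℝ (nonlin f) p (0, b) c) a
    - vvCurv f p (fderiv ℝ (nonlin f) p (0, a) c) b = 0 := by
  have h := bianchi_second hf.isOpen hf.contDiffOn_connForm hp (0, a) (0, b) (horLift f p c)
  simp only [← curv_eq_formCurv, connForm_horLift, connForm_fibre] at h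
  rw [hf.fderiv_curv hp, hf.fderiv_curv hp, hf.fderiv_curv hp] at h
  have e : ∀ x, (horLift f p x).1 = x := fun _ => rfl
  rw [curv_antisymm f p (0, b)] at h
  simp only [vertPart_horLift, vertPart_fibre, e, map_zero, _root_.zero_apply, zero_add, add_zero,
    sub_zero, zero_sub, ContinuousLinearMap.neg_comp, ContinuousLinearMap.comp_neg,
    ← hvCurvL_apply, ← vvCurv_apply] at h
  rw [vvCurv_antisymm f p b] at h
  rw [← h]
  abel

theorem curv_skew (hp : p ∈ slit O) (A B : E × E) (c d : E) :
    fundTensor f p (curv f p A B c) d = - fundTensor f p (curv f p A B d) c := by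
  have h := formCurv_skew hf.isOpen hf.contDiffOn_connForm hf.contDiffOn_fundTensor
    (fun q hq A c d => hf.fderiv_fundTensor hq A c d) hp A B c d
  rw [hf.fundTensor_symm hp c] at h
  exact eq_neg_of_add_eq_zero_left h

end IsLocalFinsler

end CartanCurvature

/-! ### Covariant derivative along the geodesic spray; P vanishes on the canonical section -/

section Landsberg

variable {E : Type*} [NormedAddCommGroup E] [NormedSpace ℝ E]

/-- The commutator of endomorphisms. -/
def opComm (A B : E →L[ℝ] E) : E →L[ℝ] E := A.comp B - B.comp A

/-- The value of the geodesic spray vector field. -/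
def sprayVec (f : E × E → ℝ) (p : E × E) : E × E := horLift f p p.2

/-- The covariant derivative along the geodesic spray of a field of endomorphisms. -/
def sprayDeriv (f : E × E → ℝ) (K : E × E → E →L[ℝ] E) (p : E × E) : E →L[ℝ] E :=
  fderiv ℝ K p (sprayVec f p) + opComm (nonlin f p) (K p)

/-- The covariant derivative along the geodesic spray of an endomorphism valued one-form. -/
def sprayDerivForm (f : E × E → ℝ) (T : E × E → E →L[ℝ] E →L[ℝ] E) (p : E × E) :
    E →L[ℝ] E →L[ℝ] E :=
  fderiv ℝ T p (sprayVec f p) + (ContinuousLinearMap.compL ℝ E E E (nonlin f p)).comp (T p)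
    - ((ContinuousLinearMap.compL ℝ E E E).flip (nonlin f p)).comp (T p)
    - (T p).comp (nonlin f p)

/-- The Landsberg tensor, the derivative of the Cartan tensor along the geodesic spray. -/
def landsberg (f : E × E → ℝ) : E × E → E →L[ℝ] E →L[ℝ] E := sprayDerivForm f (cartanTensor f)

theorem sprayDerivForm_apply (f : E × E → ℝ) (T : E × E → E →L[ℝ] E →L[ℝ] E) (p : E × E) (b : E) :
    sprayDerivForm f T p b = fderiv ℝ T p (sprayVec f p) b + opComm (nonlin f p) (T p b)
      - T p (nonlin f p b) := by
  rw [opComm, ← add_sub_assoc]; rfl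

theorem opComm_antisymm (A B : E →L[ℝ] E) : opComm A B = - opComm B A := by
  unfold opComm; abel

/-- The extra term T(N b) appears because b is held constant and is therefore not parallel along the
spray. -/
theorem sprayDeriv_apply {f : E × E → ℝ} {T : E × E → E →L[ℝ] E →L[ℝ] E} {p : E × E}
    (hT : DifferentiableAt ℝ T p) (b : E) :
    sprayDeriv f (fun q => T q b) p = sprayDerivForm f T p b + T p (nonlin f p b) := by
  rw [sprayDerivForm_apply, sprayDeriv, fderiv_apply_const hT]
  abel

theorem sprayDeriv_congr {f : E × E → ℝ} {S : Set (E × E)} (hS : IsOpen S)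
    {K K' : E × E → E →L[ℝ] E} (h : ∀ q ∈ S, K q = K' q) {p : E × E} (hp : p ∈ S) :
    sprayDeriv f K p = sprayDeriv f K' p := by
  rw [sprayDeriv, sprayDeriv, fderiv_congr_of_isOpen hS h hp, h p hp]

theorem sprayDeriv_opComm {f : E × E → ℝ} {K K' : E × E → E →L[ℝ] E} {p : E × E}
    (hK : DifferentiableAt ℝ K p) (hK' : DifferentiableAt ℝ K' p) :
    sprayDeriv f (fun q => opComm (K q) (K' q)) p =
      opComm (sprayDeriv f K p) (K' p) + opComm (K p) (sprayDeriv f K' p) := by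
  unfold sprayDeriv
  have h : fderiv ℝ (fun q => opComm (K q) (K' q)) p (sprayVec f p) =
      opComm (fderiv ℝ K p (sprayVec f p)) (K' p) + opComm (K p) (fderiv ℝ K' p (sprayVec f p)) := by
    unfold opComm
    rw [fderiv_fun_sub (hK.clm_comp hK') (hK'.clm_comp hK), _root_.sub_apply,
      fderiv_mul_apply hK hK', fderiv_mul_apply hK' hK]
    abel
  rw [h]
  ext c
  simp only [opComm, _root_.add_apply, _root_.sub_apply, ContinuousLinearMap.comp_apply, map_add,
    map_sub]
  abel

theorem sprayDeriv_add {f : E × E → ℝ} {K K' : E × E → E →L[ℝ] E} {p : E × E}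
    (hK : DifferentiableAt ℝ K p) (hK' : DifferentiableAt ℝ K' p) :
    sprayDeriv f (fun q => K q + K' q) p = sprayDeriv f K p + sprayDeriv f K' p := by
  unfold sprayDeriv opComm
  rw [fderiv_fun_add hK hK', _root_.add_apply, ContinuousLinearMap.comp_add,
    ContinuousLinearMap.add_comp]
  abel

theorem sprayDeriv_neg {f : E × E → ℝ} {K : E × E → E →L[ℝ] E} {p : E × E} :
    sprayDeriv f (fun q => - K q) p = - sprayDeriv f K p := by
  unfold sprayDeriv opComm
  rw [fderiv_fun_neg, _root_.neg_apply, ContinuousLinearMap.comp_neg,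
    ContinuousLinearMap.neg_comp]
  abel

theorem opComm_add_left (A A' B : E →L[ℝ] E) : opComm (A + A') B = opComm A B + opComm A' B := by
  unfold opComm; rw [ContinuousLinearMap.comp_add, ContinuousLinearMap.add_comp]; abel

theorem opComm_add_right (A B B' : E →L[ℝ] E) : opComm A (B + B') = opComm A B + opComm A B' := by
  unfold opComm; rw [ContinuousLinearMap.comp_add, ContinuousLinearMap.add_comp]; abel

theorem opComm_smul_left (r : ℝ) (A B : E →L[ℝ] E) : opComm (r • A) B = r • opComm A B := by
  unfold opComm; rw [ContinuousLinearMap.comp_smul, ContinuousLinearMap.smul_comp, smul_sub]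

theorem opComm_smul_right (r : ℝ) (A B : E →L[ℝ] E) : opComm A (r • B) = r • opComm A B := by
  unfold opComm; rw [ContinuousLinearMap.comp_smul, ContinuousLinearMap.smul_comp, smul_sub]

namespace IsLocalFinsler

variable {f : E × E → ℝ} {O : Set E} (hf : IsLocalFinsler f O) {p : E × E}
variable [FiniteDimensional ℝ E]
include hf

theorem contDiffOn_sprayVec : ContDiffOn ℝ ∞ (sprayVec f) (slit O) :=
  hf.contDiffOn_horLift.clm_apply contDiff_snd.contDiffOn

theorem contDiffOn_sprayDerivForm {T : E × E → E →L[ℝ] E →L[ℝ] E}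
    (hT : ContDiffOn ℝ ∞ T (slit O)) : ContDiffOn ℝ ∞ (sprayDerivForm f T) (slit O) :=
  ((((contDiffOn_fderiv hf.isOpen hT).clm_apply hf.contDiffOn_sprayVec).add
    (((ContinuousLinearMap.compL ℝ E E E).contDiff.comp_contDiffOn
      hf.contDiffOn_nonlin).clm_comp hT)).sub
    (((ContinuousLinearMap.compL ℝ E E E).flip.contDiff.comp_contDiffOn
      hf.contDiffOn_nonlin).clm_comp hT)).sub (hT.clm_comp hf.contDiffOn_nonlin)

theorem contDiffOn_landsberg : ContDiffOn ℝ ∞ (landsberg f) (slit O) :=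
  hf.contDiffOn_sprayDerivForm hf.contDiffOn_cartanTensor

theorem differentiableAt_landsberg (hp : p ∈ slit O) : DifferentiableAt ℝ (landsberg f) p :=
  differentiableAt_of_contDiffOn hf.isOpen hf.contDiffOn_landsberg hp

omit hf [FiniteDimensional ℝ E] in
theorem sprayVec_eq (p : E × E) : sprayVec f p = (p.2, -nonlin f p p.2) := rfl

theorem christoffel_eq_nonlin (hp : p ∈ slit O) : christoffel f p p.2 = nonlin f p :=
  ContinuousLinearMap.ext fun a => hf.christoffel_vec' hp a

theorem fderiv_cartanTensor_vec (hp : p ∈ slit O) (A : E × E) (b : E) :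
    fderiv ℝ (cartanTensor f) p A b p.2 = - cartanTensor f p b A.2 := by
  have h := congrArg (fun L => L A) (fderiv_congr_of_isOpen hf.isOpen
    (fun q hq => hf.cartanTensor_vec hq b) hp)
  beta_reduce at h
  rw [fderiv_apply_apply ((hf.differentiableAt_cartanTensor hp).clm_apply
    (differentiableAt_const _)) differentiableAt_snd,
    fderiv_apply_const (hf.differentiableAt_cartanTensor hp), fderiv_snd] at h
  refine eq_neg_of_add_eq_zero_left ?_
  simpa using h

theorem fderiv_cartanTensor_symm (hp : p ∈ slit O) (A : E × E) (b c : E) :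
    fderiv ℝ (cartanTensor f) p A b c = fderiv ℝ (cartanTensor f) p A c b := by
  have d := hf.differentiableAt_cartanTensor hp
  have h := congrArg (fun L => L A) (fderiv_congr_of_isOpen hf.isOpen
    (fun q hq => hf.cartanTensor_symm hq b c) hp)
  beta_reduce at h
  rwa [fderiv_apply_apply_const d, fderiv_apply_apply_const d] at h

/-- The derivative of the total symmetry of the Cartan tensor. -/
theorem fundTensor_fderiv_cartanTensor (hp : p ∈ slit O) (A : E × E) (a b c : E) :
    fundTensor f p (fderiv ℝ (cartanTensor f) p A a b + connForm f p A (cartanTensor f p a b)) c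
      + fundTensor f p (cartanTensor f p a b) (connForm f p A c) =
    fundTensor f p (fderiv ℝ (cartanTensor f) p A a c + connForm f p A (cartanTensor f p a c)) b
      + fundTensor f p (cartanTensor f p a c) (connForm f p A b) := by
  have d := hf.differentiableAt_cartanTensor hp
  have dg := hf.differentiableAt_fundTensor hp
  have h := congrArg (fun L => L A) (fderiv_congr_of_isOpen hf.isOpen
    (fun q hq => hf.fundTensor_cartanTensor_comm hq a b c) hp)
  have c0 : ∀ x : E, DifferentiableAt ℝ (fun _ : E × E => x) p := fun x => differentiableAt_const x
  beta_reduce at h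
  have e : ∀ x y, DifferentiableAt ℝ (fun q => cartanTensor f q x y) p := fun x y =>
    (d.clm_apply (c0 x)).clm_apply (c0 y)
  rw [fderiv_apply_apply₂ dg (e _ _) (c0 _), fderiv_apply_apply₂ dg (e _ _) (c0 _),
    fderiv_apply_apply_const d, fderiv_apply_apply_const d, hf.fderiv_fundTensor hp,
    hf.fderiv_fundTensor hp] at h
  simp only [fderiv_fun_const, Pi.zero_apply, _root_.zero_apply, map_zero, add_zero] at h
  simp only [map_add, _root_.add_apply]
  linarith

omit hf [FiniteDimensional ℝ E] in
/-- A tensor that is skew in its last two slots is determined by its alternation in the first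
two. -/
theorem two_mul_of_skew {g : E →L[ℝ] E →L[ℝ] ℝ} {P : E → E → E} {τ : E → E → E → ℝ}
    (hP : ∀ a c d, g (P a c) d = - g (P a d) c)
    (hτ : ∀ a c d, g (P c a) d - g (P a c) d = τ a c d) (a c d : E) :
    2 * g (P a c) d = τ c d a + τ a d c - τ a c d := by
  rw [← hτ, ← hτ, ← hτ]
  -- Koszul's argument: in the combination of three alternations the skew pairs cancel and twice one
  -- term remains.
  have h1 := hP a c d
  have h2 := hP c a d
  have h3 := hP d a c
  linarith

/-- The `hv`-curvature vanishes if its horizontal argument is the canonical section. -/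
theorem hvCurvL_vec (hp : p ∈ slit O) (b : E) : hvCurvL f p p.2 b = 0 := by
  ext c
  refine hf.fundTensor_ext hp fun d => ?_
  -- P is skew in its last two slots because the connection is metric, and its alternation is given
  -- by the first Bianchi identity. With v in the first slot, homogeneity and the total symmetry of
  -- C make all the resulting terms cancel.
  have h := two_mul_of_skew (g := fundTensor f p) (P := fun a c => hvCurvL f p a b c)
    (fun a c d => hf.curv_skew hp _ _ c d)
    (fun a c d => show _ = fundTensor f p (hvCurvL f p c b a - hvCurvL f p a b c) d by
      rw [map_sub, _root_.sub_apply]) p.2 c d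
  have eC := hf.cartanTensor_symm hp
  -- the right-hand side of the first Bianchi identity paired with a vector
  have key : ∀ a c d, fundTensor f p (hvCurvL f p c b a - hvCurvL f p a b c) d =
      fundTensor f p (cartanTensor f p (fderiv ℝ (nonlin f) p (0, b) a) c) d
      - fundTensor f p (cartanTensor f p (fderiv ℝ (nonlin f) p (0, b) c) a) d
      - fundTensor f p (fderiv ℝ (cartanTensor f) p (horLift f p a) b c
        + connForm f p (horLift f p a) (cartanTensor f p b c)) d
      + fundTensor f p (fderiv ℝ (cartanTensor f) p (horLift f p c) b a
        + connForm f p (horLift f p c) (cartanTensor f p b a)) d := by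
    intro a c d
    rw [hf.bianchi_first_vhh hp, connForm_horLift, connForm_horLift]
    simp only [map_add, map_sub, _root_.add_apply, _root_.sub_apply]
    ring
  rw [key, key, key] at h
  have s1 := hf.fundTensor_fderiv_cartanTensor hp (horLift f p p.2) b c d
  have s2 := hf.fundTensor_fderiv_cartanTensor hp (horLift f p c) b p.2 d
  have s3 := hf.fundTensor_fderiv_cartanTensor hp (horLift f p d) b p.2 c
  have hv : ∀ x y, fundTensor f p (cartanTensor f p x y) p.2 = 0 := fun x y => by
    rw [hf.fundTensor_cartanTensor_comm hp, hf.cartanTensor_vec hp, map_zero, _root_.zero_apply]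
  have comm := hf.fundTensor_cartanTensor_comm hp
  have e2 : ∀ a, (horLift f p a).2 = - nonlin f p a := fun _ => rfl
  have hB := hf.fderiv_nonlin_fibre_vec hp b
  simp only [hf.fderiv_cartanTensor_vec hp, hf.cartanTensor_vec hp, map_zero, add_zero,
    connForm_horLift, hf.christoffel_vec hp, hf.christoffel_vec' hp, e2, map_neg, neg_neg, hB, hv,
    _root_.zero_apply, map_add, _root_.add_apply, sub_zero, zero_sub] at h s1 s2 s3 ⊢
  have t1 := comm b (nonlin f p c) d
  have t2 := comm b (nonlin f p d) c
  have t3 := comm (nonlin f p b) c d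
  have t4 := hf.cartanTensor_symm hp b (nonlin f p c)
  have t5 := hf.cartanTensor_symm hp b (nonlin f p d)
  have t6 := hf.cartanTensor_symm hp b c
  have t7 := hf.cartanTensor_symm hp b d
  linarith

end IsLocalFinsler
end Landsberg

/-! ### The modified curvature, the Landsberg tensor and the antisymmetric part of P -/

section Nullity

variable {E : Type*} [NormedAddCommGroup E] [NormedSpace ℝ E]

/-- The curvature `k (g(b, ·) a - g(a, ·) b)` of constant curvature type. -/
def constCurv (f : E × E → ℝ) (k : ℝ) (p : E × E) : E →L[ℝ] E →L[ℝ] E →L[ℝ] E :=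
  k • (((ContinuousLinearMap.smulRightL ℝ E E).comp (fundTensor f p)).flip
    - (ContinuousLinearMap.smulRightL ℝ E E).comp (fundTensor f p))

/-- The difference of the `hh`-curvature and the curvature of constant curvature type. -/
def modHH (f : E × E → ℝ) (k : ℝ) (p : E × E) : E →L[ℝ] E →L[ℝ] E →L[ℝ] E :=
  hhCurv f p - constCurv f k p

theorem constCurv_apply (f : E × E → ℝ) (k : ℝ) (p : E × E) (a b z : E) :
    constCurv f k p a b z = k • (fundTensor f p b z • a - fundTensor f p a z • b) := rfl

theorem modHH_apply (f : E × E → ℝ) (k : ℝ) (p : E × E) (a b : E) :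
    modHH f k p a b = hhCurv f p a b - constCurv f k p a b := rfl

theorem constCurv_antisymm (f : E × E → ℝ) (k : ℝ) (p : E × E) (a b : E) :
    constCurv f k p a b = - constCurv f k p b a := by
  ext z
  rw [_root_.neg_apply, constCurv_apply, constCurv_apply, ← smul_neg, neg_sub]

theorem modHH_antisymm (f : E × E → ℝ) (k : ℝ) (p : E × E) (a b : E) :
    modHH f k p a b = - modHH f k p b a := by
  rw [modHH_apply, modHH_apply, constCurv_antisymm, hhCurv_antisymm]; abel

/-- A tangent vector at `x` that lies in the `k`-nullity space for all nonzero vectors over `x`. -/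
def IsNull (f : E × E → ℝ) (k : ℝ) (x X : E) : Prop :=
  ∀ v : E, v ≠ 0 → modHH f k (x, v) X = 0

theorem fderiv_eq_zero_of_curve {V G : Type*} [NormedAddCommGroup V] [NormedSpace ℝ V]
    [NormedAddCommGroup G] [NormedSpace ℝ G] {F : V → G} {c : ℝ → V} {A : V}
    (hF : DifferentiableAt ℝ F (c 0)) (hc : HasDerivAt c A 0) (h : ∀ᶠ t in 𝓝 0, F (c t) = 0) :
    fderiv ℝ F (c 0) A = 0 := by
  have h1 := hF.hasFDerivAt.comp_hasDerivAt (0 : ℝ) hc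
  have h2 : F ∘ c =ᶠ[𝓝 0] fun _ => (0 : G) := h
  exact (h1.congr_of_eventuallyEq h2.symm).unique (hasDerivAt_const _ _)

theorem modHH_ext {f : E × E → ℝ} {k : ℝ} {p : E × E} {a : E} (h : modHH f k p a = 0) (b : E) :
    hhCurv f p a b = constCurv f k p a b := by
  have := congrArg (fun L => L b) h
  exact sub_eq_zero.1 this

theorem modHH_ext' {f : E × E → ℝ} {k : ℝ} {p : E × E} {a : E} (h : modHH f k p a = 0) (b : E) :
    hhCurv f p b a = constCurv f k p b a := by
  rw [hhCurv_antisymm, constCurv_antisymm, modHH_ext h]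

namespace IsLocalFinsler

variable {f : E × E → ℝ} {O : Set E} (hf : IsLocalFinsler f O) {p : E × E} {k : ℝ}
variable [FiniteDimensional ℝ E]
include hf

/-- First Bianchi identity with v as a horizontal argument: P(v, ·) = 0 and C(·, v) = 0 leave only
the derivative of C along the spray. -/
theorem hvCurvL_apply_vec (hp : p ∈ slit O) (a b : E) :
    hvCurvL f p a b p.2 = - landsberg f p b a := by
  have h := hf.bianchi_first_vhh hp a b p.2
  have e2 : (horLift f p a).2 = - nonlin f p a := rfl
  rw [hf.hvCurvL_vec hp, hf.cartanTensor_vec hp, hf.cartanTensor_vec hp, map_zero,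
    hf.fderiv_nonlin_fibre_vec hp, hf.fderiv_cartanTensor_vec hp, hf.christoffel_vec' hp, e2,
    map_neg, hf.cartanTensor_symm hp (nonlin f p b)] at h
  rw [landsberg, sprayDerivForm_apply, opComm]
  rw [hf.cartanTensor_symm hp _ (nonlin f p b)] at h
  simp only [_root_.zero_apply, zero_sub, neg_eq_iff_eq_neg] at h
  rw [h]
  simp only [_root_.sub_apply, _root_.add_apply, ContinuousLinearMap.comp_apply, sprayVec]
  abel

theorem landsberg_symm (hp : p ∈ slit O) (a b : E) : landsberg f p a b = landsberg f p b a := by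
  rw [landsberg, sprayDerivForm_apply, sprayDerivForm_apply, opComm, opComm]
  simp only [_root_.sub_apply, _root_.add_apply, ContinuousLinearMap.comp_apply]
  rw [hf.fderiv_cartanTensor_symm hp, hf.cartanTensor_symm hp a b,
    hf.cartanTensor_symm hp a (nonlin f p b), hf.cartanTensor_symm hp b (nonlin f p a)]
  abel

/-- C is half the fibre derivative of g with an index raised. Second fibre derivatives of g commute,
so the asymmetry comes only from the raised index, whose derivative is again given by 2C. -/
theorem fderiv_cartanTensor_fibre (hp : p ∈ slit O) (a b : E) :
    fderiv ℝ (cartanTensor f) p (0, a) b - fderiv ℝ (cartanTensor f) p (0, b) a =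
      (-2 : ℝ) • opComm (cartanTensor f p a) (cartanTensor f p b) := by
  have d := hf.differentiableAt_cartanTensor hp
  have dg := hf.differentiableAt_fundTensor hp
  have d2 := differentiableAt_fderiv hf.isOpen hf.contDiffOn_fundTensor hp
  have c0 : ∀ x : E, DifferentiableAt ℝ (fun _ : E × E => x) p := fun x => differentiableAt_const x
  have e : ∀ x y, DifferentiableAt ℝ (fun q => cartanTensor f q x y) p := fun x y =>
    (d.clm_apply (c0 x)).clm_apply (c0 y)
  ext c
  refine hf.fundTensor_ext hp fun w => ?_
  have key : ∀ a b, 2 * (fderiv ℝ (fundTensor f) p (0, a) (cartanTensor f p b c) w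
      + fundTensor f p (fderiv ℝ (cartanTensor f) p (0, a) b c) w) =
      fderiv ℝ (fderiv ℝ (fundTensor f)) p (0, a) (0, b) c w := by
    intro a b
    have h := congrArg (fun L => L (0, a)) (fderiv_congr_of_isOpen hf.isOpen
      (fun q hq => hf.fundTensor_cartanTensor hq b c w) hp)
    beta_reduce at h
    rw [fderiv_const_mul ((dg.clm_apply (e _ _)).clm_apply (c0 _)), _root_.smul_apply,
      fderiv_apply_apply₂ dg (e _ _) (c0 _), fderiv_apply_apply_const d,
      fderiv_apply_apply_const (d2.clm_apply (differentiableAt_const _)),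
      fderiv_apply_const d2] at h
    simpa using h
  have h1 := key a b
  have h2 := key b a
  rw [fderiv_fderiv_comm hf.isOpen hf.contDiffOn_fundTensor hp] at h2
  rw [← hf.fundTensor_cartanTensor hp] at h1 h2
  simp only [opComm, _root_.sub_apply, _root_.smul_apply, ContinuousLinearMap.comp_apply, map_sub,
    map_smul, smul_eq_mul]
  linarith

/-- Along a fibre the connection form is C, and the commutator term of its curvature adds [C, C] to
the alternation -2[C, C]. -/
theorem vvCurv_eq (hp : p ∈ slit O) (a b : E) :
    vvCurv f p a b = - opComm (cartanTensor f p a) (cartanTensor f p b) := by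
  have h := hf.fderiv_cartanTensor_fibre hp a b
  have d := hf.differentiableAt_connForm hp
  have e : ∀ x y, fderiv ℝ (connForm f) p (0, x) (0, y) =
      fderiv ℝ (cartanTensor f) p (0, x) y := by
    intro x y
    rw [← fderiv_apply_const d, ← fderiv_apply_const (hf.differentiableAt_cartanTensor hp)]
    simp only [connForm_fibre]
  rw [vvCurv_apply, curv, e, e, connForm_fibre, connForm_fibre, h, add_sub_assoc]
  change _ + opComm _ _ = _
  module

theorem fderiv_hvCurvL_vec (hp : p ∈ slit O) (A : E × E) (b : E) :
    fderiv ℝ (hvCurvL f) p A p.2 b = - hvCurvL f p A.2 b := by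
  have h := congrArg (fun L => L A) (fderiv_congr_of_isOpen hf.isOpen
    (fun q hq => hf.hvCurvL_vec hq b) hp)
  beta_reduce at h
  rw [fderiv_apply_apply₂ (hf.differentiableAt_hvCurvL hp) differentiableAt_snd
    (differentiableAt_const _), fderiv_snd] at h
  refine eq_neg_of_add_eq_zero_left ?_
  simpa using h

/-- The antisymmetric part of the `hv`-curvature. -/
theorem hvCurvL_sub (hp : p ∈ slit O) (a b : E) :
    hvCurvL f p a b - hvCurvL f p b a =
      opComm (landsberg f p a) (cartanTensor f p b)
        + opComm (cartanTensor f p a) (landsberg f p b) := by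
  -- With horizontal argument v, the fibre derivative of P(v, ·) = 0 turns this identity into P(a,
  -- b) - P(b, a) = -∇_S Q(a, b). Leibniz on Q = -[C, C] finishes.
  have h := hf.bianchi_second_vvh hp a b p.2
  have d := hf.differentiableAt_cartanTensor hp
  have h1 := sprayDeriv_congr (f := f) hf.isOpen (fun q hq => hf.vvCurv_eq hq a b) hp
  have c0 : ∀ x : E, DifferentiableAt ℝ (fun _ : E × E => x) p := fun x => differentiableAt_const x
  rw [sprayDeriv_neg, sprayDeriv_opComm (d.clm_apply (c0 a)) (d.clm_apply (c0 b)),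
    sprayDeriv_apply d, sprayDeriv_apply d, sprayDeriv,
    fderiv_apply_apply_const (hf.differentiableAt_vvCurv hp)] at h1
  change fderiv ℝ (vvCurv f) p (sprayVec f p) a b + _ + _ - _ + _ - _ = 0 at h
  rw [hf.fderiv_hvCurvL_vec hp, hf.fderiv_hvCurvL_vec hp, hf.hvCurvL_vec hp, hf.hvCurvL_vec hp,
    hf.fderiv_nonlin_fibre_vec hp, hf.fderiv_nonlin_fibre_vec hp, hf.christoffel_eq_nonlin hp] at h
  change fderiv ℝ (vvCurv f) p (sprayVec f p) a b + opComm _ _ + (_ + opComm _ _)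
    - (_ + opComm _ _) + _ - _ = 0 at h
  rw [h1, hf.vvCurv_eq hp, hf.vvCurv_eq hp (nonlin f p a)] at h
  simp only [opComm_add_left, opComm_add_right] at h
  rw [opComm_antisymm (cartanTensor f p (nonlin f p b))] at h
  have z : ∀ A : E →L[ℝ] E, opComm A 0 = 0 := fun A => by simp [opComm]
  simp only [z] at h
  rw [← sub_eq_zero, ← h]
  simp only [landsberg]
  abel

omit [FiniteDimensional ℝ E] in
theorem contDiffOn_constCurv : ContDiffOn ℝ ∞ (constCurv f k) (slit O) := by
  have h : ContDiffOn ℝ ∞ (fun q => (ContinuousLinearMap.smulRightL ℝ E E).comp (fundTensor f q))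
    (slit O) := contDiffOn_const.clm_comp hf.contDiffOn_fundTensor
  exact ContDiffOn.const_smul k ((contDiffOn_flip h).sub h)

theorem contDiffOn_modHH : ContDiffOn ℝ ∞ (modHH f k) (slit O) :=
  hf.contDiffOn_hhCurv.sub hf.contDiffOn_constCurv

theorem differentiableAt_modHH (hp : p ∈ slit O) : DifferentiableAt ℝ (modHH f k) p :=
  differentiableAt_of_contDiffOn hf.isOpen hf.contDiffOn_modHH hp

omit [FiniteDimensional ℝ E] in
theorem fderiv_constCurv (hp : p ∈ slit O) (A : E × E) (a b z : E) :
    fderiv ℝ (constCurv f k) p A a b z = k • (fderiv ℝ (fundTensor f) p A b z • a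
      - fderiv ℝ (fundTensor f) p A a z • b) := by
  have d := differentiableAt_of_contDiffOn hf.isOpen (hf.contDiffOn_constCurv (k := k)) hp
  have dg := hf.differentiableAt_fundTensor hp
  have c0 : ∀ x : E, DifferentiableAt ℝ (fun _ : E × E => x) p := fun x => differentiableAt_const x
  rw [← fderiv_apply_apply_const d, ← fderiv_apply_const ((d.clm_apply (c0 a)).clm_apply (c0 b))]
  simp only [constCurv_apply]
  have e : ∀ x y, DifferentiableAt ℝ (fun q => fundTensor f q x y) p := fun x y =>
    (dg.clm_apply (c0 x)).clm_apply (c0 y)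
  rw [fderiv_fun_const_smul (((e b z).fun_smul (c0 a)).fun_sub ((e a z).fun_smul (c0 b))),
    fderiv_fun_sub ((e b z).fun_smul (c0 a)) ((e a z).fun_smul (c0 b)), fderiv_fun_smul (e b z) (c0 a),
    fderiv_fun_smul (e a z) (c0 b)]
  simp [fderiv_apply_apply_const dg]

theorem fderiv_modHH (hp : p ∈ slit O) (A : E × E) :
    fderiv ℝ (modHH f k) p A = fderiv ℝ (hhCurv f) p A - fderiv ℝ (constCurv f k) p A := by
  unfold modHH
  rw [fderiv_fun_sub (hf.differentiableAt_hhCurv hp)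
    (differentiableAt_of_contDiffOn hf.isOpen hf.contDiffOn_constCurv hp), _root_.sub_apply]

/-- Direction independence at work: R̄(X) vanishes on the whole punctured fibre, hence so do its
fibre derivatives. -/
theorem fderiv_modHH_fibre (hp : p ∈ slit O) {X : E} (hX : IsNull f k p.1 X) (b : E) :
    fderiv ℝ (modHH f k) p (0, b) X = 0 := by
  have hc : HasDerivAt (fun t : ℝ => ((p.1, p.2 + t • b) : E × E)) (0, b) 0 := by
    have := (hasDerivAt_const (0 : ℝ) p.1).prodMk
      (((hasDerivAt_id (0 : ℝ)).smul_const b).const_add p.2)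
    simpa using this
  have h0 : ((p.1, p.2 + (0 : ℝ) • b) : E × E) = p := by simp
  have hev : ∀ᶠ t : ℝ in 𝓝 0, p.2 + t • b ≠ 0 := by
    have : Tendsto (fun t : ℝ => p.2 + t • b) (𝓝 0) (𝓝 p.2) := by
      have hcont : Continuous fun t : ℝ => p.2 + t • b := by fun_prop
      simpa using hcont.tendsto 0
    exact this.eventually_ne (mem_slit.1 hp).2
  have hF : DifferentiableAt ℝ (fun q => modHH f k q X) (p.1, p.2 + (0 : ℝ) • b) := by
    rw [h0]; exact (hf.differentiableAt_modHH hp).clm_apply (differentiableAt_const _)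
  have := fderiv_eq_zero_of_curve hF hc (by filter_upwards [hev] with t ht using hX _ ht)
  rwa [h0, fderiv_apply_const (hf.differentiableAt_modHH hp)] at this

/-- The `vhh`-Bianchi identity at a point where the canonical section is a nullity vector. -/
theorem sprayDeriv_hvCurvL (hp : p ∈ slit O) (hX : IsNull f k p.1 p.2) (y b c : E) :
    (sprayDeriv f (fun q => hvCurvL f q y b) p - hvCurvL f p (nonlin f p y) b
      - hvCurvL f p y (nonlin f p b)) c
    = (k * fundTensor f p p.2 p.2) • vvCurv f p y b c
      - k • (fundTensor f p (cartanTensor f p b y) c • p.2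
        - fundTensor f p p.2 c • cartanTensor f p b y) := by
  have h := congrArg (fun L => L c) (hf.bianchi_second_vhh hp b p.2 y)
  have hX0 : modHH f k p p.2 = 0 := hX p.2 (mem_slit.1 hp).2
  -- Because v is null in all directions, R(v, y) may be replaced by the constant curvature model
  -- even under a fibre derivative.
  have h1 : fderiv ℝ (hhCurv f) p (0, b) p.2 y = fderiv ℝ (constCurv f k) p (0, b) p.2 y := by
    have := hf.fderiv_modHH_fibre hp hX b
    rw [hf.fderiv_modHH hp, _root_.sub_apply, sub_eq_zero] at this
    rw [this]
  have e2 : (horLift f p y).2 = - nonlin f p y := rfl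
  have e3 : vvCurv f p p.2 b = 0 := by
    rw [hf.vvCurv_eq hp, hf.cartanTensor_vec_eq_zero hp]; simp [opComm]
  rw [h1, hf.hvCurvL_vec hp, hf.hvCurvL_vec hp, hf.fderiv_nonlin_fibre_vec hp,
    hf.fderiv_hvCurvL_vec hp, e2, modHH_ext hX0, constCurv_apply, hf.christoffel_eq_nonlin hp] at h
  rw [sprayDeriv, fderiv_apply_apply_const (hf.differentiableAt_hvCurvL hp), opComm]
  simp only [_root_.sub_apply, _root_.add_apply, ContinuousLinearMap.comp_apply, map_zero,
    _root_.zero_apply, map_neg, _root_.neg_apply, hf.fderiv_constCurv hp, constCurv_apply,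
    map_smul, map_sub, hf.fderiv_fundTensor hp, connForm_fibre, _root_.smul_apply, e3,
    hf.cartanTensor_vec hp] at h ⊢
  have e4 : sprayVec f p = horLift f p p.2 := rfl
  have e5 := hf.fundTensor_symm hp p.2 (cartanTensor f p b c)
  have e6 : fundTensor f p (cartanTensor f p b c) p.2 = 0 := by
    rw [hf.fundTensor_cartanTensor_comm hp, hf.cartanTensor_vec hp, map_zero, _root_.zero_apply]
  rw [e4, ← sub_eq_zero, ← h, e5, e6]
  module

end IsLocalFinsler
end Nullity

/-! ### Consequences of the Bianchi identities in a null direction -/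

section NullityIntegrability

variable {E : Type*} [NormedAddCommGroup E] [NormedSpace ℝ E]

namespace IsLocalFinsler

variable {f : E × E → ℝ} {O : Set E} (hf : IsLocalFinsler f O) {p : E × E} {k : ℝ}
variable [FiniteDimensional ℝ E]
include hf

/-- In a nullity direction, the Landsberg tensor satisfies a Jacobi type equation. -/
theorem sprayDerivForm_landsberg (hp : p ∈ slit O) (hX : IsNull f k p.1 p.2) (b : E) :
    sprayDerivForm f (landsberg f) p b = (-(k * fundTensor f p p.2 p.2)) • cartanTensor f p b := by
  ext y
  -- Evaluated on v: P(y, b)v = -L_b y, while Q(y, b)v = 0 and g(C(b, y), v) = 0, so only k g(v, v)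
  -- C survives on the right.
  have h := hf.sprayDeriv_hvCurvL hp hX y b p.2
  have d := hf.differentiableAt_hvCurvL hp
  have dL := hf.differentiableAt_landsberg hp
  have c0 : ∀ x : E, DifferentiableAt ℝ (fun _ : E × E => x) p := fun x => differentiableAt_const x
  have h1 := congrArg (fun L => L (sprayVec f p)) (fderiv_congr_of_isOpen hf.isOpen
    (fun q hq => hf.hvCurvL_apply_vec hq y b) hp)
  beta_reduce at h1
  rw [fderiv_apply_apply ((d.clm_apply (c0 y)).clm_apply (c0 b)) differentiableAt_snd,
    fderiv_apply_apply_const d, fderiv_snd, fderiv_fun_neg, _root_.neg_apply,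
    fderiv_apply_apply_const dL] at h1
  have e2 : (ContinuousLinearMap.snd ℝ E E) (sprayVec f p) = - nonlin f p p.2 := rfl
  have e3 : vvCurv f p y b p.2 = 0 := by
    rw [hf.vvCurv_eq hp]; simp [opComm, hf.cartanTensor_vec hp]
  have e6 : fundTensor f p (cartanTensor f p b y) p.2 = 0 := by
    rw [hf.fundTensor_cartanTensor_comm hp, hf.cartanTensor_vec hp, map_zero, _root_.zero_apply]
  rw [sprayDeriv, fderiv_apply_apply_const d, opComm] at h
  rw [sprayDerivForm_apply, opComm]
  rw [e2] at h1
  simp only [_root_.sub_apply, _root_.add_apply, ContinuousLinearMap.comp_apply, map_neg, e3, e6,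
    hf.hvCurvL_apply_vec hp, smul_zero, zero_smul, _root_.smul_apply, zero_sub, smul_neg,
    neg_neg] at h h1 ⊢
  have h2 : fderiv ℝ (hvCurvL f) p (sprayVec f p) y b p.2 =
    hvCurvL f p y b (nonlin f p p.2) - fderiv ℝ (landsberg f) p (sprayVec f p) b y := by
    rw [sub_eq_neg_add, ← h1]; abel
  rw [h2, smul_smul] at h
  rw [neg_smul, ← h]
  abel

/-- In a nullity direction, the Landsberg endomorphisms commute. -/
theorem opComm_landsberg (hp : p ∈ slit O) (hX : IsNull f k p.1 p.2) (a b : E) :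
    opComm (landsberg f p a) (landsberg f p b) = 0 := by
  have d := hf.differentiableAt_hvCurvL hp
  have dL := hf.differentiableAt_landsberg hp
  have dC := hf.differentiableAt_cartanTensor hp
  have c0 : ∀ x : E, DifferentiableAt ℝ (fun _ : E × E => x) p := fun x => differentiableAt_const x
  have dh : ∀ x y, DifferentiableAt ℝ (fun q => hvCurvL f q x y) p := fun x y =>
    (d.clm_apply (c0 x)).clm_apply (c0 y)
  have dLa : ∀ x, DifferentiableAt ℝ (fun q => landsberg f q x) p := fun x => dL.clm_apply (c0 x)
  have dCa : ∀ x, DifferentiableAt ℝ (fun q => cartanTensor f q x) p := fun x => dC.clm_apply (c0 x)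
  have dop : ∀ {K K' : E × E → E →L[ℝ] E}, DifferentiableAt ℝ K p → DifferentiableAt ℝ K' p →
      DifferentiableAt ℝ (fun q => opComm (K q) (K' q)) p := fun h h' =>
    (h.clm_comp h').fun_sub (h'.clm_comp h)
  have h1 := sprayDeriv_congr (f := f) hf.isOpen (fun q hq => hf.hvCurvL_sub hq a b) hp
  have hsub : sprayDeriv f (fun q => hvCurvL f q a b - hvCurvL f q b a) p =
      sprayDeriv f (fun q => hvCurvL f q a b) p - sprayDeriv f (fun q => hvCurvL f q b a) p := by
    simp only [sub_eq_add_neg]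
    rw [sprayDeriv_add (dh a b) (dh b a).fun_neg, sprayDeriv_neg]
  -- First evaluation of the spray derivative of P(a, b) - P(b, a): the terms in C(a, b) are
  -- symmetric and drop out, leaving 2k g(v, v) Q(a, b).
  have hab : sprayDeriv f (fun q => hvCurvL f q a b) p - sprayDeriv f (fun q => hvCurvL f q b a) p
      = (hvCurvL f p (nonlin f p a) b - hvCurvL f p b (nonlin f p a))
        + (hvCurvL f p a (nonlin f p b) - hvCurvL f p (nonlin f p b) a)
        + (2 * (k * fundTensor f p p.2 p.2)) • vvCurv f p a b := by
    ext c
    have s1 := hf.sprayDeriv_hvCurvL hp hX a b c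
    have s2 := hf.sprayDeriv_hvCurvL hp hX b a c
    rw [hf.cartanTensor_symm hp, vvCurv_antisymm] at s2
    simp only [_root_.sub_apply, _root_.add_apply, _root_.smul_apply, _root_.neg_apply] at s1 s2 ⊢
    rw [sub_sub, sub_eq_iff_eq_add] at s1 s2
    rw [s1, s2]
    module
  -- Second evaluation, by Leibniz on [L_a, C_b] + [C_a, L_b] with ∇_S L = -k g(v, v) C. The
  -- commutators [C_a, C_b] match those of the first, and 2[L_a, L_b] is left over.
  rw [hsub, hab, sprayDeriv_add (dop (dLa a) (dCa b)) (dop (dCa a) (dLa b)),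
    sprayDeriv_opComm (dLa a) (dCa b), sprayDeriv_opComm (dCa a) (dLa b), sprayDeriv_apply dL,
    sprayDeriv_apply dC, sprayDeriv_apply dC, sprayDeriv_apply dL,
    hf.sprayDerivForm_landsberg hp hX, hf.sprayDerivForm_landsberg hp hX, hf.hvCurvL_sub hp,
    hf.hvCurvL_sub hp, hf.vvCurv_eq hp] at h1
  change _ = (_ + opComm _ (landsberg f p b + _)) + (opComm (landsberg f p a + _) _ + _) at h1
  simp only [opComm_add_left, opComm_add_right, opComm_smul_left, opComm_smul_right] at h1
  have h3 : (2 : ℝ) • opComm (landsberg f p a) (landsberg f p b) = 0 := by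
    rw [← sub_eq_zero] at h1
    rw [← neg_eq_zero, ← h1]
    module
  exact (smul_eq_zero.1 h3).resolve_left two_ne_zero

/-- The second Bianchi identity for the modified curvature. -/
theorem bianchi_second_modHH (hp : p ∈ slit O) (a b c z : E) :
    (fderiv ℝ (modHH f k) p (horLift f p a) b c z + (christoffel f p a (modHH f k p b c z)
      - modHH f k p b c (christoffel f p a z)))
    + (fderiv ℝ (modHH f k) p (horLift f p b) c a z + (christoffel f p b (modHH f k p c a z)
      - modHH f k p c a (christoffel f p b z)))
    + (fderiv ℝ (modHH f k) p (horLift f p c) a b z + (christoffel f p c (modHH f k p a b z)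
      - modHH f k p a b (christoffel f p c z))) =
    hvCurvL f p a (hhCurv f p b c p.2) z + hvCurvL f p b (hhCurv f p c a p.2) z
      + hvCurvL f p c (hhCurv f p a b p.2) z := by
  have h := congrArg (fun L => L z) (hf.bianchi_second_hhh hp a b c)
  simp only [hf.fderiv_modHH hp, modHH_apply, _root_.sub_apply, _root_.add_apply,
    ContinuousLinearMap.comp_apply, map_sub, hf.fderiv_constCurv hp, constCurv_apply, map_smul,
    hf.fderiv_fundTensor hp, connForm_horLift] at h ⊢
  -- The constant curvature model contributes nothing: g is parallel and the horizontal coefficients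
  -- are symmetric.
  rw [← h, hf.christoffel_symm hp b a, hf.christoffel_symm hp c a, hf.christoffel_symm hp c b]
  module

/-- First Bianchi identity with v in the third slot. R(v, ·) is of constant curvature type, and the
two remaining terms k g(v, v) C(a, b) have opposite signs. -/
theorem hhCurv_vec (hp : p ∈ slit O) (hX : IsNull f k p.1 p.2) (a b : E) :
    modHH f k p a b p.2 = 0 := by
  have hX0 : modHH f k p p.2 = 0 := hX p.2 (mem_slit.1 hp).2
  have h := hf.bianchi_first_hhh hp a b p.2
  rw [hf.cartanTensor_vec hp, modHH_ext hX0, modHH_ext' hX0] at h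
  simp only [constCurv_apply, map_smul, map_sub, hf.cartanTensor_vec' hp, _root_.smul_apply,
    _root_.sub_apply, smul_zero, sub_zero, zero_sub] at h
  rw [modHH_apply, _root_.sub_apply, constCurv_apply]
  rw [hf.cartanTensor_symm hp a b, hf.fundTensor_symm hp b a] at h
  rw [hf.fundTensor_symm hp b p.2, hf.fundTensor_symm hp a p.2]
  have h2 : hhCurv f p a b p.2 = k • (fundTensor f p p.2 b • a - fundTensor f p p.2 a • b) := by
    rw [← sub_eq_zero, ← sub_eq_zero.2 h]
    module
  rw [h2, sub_self]

/-- Here the direction need not be X, so the C(·, X) terms survive. This generality is needed to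
differentiate along the fibre at the direction X, where they vanish. -/
theorem modHH_apply_null (hp : p ∈ slit O) {X : E} (hX : IsNull f k p.1 X) (a b : E) :
    modHH f k p a b X = k • (fundTensor f p a p.2 • cartanTensor f p b X
      - fundTensor f p b p.2 • cartanTensor f p a X) +
      cartanTensor f p (hhCurv f p a b p.2) X := by
  have hX0 : modHH f k p X = 0 := hX p.2 (mem_slit.1 hp).2
  have h := hf.bianchi_first_hhh hp a b X
  rw [modHH_ext hX0, modHH_ext' hX0] at h
  simp only [constCurv_apply, map_smul, map_sub, _root_.smul_apply,
    _root_.sub_apply] at h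
  rw [modHH_apply, _root_.sub_apply, constCurv_apply]
  rw [hf.cartanTensor_symm hp a b, hf.fundTensor_symm hp b a, hf.cartanTensor_symm hp X a,
    hf.cartanTensor_symm hp X b] at h
  rw [hf.fundTensor_symm hp b X, hf.fundTensor_symm hp a X]
  rw [← sub_eq_zero] at h ⊢
  rw [← h]
  module

/-- At a nullity direction the modified curvature satisfies the algebraic Bianchi identity. -/
theorem modHH_cyclic (hp : p ∈ slit O) (hX : IsNull f k p.1 p.2) (a b c : E) :
    modHH f k p a b c + modHH f k p b c a + modHH f k p c a b = 0 := by
  have h := hf.bianchi_first_hhh hp a b c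
  have e : ∀ x y, hhCurv f p x y p.2 = constCurv f k p x y p.2 := fun x y => by
    have := hf.hhCurv_vec hp hX x y
    rwa [modHH_apply, _root_.sub_apply, sub_eq_zero] at this
  rw [e, e, e] at h
  simp only [modHH_apply, constCurv_apply, map_smul, map_sub, _root_.smul_apply,
    _root_.sub_apply] at h ⊢
  rw [hf.cartanTensor_symm hp b a, hf.cartanTensor_symm hp c a, hf.cartanTensor_symm hp c b] at h
  rw [hf.fundTensor_symm hp b a, hf.fundTensor_symm hp c a, hf.fundTensor_symm hp c b]
  rw [← sub_eq_zero] at h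
  rw [← h]
  module

theorem modHH_skew (hp : p ∈ slit O) (a b c d : E) :
    fundTensor f p (modHH f k p a b c) d = - fundTensor f p (modHH f k p a b d) c := by
  have h := hf.curv_skew hp (horLift f p a) (horLift f p b) c d
  rw [← hhCurv_apply] at h
  rw [modHH_apply, _root_.sub_apply, _root_.sub_apply, map_sub, map_sub, _root_.sub_apply,
    _root_.sub_apply, h, constCurv_apply, constCurv_apply]
  simp only [map_smul, map_sub, _root_.smul_apply, _root_.sub_apply, smul_eq_mul]
  ring

/-- At a nullity direction, a vector annihilated by the modified curvature is a nullity vector. -/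
theorem modHH_eq_zero_of_apply (hp : p ∈ slit O) (hX : IsNull f k p.1 p.2) {u : E}
    (hu : ∀ b c, modHH f k p b c u = 0) : modHH f k p u = 0 := by
  ext b c
  refine hf.fundTensor_ext hp fun d => ?_
  have B := fun x y z w => congrArg (fun l => fundTensor f p l w) (hf.modHH_cyclic hp hX x y z)
  have A : ∀ x y z w, fundTensor f p (modHH f k p x y z) w =
      - fundTensor f p (modHH f k p y x z) w := fun x y z w => by
    rw [modHH_antisymm, _root_.neg_apply, map_neg, _root_.neg_apply]
  have S := hf.modHH_skew (k := k) hp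
  simp only [map_add, _root_.add_apply, map_zero, _root_.zero_apply] at B ⊢
  -- Four cyclic identities combined with the two skew symmetries: the classical derivation of
  -- g(R̄(u, b)c, d) = g(R̄(c, d)u, b), whose right side is zero by hypothesis.
  have b1 := B u b c d
  have b2 := B b c d u
  have b3 := B c d u b
  have b4 := B d u b c
  simp only [hu, map_zero, _root_.zero_apply] at b1 b3 b4
  have s1 := S b c d u
  have s2 := S c d b u
  have s3 := S d b c u
  have s4 := S u b c d
  have s5 := S c u b d
  have s6 := S d u b c
  have s7 := S u b d c
  have s8 := S c u d b
  have s9 := S u d c b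
  have a1 := A c u b d
  have a2 := A c u d b
  have a3 := A d u b c
  have a4 := A d u c b
  have a5 := A u d b c
  have a6 := A u d c b
  simp only [hu, map_zero, _root_.zero_apply] at s1 s2 s3
  linarith

end IsLocalFinsler
end NullityIntegrability

/-! ### Involutivity of the nullity distribution in coordinates -/

section NullityInvolutive

variable {E : Type*} [NormedAddCommGroup E] [NormedSpace ℝ E]
variable {G : Type*} [NormedAddCommGroup G] [NormedSpace ℝ G]

theorem fderiv_eq_zero_of_section {F : E × E → G} {X : E → E} {x : E}
    (hF : DifferentiableAt ℝ F (x, X x)) (hX : DifferentiableAt ℝ X x)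
    (h : ∀ᶠ y in 𝓝 x, F (y, X y) = 0) (a : E) :
    fderiv ℝ F (x, X x) (a, fderiv ℝ X x a) = 0 := by
  have h1 : HasFDerivAt (fun y => (y, X y))
      ((ContinuousLinearMap.id ℝ E).prod (fderiv ℝ X x)) x :=
    (hasFDerivAt_id x).prodMk hX.hasFDerivAt
  have h2 := hF.hasFDerivAt.comp x h1
  have h3 : F ∘ (fun y => (y, X y)) =ᶠ[𝓝 x] fun _ => (0 : G) := h
  have := (h2.congr_of_eventuallyEq h3.symm).unique (hasFDerivAt_const _ _)
  exact congrArg (fun L => L a) this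

theorem fderiv_fibre_eq_zero {F : E × E → G} {p : E × E} {b : E}
    (hF : DifferentiableAt ℝ F p) (h : ∀ᶠ t : ℝ in 𝓝 0, F (p.1, p.2 + t • b) = 0) :
    fderiv ℝ F p (0, b) = 0 := by
  have hc : HasDerivAt (fun t : ℝ => ((p.1, p.2 + t • b) : E × E)) (0, b) 0 := by
    have := (hasDerivAt_const (0 : ℝ) p.1).prodMk
      (((hasDerivAt_id (0 : ℝ)).smul_const b).const_add p.2)
    simpa using this
  have h0 : ((p.1, p.2 + (0 : ℝ) • b) : E × E) = p := by simp
  have := fderiv_eq_zero_of_curve (F := F) (by rwa [h0]) hc h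
  rwa [h0] at this

theorem eventually_add_smul_ne {v : E} (hv : v ≠ 0) (b : E) : ∀ᶠ t : ℝ in 𝓝 0, v + t • b ≠ 0 := by
  have : Tendsto (fun t : ℝ => v + t • b) (𝓝 0) (𝓝 v) := by
    have hcont : Continuous fun t : ℝ => v + t • b := by fun_prop
    simpa using hcont.tendsto 0
  exact this.eventually_ne hv

theorem IsNull.add_smul {f : E × E → ℝ} {k : ℝ} {x X Y : E} (hX : IsNull f k x X)
    (hY : IsNull f k x Y) (t : ℝ) : IsNull f k x (X + t • Y) := fun v hv => by
  rw [map_add, map_smul, hX v hv, hY v hv, smul_zero, add_zero]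

namespace IsLocalFinsler

variable {f : E × E → ℝ} {O : Set E} (hf : IsLocalFinsler f O) {p : E × E} {k : ℝ}
variable [FiniteDimensional ℝ E]
include hf

theorem landsberg_vec (hp : p ∈ slit O) (a : E) : landsberg f p a p.2 = 0 := by
  rw [← neg_eq_zero, ← hf.hvCurvL_apply_vec hp, hf.hvCurvL_vec hp, _root_.zero_apply]

theorem landsberg_vec' (hp : p ∈ slit O) : landsberg f p p.2 = 0 :=
  ContinuousLinearMap.ext fun a => by
    rw [hf.landsberg_symm hp, hf.landsberg_vec hp, _root_.zero_apply]

theorem hvCurvL_vec' (hp : p ∈ slit O) (a : E) : hvCurvL f p a p.2 = 0 := by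
  have h := hf.hvCurvL_sub hp a p.2
  rw [hf.hvCurvL_vec hp, hf.landsberg_vec' hp, hf.cartanTensor_vec_eq_zero hp] at h
  simpa [opComm] using h

omit [FiniteDimensional ℝ E] in
theorem fundTensor_vec_pos (hp : p ∈ slit O) : 0 < fundTensor f p p.2 p.2 :=
  hf.posDef p hp _ (mem_slit.1 hp).2

/-- R̄(Y) vanishes in a neighbourhood of p in the slit tangent space, so the product rule trades a
derivative of R̄ for a derivative of Y. -/
theorem fderiv_modHH_field (hp : p ∈ slit O) {Y : E → E} (hY : DifferentiableAt ℝ Y p.1)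
    (hYn : ∀ᶠ y in 𝓝 p.1, IsNull f k y (Y y)) (A : E × E) :
    fderiv ℝ (modHH f k) p A (Y p.1) = - modHH f k p (fderiv ℝ Y p.1 A.1) := by
  have hev : (fun q : E × E => modHH f k q (Y q.1)) =ᶠ[𝓝 p] fun _ => 0 := by
    filter_upwards [continuous_fst.continuousAt.eventually hYn, hf.isOpen.mem_nhds hp]
      with q hq hq'
    exact hq q.2 (mem_slit.1 hq').2
  have hc : HasFDerivAt (fun q : E × E => Y q.1)
      ((fderiv ℝ Y p.1).comp (ContinuousLinearMap.fst ℝ E E)) p :=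
    hY.hasFDerivAt.comp p hasFDerivAt_fst
  have h := congrArg (fun L => L A) (hev.fderiv_eq (𝕜 := ℝ))
  beta_reduce at h
  rw [fderiv_apply_apply (hf.differentiableAt_modHH hp) hc.differentiableAt, hc.fderiv] at h
  refine eq_neg_of_add_eq_zero_left ?_
  simpa using h

/-- Fibre derivative of `modHH_apply_null` with the vector v frozen. As C(·, v) = 0 at p, only the
derivative -C(·, u) of that factor counts; the terms then cancel because R(b, c)v is of constant
curvature type. -/
theorem fderiv_modHH_fibre_vec (hp : p ∈ slit O) (hX : IsNull f k p.1 p.2) (b c u : E) :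
    fderiv ℝ (modHH f k) p (0, u) b c p.2 = 0 := by
  have dm := hf.differentiableAt_modHH (k := k) hp
  have dC := hf.differentiableAt_cartanTensor hp
  have dg := hf.differentiableAt_fundTensor hp
  have dh := hf.differentiableAt_hhCurv hp
  have c0 : ∀ x : E, DifferentiableAt ℝ (fun _ : E × E => x) p := fun x => differentiableAt_const x
  have ds : DifferentiableAt ℝ (fun q : E × E => q.2) p := differentiableAt_snd
  have e1 : ∀ x, DifferentiableAt ℝ (fun q => fundTensor f q x q.2) p := fun x =>
    (dg.clm_apply (c0 x)).clm_apply ds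
  have e2 : ∀ x, DifferentiableAt ℝ (fun q => cartanTensor f q x p.2) p := fun x =>
    (dC.clm_apply (c0 x)).clm_apply (c0 p.2)
  have e3 : DifferentiableAt ℝ (fun q => hhCurv f q b c q.2) p :=
    ((dh.clm_apply (c0 b)).clm_apply (c0 c)).clm_apply ds
  have e4 : DifferentiableAt ℝ (fun q => modHH f k q b c p.2) p :=
    ((dm.clm_apply (c0 b)).clm_apply (c0 c)).clm_apply (c0 p.2)
  have e5 : DifferentiableAt ℝ (fun q => cartanTensor f q (hhCurv f q b c q.2) p.2) p :=
    (dC.clm_apply e3).clm_apply (c0 p.2)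
  have e6 : ∀ x y, DifferentiableAt ℝ
      (fun q => fundTensor f q x q.2 • cartanTensor f q y p.2) p := fun x y =>
    (e1 x).fun_smul (e2 y)
  have e7 := ((e6 b c).fun_sub (e6 c b)).fun_const_smul k
  have hF := fderiv_fibre_eq_zero (b := u) (e4.fun_sub (e7.fun_add e5)) (by
    filter_upwards [eventually_add_smul_ne (mem_slit.1 hp).2 u] with t ht
    have hq : ((p.1, p.2 + t • u) : E × E) ∈ slit O := mem_slit.2 ⟨(mem_slit.1 hp).1, ht⟩
    exact sub_eq_zero.2 (hf.modHH_apply_null hq hX b c))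
  have hm : fderiv ℝ (fun q => modHH f k q b c p.2) p (0, u) =
      fderiv ℝ (modHH f k) p (0, u) b c p.2 := by
    rw [fderiv_apply_const ((dm.clm_apply (c0 b)).clm_apply (c0 c)), fderiv_apply_apply_const dm]
  have hh : hhCurv f p b c p.2 = constCurv f k p b c p.2 := by
    have := hf.hhCurv_vec hp hX b c
    rwa [modHH_apply, _root_.sub_apply, sub_eq_zero] at this
  rw [fderiv_fun_sub e4 (e7.fun_add e5), fderiv_fun_add e7 e5,
    fderiv_fun_const_smul ((e6 b c).fun_sub (e6 c b)), fderiv_fun_sub (e6 b c) (e6 c b),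
    fderiv_fun_smul (e1 b) (e2 c), fderiv_fun_smul (e1 c) (e2 b)] at hF
  simp only [_root_.sub_apply, _root_.add_apply, _root_.smul_apply, hm,
    ContinuousLinearMap.smulRight_apply, hf.cartanTensor_vec hp, smul_zero, add_zero,
    fderiv_apply_apply_const dC, fderiv_apply_apply₂ dC e3 (c0 p.2), hf.fderiv_cartanTensor_vec hp,
    hh, constCurv_apply, fderiv_fun_const, Pi.zero_apply, _root_.zero_apply, map_zero, map_sub,
    map_smul] at hF
  refine Eq.trans ?_ hF
  module

/-- The covariant derivative of a field of nullity vectors along itself is a nullity vector. -/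
theorem modHH_geodesic (hp : p ∈ slit O) {X : E → E} (hX : DifferentiableAt ℝ X p.1)
    (hXn : ∀ᶠ y in 𝓝 p.1, IsNull f k y (X y)) (hXp : X p.1 = p.2) (b c : E) :
    modHH f k p b c (fderiv ℝ X p.1 p.2 + nonlin f p p.2) = 0 := by
  have hn : IsNull f k p.1 p.2 := hXp ▸ hXn.self_of_nhds
  have hn0 : modHH f k p p.2 = 0 := hn p.2 (mem_slit.1 hp).2
  have dm := hf.differentiableAt_modHH (k := k) hp
  have c0 : ∀ x : E, DifferentiableAt ℝ (fun _ : E × E => x) p := fun x => differentiableAt_const x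
  have e1 := (dm.clm_apply (c0 b)).clm_apply (c0 c)
  have hpe : (p.1, X p.1) = p := by rw [hXp]
  -- R̄(b, c)v = 0 holds at every (y, X y), since these directions are null; differentiate along the
  -- section in the direction X.
  have hs := fderiv_eq_zero_of_section (F := fun q => modHH f k q b c q.2) (x := p.1) (X := X)
    (by rw [hpe]; exact e1.clm_apply differentiableAt_snd) hX (by
      have hc : Tendsto (fun y => (y, X y)) (𝓝 p.1) (𝓝 p) := by
        have h : Tendsto (fun y => (y, X y)) (𝓝 p.1) (𝓝 (p.1, X p.1)) :=
          continuousAt_id.prodMk hX.continuousAt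
        rwa [hpe] at h
      filter_upwards [hXn, hc (hf.isOpen.mem_nhds hp)] with y hy hy'
      exact hf.hhCurv_vec (p := (y, X y)) hy' hy b c) p.2
  rw [hpe, fderiv_apply_apply e1 differentiableAt_snd, fderiv_apply_apply_const dm,
    fderiv_snd] at hs
  -- The tangent vector of the section is the lift of v plus the vertical vector of ∇_X X. The
  -- vertical part does not contribute to the derivative of R̄.
  have hdec : ((p.2, fderiv ℝ X p.1 p.2) : E × E) = horLift f p p.2
      + (0, fderiv ℝ X p.1 p.2 + nonlin f p p.2) := by
    ext <;> simp [horLift_apply]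
  rw [hdec, map_add, _root_.add_apply, _root_.add_apply, _root_.add_apply,
    hf.fderiv_modHH_fibre_vec hp hn, ← hdec] at hs
  -- Supplies the horizontal part. On the right, P applied to v gives two Landsberg terms k g(v, v)
  -- L(b, c), which cancel by symmetry of L.
  have hB := hf.bianchi_second_modHH (k := k) hp p.2 b c p.2
  have e : ∀ A, fderiv ℝ (modHH f k) p A p.2 = - modHH f k p (fderiv ℝ X p.1 A.1) := fun A => by
    rw [← hf.fderiv_modHH_field hp hX hXn, hXp]
  have ea : ∀ A, fderiv ℝ (modHH f k) p A c p.2 = modHH f k p (fderiv ℝ X p.1 A.1) c := fun A => by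
    have h1 := congrArg (fun L => L A) (fderiv_congr_of_isOpen hf.isOpen
      (fun q _ => modHH_antisymm f k q c p.2) hp)
    beta_reduce at h1
    rw [fderiv_fun_neg, _root_.neg_apply, fderiv_apply_apply_const dm,
      fderiv_apply_apply_const dm, e, _root_.neg_apply, neg_neg] at h1
    exact h1
  have h0 : modHH f k p c p.2 = 0 := by
    rw [modHH_antisymm, hn0, _root_.zero_apply, neg_zero]
  rw [e, ea, hf.hvCurvL_vec hp, modHH_ext hn0, modHH_ext' hn0] at hB
  simp only [hn0, h0, _root_.neg_apply, hf.hhCurv_vec hp hn, constCurv_apply, map_smul, map_sub,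
    map_zero, _root_.zero_apply, _root_.sub_apply, _root_.smul_apply, hf.hvCurvL_apply_vec hp,
    hf.landsberg_vec' hp, hf.christoffel_vec hp] at hB
  rw [hf.landsberg_symm hp b c] at hB
  rw [map_add]
  have e9 : (ContinuousLinearMap.snd ℝ E E) (p.2, fderiv ℝ X p.1 p.2) = fderiv ℝ X p.1 p.2 := rfl
  rw [e9] at hs
  have hB' : fderiv ℝ (modHH f k) p (horLift f p p.2) b c p.2 =
      modHH f k p b c (nonlin f p p.2) := by
    rw [← sub_eq_zero, ← sub_eq_zero.2 hB]
    module
  rw [hB'] at hs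
  rw [← hs]
  abel

/-- In the direction of a field of nullity vectors, the `hv`-curvature is symmetric. -/
theorem hvCurvL_symm_of_null (hp : p ∈ slit O) {X : E → E} (hX : DifferentiableAt ℝ X p.1)
    (hXn : ∀ᶠ y in 𝓝 p.1, IsNull f k y (X y)) (hXp : X p.1 = p.2)
    (hu : IsNull f k p.1 (fderiv ℝ X p.1 p.2 + nonlin f p p.2)) (a b : E) :
    k • (hvCurvL f p a b - hvCurvL f p b a) = 0 := by
  have hn : IsNull f k p.1 p.2 := hXp ▸ hXn.self_of_nhds
  have dL := hf.differentiableAt_landsberg hp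
  have c0 : ∀ x : E, DifferentiableAt ℝ (fun _ : E × E => x) p := fun x => differentiableAt_const x
  have dLa : ∀ x, DifferentiableAt ℝ (fun q => landsberg f q x) p := fun x => dL.clm_apply (c0 x)
  have dK : DifferentiableAt ℝ (fun q => opComm (landsberg f q a) (landsberg f q b)) p :=
    ((dLa a).clm_comp (dLa b)).fun_sub ((dLa b).clm_comp (dLa a))
  have hpe : (p.1, X p.1) = p := by rw [hXp]
  have hs := fderiv_eq_zero_of_section (x := p.1) (X := X) (by rw [hpe]; exact dK) hX (by
      have hc : Tendsto (fun y => (y, X y)) (𝓝 p.1) (𝓝 p) := by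
        have h : Tendsto (fun y => (y, X y)) (𝓝 p.1) (𝓝 (p.1, X p.1)) :=
          continuousAt_id.prodMk hX.continuousAt
        rwa [hpe] at h
      filter_upwards [hXn, hc (hf.isOpen.mem_nhds hp)] with y hy hy'
      exact hf.opComm_landsberg (p := (y, X y)) hy' hy a b) p.2
  rw [hpe] at hs
  -- The directions v + tu with u = ∇_X X are null too, so the commutator also vanishes along this
  -- line and only its spray derivative remains.
  have hv := fderiv_fibre_eq_zero dK (b := fderiv ℝ X p.1 p.2 + nonlin f p p.2) (by
    filter_upwards [eventually_add_smul_ne (mem_slit.1 hp).2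
      (fderiv ℝ X p.1 p.2 + nonlin f p p.2)] with t ht
    have hq : ((p.1, p.2 + t • (fderiv ℝ X p.1 p.2 + nonlin f p p.2)) : E × E) ∈ slit O :=
      mem_slit.2 ⟨(mem_slit.1 hp).1, ht⟩
    exact hf.opComm_landsberg hq (hn.add_smul hu t) a b)
  have hdec : ((p.2, fderiv ℝ X p.1 p.2) : E × E) = sprayVec f p
      + (0, fderiv ℝ X p.1 p.2 + nonlin f p p.2) := by
    ext <;> simp [sprayVec_eq]
  rw [hdec, map_add, hv, add_zero] at hs
  have hd : sprayDeriv f (fun q => opComm (landsberg f q a) (landsberg f q b)) p = 0 := by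
    rw [sprayDeriv, hs, hf.opComm_landsberg hp hn]
    simp [opComm]
  rw [sprayDeriv_opComm (dLa a) (dLa b), sprayDeriv_apply dL, sprayDeriv_apply dL,
    hf.sprayDerivForm_landsberg hp hn, hf.sprayDerivForm_landsberg hp hn, opComm_add_left,
    opComm_add_right, hf.opComm_landsberg hp hn, hf.opComm_landsberg hp hn, opComm_smul_left,
    opComm_smul_right] at hd
  -- Insert ∇_S L = -k g(v, v) C into [∇_S L_a, L_b] + [L_a, ∇_S L_b] and recognise the
  -- antisymmetric part of P. Only g(v, v) is cancelled; the factor k has to stay, as k may be zero.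
  have h3 : fundTensor f p p.2 p.2 • (k • (hvCurvL f p a b - hvCurvL f p b a)) = 0 := by
    rw [hf.hvCurvL_sub hp, ← neg_eq_zero, ← hd]
    module
  exact (smul_eq_zero.1 h3).resolve_left (hf.fundTensor_vec_pos hp).ne'

theorem modHH_lieBracket (hp : p ∈ slit O) {X Y : E → E} (hX : DifferentiableAt ℝ X p.1)
    (hXn : ∀ᶠ y in 𝓝 p.1, IsNull f k y (X y)) (hXp : X p.1 = p.2)
    (hY : DifferentiableAt ℝ Y p.1) (hYn : ∀ᶠ y in 𝓝 p.1, IsNull f k y (Y y))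
    (hu : IsNull f k p.1 (fderiv ℝ X p.1 p.2 + nonlin f p p.2)) :
    modHH f k p (VectorField.lieBracket ℝ X Y p.1) = 0 := by
  have hn : IsNull f k p.1 p.2 := hXp ▸ hXn.self_of_nhds
  have hn0 : modHH f k p p.2 = 0 := hn p.2 (mem_slit.1 hp).2
  have hY0 : modHH f k p (Y p.1) = 0 := hYn.self_of_nhds p.2 (mem_slit.1 hp).2
  have dm := hf.differentiableAt_modHH (k := k) hp
  have e : ∀ A, fderiv ℝ (modHH f k) p A p.2 = - modHH f k p (fderiv ℝ X p.1 A.1) := fun A => by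
    rw [← hf.fderiv_modHH_field hp hX hXn, hXp]
  ext c z
  have ea : ∀ A, fderiv ℝ (modHH f k) p A c p.2 = modHH f k p (fderiv ℝ X p.1 A.1) c := fun A => by
    have h1 := congrArg (fun L => L A) (fderiv_congr_of_isOpen hf.isOpen
      (fun q _ => modHH_antisymm f k q c p.2) hp)
    beta_reduce at h1
    rw [fderiv_fun_neg, _root_.neg_apply, fderiv_apply_apply_const dm,
      fderiv_apply_apply_const dm, e, _root_.neg_apply, neg_neg] at h1
    exact h1
  have h0 : modHH f k p c p.2 = 0 := by
    rw [modHH_antisymm, hn0, _root_.zero_apply, neg_zero]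
  have h1 : ∀ a, modHH f k p a (Y p.1) = 0 := fun a => by
    rw [modHH_antisymm, hY0, _root_.zero_apply, neg_zero]
  have hQ := hf.hvCurvL_symm_of_null hp hX hXn hXp hu (Y p.1) c
  -- The derivative terms collapse to R̄([X, Y], c) up to sign. On the right P(v, ·) = P(·, v) = 0,
  -- and the constant curvature form of R(v, ·) leaves a multiple of k (P(Y, c) - P(c, Y)).
  have hB := hf.bianchi_second_modHH (k := k) hp p.2 (Y p.1) c z
  rw [e, ea, hf.fderiv_modHH_field hp hY hYn, hf.hvCurvL_vec hp, modHH_ext hn0,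
    modHH_ext' hn0] at hB
  simp only [hn0, h0, hY0, h1, _root_.neg_apply, constCurv_apply, map_smul, map_sub,
    map_zero, _root_.zero_apply, _root_.smul_apply, hf.hvCurvL_vec' hp,
    smul_zero, sub_zero, zero_sub, add_zero, zero_add, neg_zero] at hB
  have hQz : k • (hvCurvL f p (Y p.1) c z - hvCurvL f p c (Y p.1) z) = 0 :=
    congrArg (fun L => L z) hQ
  have e7 : ∀ a, (horLift f p a).1 = a := fun _ => rfl
  rw [VectorField.lieBracket, map_sub, hXp, _root_.sub_apply, _root_.sub_apply, _root_.zero_apply,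
    _root_.zero_apply]
  rw [e7, e7] at hB
  have h5 : modHH f k p (fderiv ℝ Y p.1 p.2) c z - modHH f k p (fderiv ℝ X p.1 (Y p.1)) c z =
      -(fundTensor f p p.2 p.2 • k • (hvCurvL f p (Y p.1) c z - hvCurvL f p c (Y p.1) z)) := by
    rw [← neg_eq_iff_eq_neg, neg_sub, sub_eq_add_neg, add_comm, hB]
    module
  rw [h5, hQz, smul_zero, neg_zero]

/-- The nullity distribution is involutive. -/
theorem isNull_lieBracket
    (hwd : ∀ x ∈ O, ∀ v : E, v ≠ 0 → ∀ a, modHH f k (x, v) a = 0 → IsNull f k x a)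
    {x : E} (hx : x ∈ O) {X Y : E → E} (hX : DifferentiableAt ℝ X x)
    (hXn : ∀ᶠ y in 𝓝 x, IsNull f k y (X y)) (hY : DifferentiableAt ℝ Y x)
    (hYn : ∀ᶠ y in 𝓝 x, IsNull f k y (Y y)) : IsNull f k x (VectorField.lieBracket ℝ X Y x) := by
  have key : ∀ {X Y : E → E}, DifferentiableAt ℝ X x → (∀ᶠ y in 𝓝 x, IsNull f k y (X y)) →
      DifferentiableAt ℝ Y x → (∀ᶠ y in 𝓝 x, IsNull f k y (Y y)) → X x ≠ 0 →
      IsNull f k x (VectorField.lieBracket ℝ X Y x) := by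
    intro X Y hX hXn hY hYn h0
    have hp : (x, X x) ∈ slit O := mem_slit.2 ⟨hx, h0⟩
    -- Nullity of the bracket is obtained in the single direction X x, and `hwd` spreads it to all
    -- directions; the same device is then used for ∇_X X.
    refine hwd x hx _ h0 _ (hf.modHH_lieBracket hp hX hXn rfl hY hYn ?_)
    exact hwd x hx _ h0 _ (hf.modHH_eq_zero_of_apply hp hXn.self_of_nhds
      (hf.modHH_geodesic hp hX hXn rfl))
  by_cases h0 : X x = 0
  · by_cases h1 : Y x = 0
    · intro v _
      rw [VectorField.lieBracket, h0, h1, map_zero, map_zero, sub_zero, map_zero]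
    · intro v hv
      have h2 : VectorField.lieBracket ℝ X Y x = - VectorField.lieBracket ℝ Y X x := by
        simp [VectorField.lieBracket]
      rw [h2, map_neg, key hY hYn hX hXn h1 v hv, neg_zero]
  · exact key hX hXn hY hYn h0

end IsLocalFinsler
end NullityInvolutive

/-! ### Transformation laws under a change of coordinates -/

section ChartChange

variable {E : Type*} [NormedAddCommGroup E] [NormedSpace ℝ E]

/-- The map induced by `ψ` on the tangent bundle. -/
def tangentLift (ψ : E → E) (q : E × E) : E × E := (ψ q.1, fderiv ℝ ψ q.1 q.2)

/-- Two local expressions of a Finsler structure related by a change of coordinates. -/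
structure IsChartChange (ψ : E → E) (f₁ f₂ : E × E → ℝ) (O₁ O₂ : Set E) : Prop where
  fst : IsLocalFinsler f₁ O₁
  snd : IsLocalFinsler f₂ O₂
  smooth : ContDiffOn ℝ ∞ ψ O₁
  mapsTo : ∀ x ∈ O₁, ψ x ∈ O₂
  bijective : ∀ x ∈ O₁, Function.Bijective (fderiv ℝ ψ x)
  eq : ∀ q ∈ slit O₁, f₁ q = f₂ (tangentLift ψ q)

namespace IsChartChange

variable {ψ : E → E} {f₁ f₂ : E × E → ℝ} {O₁ O₂ : Set E} (h : IsChartChange ψ f₁ f₂ O₁ O₂)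
variable {p : E × E} {k : ℝ}
include h

omit h [NormedSpace ℝ E] in
theorem mem_base (hp : p ∈ slit O₁) : p.1 ∈ O₁ := (mem_slit.1 hp).1

theorem mem_slit (hp : p ∈ slit O₁) : tangentLift ψ p ∈ slit O₂ := by
  obtain ⟨h1, h2⟩ := FinslerNullity.mem_slit.1 hp
  refine FinslerNullity.mem_slit.2 ⟨h.mapsTo _ h1, fun h3 => h2 ?_⟩
  exact (h.bijective _ h1).1 (h3.trans (map_zero _).symm)

theorem contDiffOn_fderiv : ContDiffOn ℝ ∞ (fderiv ℝ ψ) O₁ :=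
  FinslerNullity.contDiffOn_fderiv h.fst.isOpen_base h.smooth

omit h [NormedSpace ℝ E] in
theorem mapsTo_fst : Set.MapsTo (Prod.fst : E × E → E) (slit O₁) O₁ := fun _ hq => hq.1

theorem contDiffOn_jac : ContDiffOn ℝ ∞ (fun q : E × E => fderiv ℝ ψ q.1) (slit O₁) :=
  h.contDiffOn_fderiv.comp contDiff_fst.contDiffOn mapsTo_fst

theorem contDiffOn_hess :
    ContDiffOn ℝ ∞ (fun q : E × E => fderiv ℝ (fderiv ℝ ψ) q.1) (slit O₁) :=
  (FinslerNullity.contDiffOn_fderiv h.fst.isOpen_base h.contDiffOn_fderiv).comp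
    contDiff_fst.contDiffOn mapsTo_fst

theorem contDiffOn_tangentLift : ContDiffOn ℝ ∞ (tangentLift ψ) (slit O₁) :=
  (h.smooth.comp contDiff_fst.contDiffOn mapsTo_fst).prodMk
    (h.contDiffOn_jac.clm_apply contDiff_snd.contDiffOn)

theorem differentiableAt_jac (hp : p ∈ slit O₁) :
    DifferentiableAt ℝ (fun q : E × E => fderiv ℝ ψ q.1) p :=
  differentiableAt_of_contDiffOn h.fst.isOpen h.contDiffOn_jac hp

theorem differentiableAt_hess (hp : p ∈ slit O₁) :
    DifferentiableAt ℝ (fun q : E × E => fderiv ℝ (fderiv ℝ ψ) q.1) p :=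
  differentiableAt_of_contDiffOn h.fst.isOpen h.contDiffOn_hess hp

theorem differentiableAt_tangentLift (hp : p ∈ slit O₁) : DifferentiableAt ℝ (tangentLift ψ) p :=
  differentiableAt_of_contDiffOn h.fst.isOpen h.contDiffOn_tangentLift hp

theorem fderiv_jac (hp : p ∈ slit O₁) (A : E × E) :
    fderiv ℝ (fun q : E × E => fderiv ℝ ψ q.1) p A = fderiv ℝ (fderiv ℝ ψ) p.1 A.1 := by
  have d := differentiableAt_of_contDiffOn h.fst.isOpen_base h.contDiffOn_fderiv (mem_base hp)
  have h1 : HasFDerivAt (fun q : E × E => fderiv ℝ ψ q.1)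
      ((fderiv ℝ (fderiv ℝ ψ) p.1).comp (ContinuousLinearMap.fst ℝ E E)) p :=
    d.hasFDerivAt.comp p hasFDerivAt_fst
  rw [h1.fderiv]; rfl

theorem fderiv_hess (hp : p ∈ slit O₁) (A : E × E) :
    fderiv ℝ (fun q : E × E => fderiv ℝ (fderiv ℝ ψ) q.1) p A =
      fderiv ℝ (fderiv ℝ (fderiv ℝ ψ)) p.1 A.1 := by
  have d := differentiableAt_of_contDiffOn h.fst.isOpen_base
    (FinslerNullity.contDiffOn_fderiv h.fst.isOpen_base h.contDiffOn_fderiv) (mem_base hp)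
  have h1 : HasFDerivAt (fun q : E × E => fderiv ℝ (fderiv ℝ ψ) q.1)
      ((fderiv ℝ (fderiv ℝ (fderiv ℝ ψ)) p.1).comp (ContinuousLinearMap.fst ℝ E E)) p :=
    d.hasFDerivAt.comp p hasFDerivAt_fst
  rw [h1.fderiv]; rfl

theorem hess_symm (hp : p ∈ slit O₁) (a b : E) :
    fderiv ℝ (fderiv ℝ ψ) p.1 a b = fderiv ℝ (fderiv ℝ ψ) p.1 b a :=
  fderiv_fderiv_comm h.fst.isOpen_base h.smooth (mem_base hp) a b

theorem fderiv_tangentLift (hp : p ∈ slit O₁) (A : E × E) :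
    fderiv ℝ (tangentLift ψ) p A =
      (fderiv ℝ ψ p.1 A.1, fderiv ℝ (fderiv ℝ ψ) p.1 A.1 p.2 + fderiv ℝ ψ p.1 A.2) := by
  have d0 := differentiableAt_of_contDiffOn h.fst.isOpen_base h.smooth (mem_base hp)
  have h1 : HasFDerivAt (fun q : E × E => ψ q.1)
      ((fderiv ℝ ψ p.1).comp (ContinuousLinearMap.fst ℝ E E)) p :=
    d0.hasFDerivAt.comp p hasFDerivAt_fst
  have d2 : DifferentiableAt ℝ (fun q : E × E => fderiv ℝ ψ q.1 q.2) p :=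
    (h.differentiableAt_jac hp).clm_apply differentiableAt_snd
  have h3 : HasFDerivAt (tangentLift ψ) _ p := h1.prodMk d2.hasFDerivAt
  rw [h3.fderiv, ContinuousLinearMap.prod_apply,
    fderiv_apply_apply (h.differentiableAt_jac hp) differentiableAt_snd, h.fderiv_jac hp,
    fderiv_snd]
  rfl

theorem fderiv_tangentLift_fibre (hp : p ∈ slit O₁) (b : E) :
    fderiv ℝ (tangentLift ψ) p (0, b) = (0, fderiv ℝ ψ p.1 b) := by
  rw [h.fderiv_tangentLift hp]; simp

theorem fderiv_comp {G : Type*} [NormedAddCommGroup G] [NormedSpace ℝ G] {u : E × E → G}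
    (hu : ContDiffOn ℝ ∞ u (slit O₂)) (hp : p ∈ slit O₁) (A : E × E) :
    fderiv ℝ (fun q => u (tangentLift ψ q)) p A =
      fderiv ℝ u (tangentLift ψ p) (fderiv ℝ (tangentLift ψ) p A) := by
  have d := differentiableAt_of_contDiffOn h.snd.isOpen hu (h.mem_slit hp)
  rw [fderiv_fun_comp p d (h.differentiableAt_tangentLift hp)]
  rfl

theorem differentiableAt_comp {G : Type*} [NormedAddCommGroup G] [NormedSpace ℝ G] {u : E × E → G}
    (hu : ContDiffOn ℝ ∞ u (slit O₂)) (hp : p ∈ slit O₁) :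
    DifferentiableAt ℝ (fun q => u (tangentLift ψ q)) p :=
  (differentiableAt_of_contDiffOn h.snd.isOpen hu (h.mem_slit hp)).comp p
    (h.differentiableAt_tangentLift hp)

theorem fderiv_energy (hp : p ∈ slit O₁) (A : E × E) :
    fderiv ℝ (energy f₁) p A =
      fderiv ℝ (energy f₂) (tangentLift ψ p) (fderiv ℝ (tangentLift ψ) p A) := by
  rw [← h.fderiv_comp h.snd.contDiffOn_energy hp]
  refine congrArg (fun L : E × E →L[ℝ] ℝ => L A) (fderiv_congr_of_isOpen h.fst.isOpen (fun q hq => ?_) hp)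
  rw [energy, energy, h.eq q hq]

theorem dFibre_energy (hp : p ∈ slit O₁) (b : E) :
    dFibre (energy f₁) p b = dFibre (energy f₂) (tangentLift ψ p) (fderiv ℝ ψ p.1 b) := by
  rw [dFibre_apply, h.fderiv_energy hp, h.fderiv_tangentLift_fibre hp]; rfl

theorem fderiv_dFibre_energy (hp : p ∈ slit O₁) (A : E × E) (b : E) :
    fderiv ℝ (dFibre (energy f₁)) p A b =
      fderiv ℝ (dFibre (energy f₂)) (tangentLift ψ p) (fderiv ℝ (tangentLift ψ) p A)
        (fderiv ℝ ψ p.1 b)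
      + dFibre (energy f₂) (tangentLift ψ p) (fderiv ℝ (fderiv ℝ ψ) p.1 A.1 b) := by
  have h1 := congrArg (fun L => L A) (fderiv_congr_of_isOpen h.fst.isOpen
    (fun q hq => h.dFibre_energy hq b) hp)
  beta_reduce at h1
  have d1 := differentiableAt_of_contDiffOn h.fst.isOpen h.fst.contDiffOn_dFibre_energy hp
  have d2 := h.differentiableAt_comp h.snd.contDiffOn_dFibre_energy hp
  have dJ := h.differentiableAt_jac hp
  rw [fderiv_apply_const d1, fderiv_apply_apply d2 (dJ.clm_apply (differentiableAt_const b)),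
    fderiv_apply_const dJ, h.fderiv_jac hp, h.fderiv_comp h.snd.contDiffOn_dFibre_energy hp] at h1
  exact h1

theorem fundTensor_eq (hp : p ∈ slit O₁) (a b : E) :
    fundTensor f₁ p a b =
      fundTensor f₂ (tangentLift ψ p) (fderiv ℝ ψ p.1 a) (fderiv ℝ ψ p.1 b) := by
  have h1 := h.fderiv_dFibre_energy hp (0, a) b
  rw [h.fderiv_tangentLift_fibre hp] at h1
  simp only [map_zero, _root_.zero_apply, add_zero] at h1
  exact h1

theorem fderiv_fundTensor (hp : p ∈ slit O₁) (A : E × E) (a b : E) :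
    fderiv ℝ (fundTensor f₁) p A a b =
      fderiv ℝ (fundTensor f₂) (tangentLift ψ p) (fderiv ℝ (tangentLift ψ) p A)
        (fderiv ℝ ψ p.1 a) (fderiv ℝ ψ p.1 b)
      + fundTensor f₂ (tangentLift ψ p) (fderiv ℝ (fderiv ℝ ψ) p.1 A.1 a) (fderiv ℝ ψ p.1 b)
      + fundTensor f₂ (tangentLift ψ p) (fderiv ℝ ψ p.1 a)
        (fderiv ℝ (fderiv ℝ ψ) p.1 A.1 b) := by
  have h1 := congrArg (fun L => L A) (fderiv_congr_of_isOpen h.fst.isOpen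
    (fun q hq => h.fundTensor_eq hq a b) hp)
  beta_reduce at h1
  have d1 := h.fst.differentiableAt_fundTensor hp
  have d2 := h.differentiableAt_comp h.snd.contDiffOn_fundTensor hp
  have dJ := h.differentiableAt_jac hp
  rw [fderiv_apply_apply_const d1, fderiv_apply_apply₂ d2 (dJ.clm_apply (differentiableAt_const _))
    (dJ.clm_apply (differentiableAt_const _)), fderiv_apply_const dJ, fderiv_apply_const dJ,
    h.fderiv_jac hp, h.fderiv_comp h.snd.contDiffOn_fundTensor hp] at h1
  exact h1

theorem ext_jac (hp : p ∈ slit O₁) {a b : E}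
    (hab : ∀ w, fundTensor f₂ (tangentLift ψ p) a (fderiv ℝ ψ p.1 w) =
      fundTensor f₂ (tangentLift ψ p) b (fderiv ℝ ψ p.1 w)) : a = b := by
  refine h.snd.fundTensor_ext (h.mem_slit hp) fun w => ?_
  obtain ⟨w', rfl⟩ := (h.bijective _ (mem_base hp)).2 w
  exact hab w'

variable [FiniteDimensional ℝ E]

/-- The Hessian term is the one that x'' acquires under ψ in the geodesic equation x'' + 2G = 0,
hence the factor 1/2. -/
theorem spray_eq (hp : p ∈ slit O₁) :
    fderiv ℝ ψ p.1 (spray f₁ p) = spray f₂ (tangentLift ψ p)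
      + (1 / 2 : ℝ) • fderiv ℝ (fderiv ℝ ψ) p.1 p.2 p.2 := by
  refine h.ext_jac hp fun w => ?_
  have h1 := h.fst.fundTensor_spray hp w
  have h2 := h.snd.fundTensor_spray (h.mem_slit hp) (fderiv ℝ ψ p.1 w)
  rw [h.fundTensor_eq hp, h.fderiv_dFibre_energy hp, h.fderiv_energy hp, h.fderiv_tangentLift hp,
    h.fderiv_tangentLift hp, h.hess_symm hp w p.2] at h1
  have e : ∀ a b : E, ((a, b) : E × E) = (a, 0) + (0, b) := fun a b => by simp
  have e1 : (tangentLift ψ p).2 = fderiv ℝ ψ p.1 p.2 := rfl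
  have e2 : ∀ b w, fderiv ℝ (dFibre (energy f₂)) (tangentLift ψ p) (0, b) w =
    fundTensor f₂ (tangentLift ψ p) b w := fun _ _ => rfl
  have e3 : ∀ b, fderiv ℝ (energy f₂) (tangentLift ψ p) (0, b) =
    dFibre (energy f₂) (tangentLift ψ p) b := fun _ => rfl
  simp only [map_zero, add_zero] at h1
  rw [e (fderiv ℝ ψ p.1 p.2), e (fderiv ℝ ψ p.1 w), map_add, map_add, _root_.add_apply, e2,
    e3] at h1
  rw [e1] at h2
  rw [map_add, _root_.add_apply, map_smul, _root_.smul_apply, smul_eq_mul]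
  linarith

theorem nonlin_eq (hp : p ∈ slit O₁) (b : E) :
    fderiv ℝ ψ p.1 (nonlin f₁ p b) = nonlin f₂ (tangentLift ψ p) (fderiv ℝ ψ p.1 b)
      + fderiv ℝ (fderiv ℝ ψ) p.1 b p.2 := by
  have h1 := congrArg (fun L => L (0, b)) (fderiv_congr_of_isOpen h.fst.isOpen
    (fun q hq => h.spray_eq hq) hp)
  beta_reduce at h1
  have d1 := differentiableAt_of_contDiffOn h.fst.isOpen h.fst.contDiffOn_spray hp
  have d2 := h.differentiableAt_comp h.snd.contDiffOn_spray hp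
  have dJ := h.differentiableAt_jac hp
  have dH := h.differentiableAt_hess hp
  have d4 := (dH.clm_apply (differentiableAt_snd (𝕜 := ℝ))).clm_apply
    (differentiableAt_snd (𝕜 := ℝ))
  rw [fderiv_apply_apply dJ d1, fderiv_fun_add d2 (d4.fun_const_smul _), fderiv_fun_const_smul d4,
    _root_.add_apply, _root_.smul_apply, fderiv_apply_apply₂ dH differentiableAt_snd
    differentiableAt_snd, h.fderiv_jac hp, h.fderiv_hess hp,
    h.fderiv_comp h.snd.contDiffOn_spray hp, h.fderiv_tangentLift_fibre hp, fderiv_snd] at h1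
  simp only [map_zero, _root_.zero_apply, zero_add] at h1
  change fderiv ℝ ψ p.1 (nonlin f₁ p b) = nonlin f₂ (tangentLift ψ p) (fderiv ℝ ψ p.1 b) +
    (1 / 2 : ℝ) • (fderiv ℝ (fderiv ℝ ψ) p.1 b p.2 + fderiv ℝ (fderiv ℝ ψ) p.1 p.2 b) at h1
  rw [h1, h.hess_symm hp p.2 b]
  module

/-- The inhomogeneous Hessian term in the law for N is exactly what the derivative of `tangentLift`
adds, so the two cancel. -/
theorem fderiv_tangentLift_horLift (hp : p ∈ slit O₁) (a : E) :
    fderiv ℝ (tangentLift ψ) p (horLift f₁ p a) =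
      horLift f₂ (tangentLift ψ p) (fderiv ℝ ψ p.1 a) := by
  rw [h.fderiv_tangentLift hp, IsLocalFinsler.horLift_apply, IsLocalFinsler.horLift_apply]
  simp only [map_neg, h.nonlin_eq hp]
  congr 1
  abel

theorem vertPart_eq (hp : p ∈ slit O₁) (A : E × E) :
    fderiv ℝ ψ p.1 (vertPart f₁ p A) =
      vertPart f₂ (tangentLift ψ p) (fderiv ℝ (tangentLift ψ) p A) := by
  rw [vertPart_apply, vertPart_apply, h.fderiv_tangentLift hp, map_add, h.nonlin_eq hp]
  dsimp only
  abel

theorem christoffel_eq (hp : p ∈ slit O₁) (a c : E) :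
    fderiv ℝ ψ p.1 (christoffel f₁ p a c) =
      christoffel f₂ (tangentLift ψ p) (fderiv ℝ ψ p.1 a) (fderiv ℝ ψ p.1 c)
      + fderiv ℝ (fderiv ℝ ψ) p.1 a c := by
  refine h.ext_jac hp fun w => ?_
  have h1 := h.fst.fundTensor_christoffel hp a c w
  have h2 := h.snd.fundTensor_christoffel (h.mem_slit hp) (fderiv ℝ ψ p.1 a) (fderiv ℝ ψ p.1 c)
    (fderiv ℝ ψ p.1 w)
  have e : ∀ x, (horLift f₁ p x).1 = x := fun _ => rfl
  have hs := h.snd.fundTensor_symm (h.mem_slit hp)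
  rw [h.fundTensor_eq hp, h.fderiv_fundTensor hp, h.fderiv_fundTensor hp, h.fderiv_fundTensor hp,
    h.fderiv_tangentLift_horLift hp, h.fderiv_tangentLift_horLift hp,
    h.fderiv_tangentLift_horLift hp, e, e, e, h.hess_symm hp w a, h.hess_symm hp w c,
    h.hess_symm hp c a, hs (fderiv ℝ ψ p.1 c), hs (fderiv ℝ ψ p.1 a)
      (fderiv ℝ (fderiv ℝ ψ) p.1 c w)] at h1
  rw [map_add, _root_.add_apply]
  linarith [hs (fderiv ℝ ψ p.1 a) (fderiv ℝ (fderiv ℝ ψ) p.1 c w)]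

theorem cartanTensor_eq (hp : p ∈ slit O₁) (b c : E) :
    fderiv ℝ ψ p.1 (cartanTensor f₁ p b c) =
      cartanTensor f₂ (tangentLift ψ p) (fderiv ℝ ψ p.1 b) (fderiv ℝ ψ p.1 c) := by
  refine h.ext_jac hp fun w => ?_
  have h1 := h.fst.fundTensor_cartanTensor hp b c w
  have h2 := h.snd.fundTensor_cartanTensor (h.mem_slit hp) (fderiv ℝ ψ p.1 b) (fderiv ℝ ψ p.1 c)
    (fderiv ℝ ψ p.1 w)
  rw [h.fundTensor_eq hp, h.fderiv_fundTensor hp, h.fderiv_tangentLift_fibre hp] at h1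
  simp only [map_zero, _root_.zero_apply, add_zero] at h1
  linarith

theorem connForm_eq (hp : p ∈ slit O₁) (A : E × E) (c : E) :
    fderiv ℝ ψ p.1 (connForm f₁ p A c) =
      connForm f₂ (tangentLift ψ p) (fderiv ℝ (tangentLift ψ) p A) (fderiv ℝ ψ p.1 c)
      + fderiv ℝ (fderiv ℝ ψ) p.1 A.1 c := by
  have e : (fderiv ℝ (tangentLift ψ) p A).1 = fderiv ℝ ψ p.1 A.1 := by
    rw [h.fderiv_tangentLift hp]
  rw [IsLocalFinsler.connForm_apply, IsLocalFinsler.connForm_apply, ← vertPart_apply,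
    ← vertPart_apply, ← h.vertPart_eq hp, e, _root_.add_apply, _root_.add_apply, map_add,
    h.christoffel_eq hp, h.cartanTensor_eq hp]
  abel

theorem curv_eq (hp : p ∈ slit O₁) (A B : E × E) (c : E) :
    fderiv ℝ ψ p.1 (curv f₁ p A B c) =
      curv f₂ (tangentLift ψ p) (fderiv ℝ (tangentLift ψ) p A) (fderiv ℝ (tangentLift ψ) p B)
        (fderiv ℝ ψ p.1 c) := by
  have d1 := h.fst.differentiableAt_connForm hp
  have d2 := h.differentiableAt_comp h.snd.contDiffOn_connForm hp
  have dJ := h.differentiableAt_jac hp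
  have dH := h.differentiableAt_hess hp
  have dT := differentiableAt_fderiv h.fst.isOpen h.contDiffOn_tangentLift hp
  have c0 : ∀ {V : Type _} [NormedAddCommGroup V] [NormedSpace ℝ V] (x : V),
    DifferentiableAt ℝ (fun _ : E × E => x) p := fun x => differentiableAt_const x
  -- The gauge law of the connection form, differentiated. Alternation in A and B removes the second
  -- derivative of `tangentLift` and the third derivative of ψ; the Hessian terms are absorbed by
  -- the commutators.
  have key : ∀ A B, fderiv ℝ (fderiv ℝ ψ) p.1 A.1 (connForm f₁ p B c)
      + fderiv ℝ ψ p.1 (fderiv ℝ (connForm f₁) p A B c) =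
      fderiv ℝ (connForm f₂) (tangentLift ψ p) (fderiv ℝ (tangentLift ψ) p A)
        (fderiv ℝ (tangentLift ψ) p B) (fderiv ℝ ψ p.1 c)
      + connForm f₂ (tangentLift ψ p) (fderiv ℝ (fderiv ℝ (tangentLift ψ)) p A B)
        (fderiv ℝ ψ p.1 c)
      + connForm f₂ (tangentLift ψ p) (fderiv ℝ (tangentLift ψ) p B)
        (fderiv ℝ (fderiv ℝ ψ) p.1 A.1 c)
      + fderiv ℝ (fderiv ℝ (fderiv ℝ ψ)) p.1 A.1 B.1 c := by
    intro A B
    have h1 := congrArg (fun L => L A) (fderiv_congr_of_isOpen h.fst.isOpen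
      (fun q hq => h.connForm_eq hq B c) hp)
    beta_reduce at h1
    have e1 : DifferentiableAt ℝ (fun q => connForm f₁ q B c) p :=
      (d1.clm_apply (c0 B)).clm_apply (c0 c)
    have e2 := dT.clm_apply (c0 B)
    have e3 := dJ.clm_apply (c0 c)
    rw [fderiv_apply_apply dJ e1, fderiv_fun_add ((d2.clm_apply e2).clm_apply e3)
      ((dH.clm_apply (c0 B.1)).clm_apply (c0 c)), _root_.add_apply,
      fderiv_apply_apply₂ d2 e2 e3, fderiv_apply_apply_const dH, fderiv_apply_apply_const d1,
      h.fderiv_jac hp, fderiv_apply_const dT, fderiv_apply_const dJ, h.fderiv_jac hp,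
      h.fderiv_hess hp, h.fderiv_comp h.snd.contDiffOn_connForm hp] at h1
    exact h1
  have kAB := key A B
  have kBA := key B A
  rw [fderiv_fderiv_comm h.fst.isOpen h.contDiffOn_tangentLift hp B A,
    fderiv_fderiv_comm h.fst.isOpen_base h.contDiffOn_fderiv (mem_base hp) B.1 A.1] at kBA
  have e1 := h.connForm_eq hp A (connForm f₁ p B c)
  have e2 := h.connForm_eq hp B (connForm f₁ p A c)
  rw [h.connForm_eq hp B c, map_add] at e1
  rw [h.connForm_eq hp A c, map_add] at e2
  simp only [curv, _root_.add_apply, _root_.sub_apply, ContinuousLinearMap.comp_apply, map_add,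
    map_sub]
  rw [← eq_sub_iff_add_eq'] at kAB kBA
  rw [e1, e2, kAB, kBA]
  abel

theorem hhCurv_eq (hp : p ∈ slit O₁) (a b c : E) :
    fderiv ℝ ψ p.1 (hhCurv f₁ p a b c) =
      hhCurv f₂ (tangentLift ψ p) (fderiv ℝ ψ p.1 a) (fderiv ℝ ψ p.1 b) (fderiv ℝ ψ p.1 c) := by
  rw [hhCurv_apply, hhCurv_apply, h.curv_eq hp, h.fderiv_tangentLift_horLift hp,
    h.fderiv_tangentLift_horLift hp]

theorem modHH_eq (hp : p ∈ slit O₁) (a b c : E) :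
    fderiv ℝ ψ p.1 (modHH f₁ k p a b c) =
      modHH f₂ k (tangentLift ψ p) (fderiv ℝ ψ p.1 a) (fderiv ℝ ψ p.1 b)
        (fderiv ℝ ψ p.1 c) := by
  rw [modHH_apply, modHH_apply, _root_.sub_apply, _root_.sub_apply, map_sub, h.hhCurv_eq hp,
    constCurv_apply, constCurv_apply, map_smul, map_sub, map_smul, map_smul, h.fundTensor_eq hp,
    h.fundTensor_eq hp]

/-- The nullity spaces are independent of the choice of coordinates. -/
theorem modHH_eq_zero_iff (hp : p ∈ slit O₁) (a : E) :
    modHH f₁ k p a = 0 ↔ modHH f₂ k (tangentLift ψ p) (fderiv ℝ ψ p.1 a) = 0 := by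
  have hb := h.bijective _ (mem_base hp)
  constructor
  · intro h0
    ext b c
    obtain ⟨b, rfl⟩ := hb.2 b
    obtain ⟨c, rfl⟩ := hb.2 c
    rw [← h.modHH_eq hp, h0]
    simp
  · intro h0
    ext b c
    refine hb.1 ?_
    rw [h.modHH_eq hp, h0]
    simp

end IsChartChange
end ChartChange

/-! ### The nullity condition in terms of the modified curvature -/

section NullityIff

variable {E : Type*} [NormedAddCommGroup E] [NormedSpace ℝ E] [FiniteDimensional ℝ E]

/-- Vectors killed by `μ` are horizontal lifts of their base parts, and for them the ᵃP summand of
`η` has a zero argument. -/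
theorem IsLocalFinsler.mem_map_horNullity_iff {f : E × E → ℝ} {O : Set E}
    (hf : IsLocalFinsler f O) {p : E × E} (hp : p ∈ slit O) (k : ℝ) (a : E) :
    a ∈ (horNullity f k p).map (LinearMap.fst ℝ E E) ↔ modHH f k p a = 0 := by
  have key : ∀ a b, modCurv f k p (horLift f p a) (horLift f p b) = modHH f k p a b := by
    intro a b
    have e : ∀ a, (horLift f p a).1 = a := fun _ => rfl
    have h0 : ∀ c, hvCurv f p c 0 = 0 := fun c => map_zero (hvCurvL f p c)
    have h1 : ∀ c, hvCurv f p 0 c = 0 := fun c => by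
      change hvCurvL f p 0 c = 0
      rw [map_zero, _root_.zero_apply]
    rw [modCurv, etaTensor, hf.muMap_horLift hp, e, e, hvCurvAnti, h0, h1, sub_zero, smul_zero,
      add_zero]
    rfl
  simp only [Submodule.mem_map, LinearMap.fst_apply]
  constructor
  · rintro ⟨A, ⟨hA1, hA2⟩, rfl⟩
    ext1 b
    rw [← key, ← (hf.muMap_eq_zero_iff hp A).1 hA1]
    exact hA2 _ (hf.muMap_horLift hp b)
  · intro h0
    refine ⟨horLift f p a, ⟨hf.muMap_horLift hp a, fun B hB => ?_⟩, rfl⟩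
    rw [(hf.muMap_eq_zero_iff hp B).1 hB, key, h0, _root_.zero_apply]

end NullityIff

/-! ### Smoothness of superposition operators on spaces of continuous functions -/

section Superposition

universe u
variable {K : Type*} [TopologicalSpace K] [CompactSpace K]
variable {E F : Type u} [NormedAddCommGroup E] [NormedSpace ℝ E]
  [NormedAddCommGroup F] [NormedSpace ℝ F]

/-- Pointwise application of a continuous family of operators to a continuous family of vectors. -/
def pointwiseApply (K : Type*) [TopologicalSpace K] [CompactSpace K] (E F : Type u)
    [NormedAddCommGroup E] [NormedSpace ℝ E] [NormedAddCommGroup F] [NormedSpace ℝ F] :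
    C(K, E →L[ℝ] F) →L[ℝ] C(K, E) →L[ℝ] C(K, F) :=
  LinearMap.mkContinuous₂
    (LinearMap.mk₂ ℝ (fun (T : C(K, E →L[ℝ] F)) (h : C(K, E)) =>
      (⟨fun t => T t (h t), T.continuous.clm_apply h.continuous⟩ : C(K, F)))
      (fun _ _ _ => by ext; simp) (fun _ _ _ => by ext; simp)
      (fun _ _ _ => by ext; simp) (fun _ _ _ => by ext; simp)) 1
    (fun T h => by
      rw [one_mul]
      refine (ContinuousMap.norm_le _ (by positivity)).2 fun t => ?_
      exact ((T t).le_opNorm (h t)).trans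
        (mul_le_mul (T.norm_coe_le_norm t) (h.norm_coe_le_norm t) (norm_nonneg _) (norm_nonneg _)))

@[simp] theorem pointwiseApply_apply (T : C(K, E →L[ℝ] F)) (h : C(K, E)) (t : K) :
    pointwiseApply K E F T h t = T t (h t) := rfl

/-- The superposition operator `u ↦ B ∘ u`. -/
def superposition (K : Type*) [TopologicalSpace K] (B : E → F) (hB : Continuous B)
    (w : C(K, E)) : C(K, F) :=
  (⟨B, hB⟩ : C(E, F)).comp w

omit [CompactSpace K] [NormedSpace ℝ E] [NormedSpace ℝ F] in
@[simp] theorem superposition_apply {B : E → F} (hB : Continuous B) (w : C(K, E)) (t : K) :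
    superposition K B hB w t = B (w t) := rfl

omit [CompactSpace K] [NormedSpace ℝ E] [NormedSpace ℝ F] in
theorem continuous_superposition {B : E → F} (hB : Continuous B) :
    Continuous (superposition K B hB) :=
  ContinuousMap.continuous_postcomp _

/-- The mean value inequality is applied at each t; uniformity in t comes from continuity of w ↦ B'
∘ w in the sup norm. -/
theorem hasFDerivAt_superposition {B : E → F} (hB : ContDiff ℝ ∞ B) (w : C(K, E)) :
    HasFDerivAt (superposition K B hB.continuous)
      (pointwiseApply K E F (superposition K (fderiv ℝ B) (hB.continuous_fderiv (by simp)) w)) w := by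
  have hB' := hB.continuous_fderiv (by simp)
  rw [hasFDerivAt_iff_isLittleO_nhds_zero, Asymptotics.isLittleO_iff]
  intro ε hε
  have hc : ContinuousAt (superposition K (fderiv ℝ B) hB') w :=
    (continuous_superposition hB').continuousAt
  obtain ⟨δ, hδ, hw⟩ := Metric.continuousAt_iff.1 hc ε hε
  filter_upwards [Metric.ball_mem_nhds (0 : C(K, E)) hδ] with h hh
  rw [mem_ball_zero_iff] at hh
  refine (ContinuousMap.norm_le _ (by positivity)).2 fun t => ?_
  have hbound : ∀ z ∈ Metric.ball (w t) δ, ‖fderiv ℝ B z - fderiv ℝ B (w t)‖ ≤ ε := by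
    intro z hz
    -- Translating w by a constant reaches the value z at t, which turns the sup norm estimate into
    -- one on a ball around w t.
    have h1 : dist (w + ContinuousMap.const K (z - w t)) w < δ := by
      rw [dist_eq_norm, add_sub_cancel_left]
      refine lt_of_le_of_lt ((ContinuousMap.norm_le _ (norm_nonneg (z - w t))).2
        fun s => le_rfl) ?_
      rwa [← dist_eq_norm]
    have h2 := hw h1
    have h3 := (ContinuousMap.dist_apply_le_dist (f := superposition K (fderiv ℝ B) hB'
      (w + ContinuousMap.const K (z - w t))) (g := superposition K (fderiv ℝ B) hB' w) t)
    simp only [superposition_apply, ContinuousMap.add_apply, ContinuousMap.const_apply,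
      add_sub_cancel] at h3
    rw [← dist_eq_norm]
    exact h3.trans h2.le
  have hmem : w t + h t ∈ Metric.ball (w t) δ := by
    rw [Metric.mem_ball, dist_eq_norm, add_sub_cancel_left]
    exact (h.norm_coe_le_norm t).trans_lt hh
  have h4 := (convex_ball (w t) δ).norm_image_sub_le_of_norm_fderiv_le' (𝕜 := ℝ) (f := B)
    (fun z _ => (hB.differentiable (by simp)) z) hbound (Metric.mem_ball_self hδ) hmem
  rw [add_sub_cancel_left] at h4
  refine h4.trans ?_
  gcongr
  exact h.norm_coe_le_norm t

/-- The derivative is a continuous linear map applied to the superposition operator of B', so induct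
on the order. The induction replaces F by E →L[ℝ] F, which is why E and F share a universe. -/
theorem contDiff_superposition {B : E → F} (hB : ContDiff ℝ ∞ B) :
    ContDiff ℝ ∞ (superposition K B hB.continuous) := by
  rw [contDiff_infty]
  intro n
  induction n generalizing F with
  | zero => exact contDiff_zero.2 (continuous_superposition _)
  | succ n ih =>
    have hB' : ContDiff ℝ ∞ (fderiv ℝ B) := hB.fderiv_right (by simp)
    rw [Nat.cast_succ, contDiff_succ_iff_hasFDerivAt]
    exact ⟨_, (pointwiseApply K E F).contDiff.comp (ih hB'), hasFDerivAt_superposition hB⟩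

end Superposition

/-! ### Integration as a bounded operator on paths -/

section Primitive

variable {E : Type*} [NormedAddCommGroup E] [NormedSpace ℝ E]

/-- The extension of a path to the real line that is constant outside the unit interval. -/
def extendPath (w : C(unitInterval, E)) : ℝ → E := Set.IccExtend zero_le_one w

omit [NormedSpace ℝ E] in
theorem continuous_extendPath (w : C(unitInterval, E)) : Continuous (extendPath w) :=
  w.continuous.Icc_extend'

omit [NormedSpace ℝ E] in
theorem extendPath_coe (w : C(unitInterval, E)) (t : unitInterval) : extendPath w t = w t :=
  Set.IccExtend_val _ _ _

omit [NormedSpace ℝ E] in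
theorem norm_extendPath_le (w : C(unitInterval, E)) (t : ℝ) : ‖extendPath w t‖ ≤ ‖w‖ :=
  w.norm_coe_le_norm _

/-- The primitive of a path that vanishes at zero. -/
def primitive (E : Type*) [NormedAddCommGroup E] [NormedSpace ℝ E] :
    C(unitInterval, E) →L[ℝ] C(unitInterval, E) :=
  LinearMap.mkContinuous
    { toFun := fun w => ⟨fun t => ∫ s in (0 : ℝ)..t, extendPath w s,
        (intervalIntegral.continuous_primitive
          (fun a b => (continuous_extendPath w).intervalIntegrable a b) 0).comp
          continuous_subtype_val⟩
      map_add' := fun w w' => by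
        ext t
        exact intervalIntegral.integral_add ((continuous_extendPath w).intervalIntegrable _ _)
          ((continuous_extendPath w').intervalIntegrable _ _)
      map_smul' := fun c w => by
        ext t
        exact intervalIntegral.integral_smul c _ } 1
    (fun w => by
      rw [one_mul]
      refine (ContinuousMap.norm_le _ (norm_nonneg _)).2 fun t => ?_
      refine (intervalIntegral.norm_integral_le_of_norm_le_const
        (fun s _ => norm_extendPath_le w s)).trans ?_
      rw [sub_zero, abs_of_nonneg t.2.1]
      exact mul_le_of_le_one_right (norm_nonneg _) t.2.2)

theorem primitive_apply (w : C(unitInterval, E)) (t : unitInterval) :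
    primitive E w t = ∫ s in (0 : ℝ)..t, extendPath w s := rfl

end Primitive

/-! ### Smooth flows by the inverse function theorem; straightening commuting fields -/

section FlowChart

universe u
variable {E : Type u} [NormedAddCommGroup E] [NormedSpace ℝ E]

/-- The right-hand side of the integral equation of the curves `w' = B(w) ξ` with initial point
`y₀ + π ξ`. -/
def picardMap (B : E → E →L[ℝ] E) (hB : Continuous B) (π : E →L[ℝ] E) (y₀ : E)
    (q : E × C(unitInterval, E)) : C(unitInterval, E) :=
  ContinuousMap.const _ (y₀ + π q.1) + primitive E (pointwiseApply unitInterval E E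
    (superposition unitInterval B hB q.2) (ContinuousMap.const _ q.1))

/-- The derivative of `picardMap`. -/
def picardDeriv (B : E → E →L[ℝ] E) (hB : ContDiff ℝ ∞ B) (π : E →L[ℝ] E)
    (q : E × C(unitInterval, E)) (r : E × C(unitInterval, E)) : C(unitInterval, E) :=
  ContinuousMap.const _ (π r.1) + primitive E
    (pointwiseApply unitInterval E E (pointwiseApply unitInterval E (E →L[ℝ] E)
      (superposition unitInterval (fderiv ℝ B) (hB.continuous_fderiv (by simp)) q.2) r.2)
      (ContinuousMap.const _ q.1)
    + pointwiseApply unitInterval E E (superposition unitInterval B hB.continuous q.2)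
      (ContinuousMap.const _ r.1))

theorem hasFDerivAt_picardMap {B : E → E →L[ℝ] E} (hB : ContDiff ℝ ∞ B) (π : E →L[ℝ] E) (y₀ : E)
    (q : E × C(unitInterval, E)) :
    ∃ L : E × C(unitInterval, E) →L[ℝ] C(unitInterval, E),
      HasFDerivAt (picardMap B hB.continuous π y₀) L q ∧ ∀ r, L r = picardDeriv B hB π q r := by
  have h1 := (hasFDerivAt_superposition (K := unitInterval) hB q.2).comp q
    (hasFDerivAt_snd (𝕜 := ℝ) (E := E) (F := C(unitInterval, E)))
  have h2 : HasFDerivAt (fun q : E × C(unitInterval, E) => ContinuousMap.const unitInterval q.1)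
      ((ContinuousLinearMap.const ℝ unitInterval).comp
        (ContinuousLinearMap.fst ℝ E C(unitInterval, E))) q :=
    ((ContinuousLinearMap.const ℝ unitInterval).comp
        (ContinuousLinearMap.fst ℝ E C(unitInterval, E))).hasFDerivAt
  have h3 := ((pointwiseApply unitInterval E E).hasFDerivAt.comp q h1).clm_apply h2
  have h4 := (primitive E).hasFDerivAt.comp q h3
  have h5 : HasFDerivAt (fun q : E × C(unitInterval, E) =>
      ContinuousMap.const unitInterval (y₀ + π q.1))
      ((ContinuousLinearMap.const ℝ unitInterval).comp
        (π.comp (ContinuousLinearMap.fst ℝ E C(unitInterval, E)))) q := by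
    have h6 := ((ContinuousLinearMap.const ℝ unitInterval).comp
        (π.comp (ContinuousLinearMap.fst ℝ E C(unitInterval, E)))).hasFDerivAt (x := q)
    exact h6.const_add (ContinuousMap.const unitInterval y₀)
  refine ⟨_, h5.add h4, fun r => ?_⟩
  have e : ∀ x y z w : C(unitInterval, E), x = z → y = w → x + y = z + w := by
    rintro x y z w rfl rfl; rfl
  refine e _ _ _ _ rfl (congrArg (primitive E) ?_)
  exact add_comm _ _

theorem contDiff_picardMap {B : E → E →L[ℝ] E} (hB : ContDiff ℝ ∞ B) (π : E →L[ℝ] E) (y₀ : E) :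
    ContDiff ℝ ∞ (picardMap B hB.continuous π y₀) := by
  have h1 : ContDiff ℝ ∞ (fun q : E × C(unitInterval, E) =>
      superposition unitInterval B hB.continuous q.2) :=
    (contDiff_superposition hB).comp contDiff_snd
  have h2 : ContDiff ℝ ∞ (fun q : E × C(unitInterval, E) =>
      ContinuousMap.const unitInterval q.1) :=
    ((ContinuousLinearMap.const ℝ unitInterval).comp
        (ContinuousLinearMap.fst ℝ E C(unitInterval, E))).contDiff
  have h3 := ((pointwiseApply unitInterval E E).contDiff.comp h1).clm_apply h2
  have h5 : ContDiff ℝ ∞ (fun q : E × C(unitInterval, E) =>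
      ContinuousMap.const unitInterval (y₀ + π q.1)) :=
    (contDiff_const (c := ContinuousMap.const unitInterval y₀)).add
      ((ContinuousLinearMap.const ℝ unitInterval).comp
        (π.comp (ContinuousLinearMap.fst ℝ E C(unitInterval, E)))).contDiff
  exact h5.add ((primitive E).contDiff.comp h3)

/-- Passes from the integral equation to a differential one on the whole line, so that no one-sided
derivatives occur at the ends of the interval. -/
theorem extendPath_picard [CompleteSpace E] {B : E → E →L[ℝ] E} (hB : Continuous B)
    {π : E →L[ℝ] E} {y₀ ξ : E} {w : C(unitInterval, E)} (hw : w = picardMap B hB π y₀ (ξ, w)) :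
    ∃ c : ℝ → E, (∀ t : unitInterval, c t = w t) ∧
      ∀ t, HasDerivAt c (B (extendPath w t) ξ) t := by
  have hc : Continuous fun s => B (extendPath w s) ξ :=
    (hB.comp (continuous_extendPath w)).clm_apply continuous_const
  refine ⟨fun t => y₀ + π ξ + ∫ s in (0 : ℝ)..t, B (extendPath w s) ξ, fun t => ?_, fun t => ?_⟩
  · have := congrArg (fun u => u t) hw
    beta_reduce at this
    rw [this]
    rfl
  · exact (intervalIntegral.integral_hasDerivAt_right (hc.intervalIntegrable _ _)
      (hc.stronglyMeasurableAtFilter _ _) hc.continuousAt).const_add _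

/-- The derivative of the solution in a direction along which the fields commute. -/
theorem picardDeriv_commuting [CompleteSpace E] {B : E → E →L[ℝ] E} (hB : ContDiff ℝ ∞ B)
    {π : E →L[ℝ] E} {y₀ ξ η : E} {w : C(unitInterval, E)}
    (hw : w = picardMap B hB.continuous π y₀ (ξ, w)) (hη : π η = 0)
    (hcomm : ∀ t, fderiv ℝ B (w t) (B (w t) ξ) η = fderiv ℝ B (w t) (B (w t) η) ξ) :
    ∃ v : C(unitInterval, E), v = picardDeriv B hB π (ξ, w) (η, v) ∧ v 1 = B (w 1) η := by
  obtain ⟨c, hc, hc'⟩ := extendPath_picard hB.continuous hw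
  have hBd := hB.differentiable (by simp)
  -- For commuting fields, adding η to ξ amounts to flowing additionally along B(·)η, which suggests
  -- t B(w)η as variation. The initial point does not move because π η = 0.
  let v : C(unitInterval, E) := ⟨fun t => (t : ℝ) • B (w t) η, by
    exact continuous_subtype_val.smul ((hB.continuous.comp w.continuous).clm_apply
      continuous_const)⟩
  have hv : ∀ t, v t = (t : ℝ) • B (w t) η := fun _ => rfl
  refine ⟨v, ?_, by rw [hv]; simp⟩
  have hd : ∀ s, HasDerivAt (fun t => t • B (c t) η)
      (s • fderiv ℝ B (c s) (B (extendPath w s) ξ) η + (1 : ℝ) • B (c s) η) s := by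
    intro s
    have h1 := ((hBd (c s)).hasFDerivAt.comp_hasDerivAt s (hc' s))
    have h2 : HasDerivAt (fun t => B (c t) η) (fderiv ℝ B (c s) (B (extendPath w s) ξ) η) s := by
      simpa using h1.clm_apply (hasDerivAt_const s η)
    exact (hasDerivAt_id s).smul h2
  ext t
  have hcw : ∀ s ∈ Set.uIcc (0 : ℝ) t, ∃ s' : unitInterval, (s' : ℝ) = s := by
    intro s hs
    rw [Set.uIcc_of_le t.2.1] at hs
    exact ⟨⟨s, hs.1, hs.2.trans t.2.2⟩, rfl⟩
  have hcont : Continuous c := continuous_iff_continuousAt.2 fun s => (hc' s).continuousAt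
  have hint : IntervalIntegrable (fun s => s • fderiv ℝ B (c s) (B (extendPath w s) ξ) η
      + (1 : ℝ) • B (c s) η) MeasureTheory.volume 0 t := by
    refine Continuous.intervalIntegrable ?_ _ _
    refine (continuous_id.smul (((((hB.continuous_fderiv (by simp)).comp hcont).clm_apply
      ((hB.continuous.comp (continuous_extendPath w)).clm_apply continuous_const))).clm_apply
      continuous_const)).add (continuous_const.smul
      ((hB.continuous.comp hcont).clm_apply continuous_const))
  have hI := intervalIntegral.integral_eq_sub_of_hasDerivAt (fun s _ => hd s) hint
  rw [zero_smul, sub_zero, hc] at hI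
  rw [hv, ← hI, picardDeriv, hη]
  change _ = (0 : E) + primitive E _ t
  rw [zero_add, primitive_apply]
  refine intervalIntegral.integral_congr fun s hs => ?_
  obtain ⟨s', rfl⟩ := hcw s hs
  rw [extendPath_coe, hc, extendPath_coe]
  simp only [ContinuousMap.add_apply, pointwiseApply_apply, superposition_apply,
    ContinuousMap.const_apply, hv, map_smul, _root_.smul_apply, one_smul, hcomm]

theorem pointwiseApply_const_zero {K : Type*} {E F : Type u} [TopologicalSpace K] [CompactSpace K]
    [NormedAddCommGroup E] [NormedSpace ℝ E] [NormedAddCommGroup F] [NormedSpace ℝ F]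
    (T : C(K, E →L[ℝ] F)) : pointwiseApply K E F T (ContinuousMap.const K 0) = 0 := by
  ext t; simp

theorem primitive_const_one [CompleteSpace E] (a : E) :
    primitive E (ContinuousMap.const _ a) 1 = a := by
  rw [primitive_apply]
  have : ∀ s, extendPath (ContinuousMap.const unitInterval a) s = a := fun _ => rfl
  simp [this]

/-- Solutions of the integral equation depend smoothly on the parameter. -/
theorem exists_smooth_solution [FiniteDimensional ℝ E] {B : E → E →L[ℝ] E}
    (hB : ContDiff ℝ ∞ B) (π : E →L[ℝ] E) {y₀ : E} {V : Set E} (hV : IsOpen V) (hy₀ : y₀ ∈ V) :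
    ∃ (U : Set E) (S : E → C(unitInterval, E)), IsOpen U ∧ (0 : E) ∈ U ∧ ContDiffOn ℝ ∞ S U ∧
      S 0 = ContinuousMap.const _ y₀ ∧ (∀ ξ ∈ U, ∀ t, S ξ t ∈ V) ∧
      (∀ ξ ∈ U, S ξ = picardMap B hB.continuous π y₀ (ξ, S ξ)) ∧
      (∀ ξ ∈ U, ∀ η, fderiv ℝ S ξ η = picardDeriv B hB π (ξ, S ξ) (η, fderiv ℝ S ξ η)) ∧
      ∀ ξ ∈ U, ∀ η v, v = picardDeriv B hB π (ξ, S ξ) (η, v) → fderiv ℝ S ξ η = v := by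
  let X := E × C(unitInterval, E)
  let pm := picardMap B hB.continuous π y₀
  choose L hL hLa using hasFDerivAt_picardMap hB π y₀
  -- Solutions of the fixed point equation with parameter ξ are the preimages of (ξ, 0).
  let ψ : X → X := fun q => (q.1, q.2 - pm q)
  have hψ : ContDiff ℝ ∞ ψ :=
    contDiff_fst.prodMk (contDiff_snd.sub (contDiff_picardMap hB π y₀))
  have hψ' : ∀ q, HasFDerivAt ψ ((ContinuousLinearMap.fst ℝ E C(unitInterval, E)).prod
      (ContinuousLinearMap.snd ℝ E C(unitInterval, E) - L q)) q := fun q =>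
    hasFDerivAt_fst.prodMk (hasFDerivAt_snd.sub (hL q))
  let q₀ : X := (0, ContinuousMap.const _ y₀)
  -- At ξ = 0 the derivative in the path variable carries the factor ξ, so ψ has a triangular
  -- derivative with identity diagonal, and no smallness of B is needed.
  have hL₀ : ∀ h, L q₀ (0, h) = 0 := by
    intro h
    rw [hLa, picardDeriv]
    rw [map_zero]
    have h1 : ∀ (T₁ T₂ : C(unitInterval, E →L[ℝ] E)), ContinuousMap.const unitInterval (0 : E)
        + primitive E (pointwiseApply unitInterval E E T₁ (ContinuousMap.const _ 0)
        + pointwiseApply unitInterval E E T₂ (ContinuousMap.const _ 0)) = 0 := by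
      intro T₁ T₂
      rw [pointwiseApply_const_zero, pointwiseApply_const_zero, add_zero, map_zero, add_zero]
      rfl
    exact h1 _ _
  have hL₁ : ∀ r : X, L q₀ r = L q₀ (r.1, 0) := by
    intro r
    have h1 : r = (r.1, 0) + (0, r.2) := Prod.ext (add_zero _).symm (zero_add _).symm
    calc L q₀ r = L q₀ ((r.1, 0) + (0, r.2)) := congrArg _ h1
      _ = L q₀ (r.1, 0) := by rw [map_add, hL₀, add_zero]
  let D : E →L[ℝ] C(unitInterval, E) := (L q₀).comp (ContinuousLinearMap.inl ℝ E _)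
  let e : X ≃L[ℝ] X := ContinuousLinearEquiv.equivOfInverse
    ((ContinuousLinearMap.fst ℝ E C(unitInterval, E)).prod
      (ContinuousLinearMap.snd ℝ E C(unitInterval, E) - L q₀))
    ((ContinuousLinearMap.fst ℝ E C(unitInterval, E)).prod
      (ContinuousLinearMap.snd ℝ E C(unitInterval, E)
        + D.comp (ContinuousLinearMap.fst ℝ E C(unitInterval, E))))
    (fun r => by
      refine Prod.ext rfl ?_
      change r.2 - L q₀ r + L q₀ (r.1, 0) = r.2
      rw [hL₁ r]; abel)
    (fun r => by
      refine Prod.ext rfl ?_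
      change r.2 + L q₀ (r.1, 0) - L q₀ (r.1, r.2 + L q₀ (r.1, 0)) = r.2
      rw [hL₁ (r.1, r.2 + L q₀ (r.1, 0))]; simp)
  have he : HasFDerivAt ψ (e : X →L[ℝ] X) q₀ := hψ' q₀
  have hn : (∞ : WithTop ℕ∞) ≠ 0 := by simp
  let P := (hψ.contDiffAt (x := q₀)).toOpenPartialHomeomorph ψ he hn
  have hP : ∀ q, P q = ψ q := fun _ => rfl
  have hPs : q₀ ∈ P.source := ContDiffAt.mem_toOpenPartialHomeomorph_source _ he hn
  have hψ₀ : ψ q₀ = (0, 0) := by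
    refine Prod.ext rfl ?_
    have h1 : ∀ T : C(unitInterval, E →L[ℝ] E), ContinuousMap.const unitInterval y₀
        - (ContinuousMap.const _ (y₀ + π 0) + primitive E
          (pointwiseApply unitInterval E E T (ContinuousMap.const _ 0))) = 0 := by
      intro T
      rw [pointwiseApply_const_zero, map_zero, map_zero, add_zero, add_zero, sub_self]
    exact h1 _
  have hPt : ((0, 0) : X) ∈ P.target := by
    rw [← hψ₀, ← hP]; exact P.map_source hPs
  have hP0 : P.symm (0, 0) = q₀ := by
    rw [← hψ₀, ← hP]; exact P.left_inv hPs
  -- Invertibility of the derivative serves twice: for smoothness of the inverse at nearby points,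
  -- and for uniqueness in the linearised equation. The second condition keeps the paths inside V.
  let N : Set X := {q | fderiv ℝ ψ q ∈ Set.range ((↑) : (X ≃L[ℝ] X) → X →L[ℝ] X)} ∩
    Prod.snd ⁻¹' {w : C(unitInterval, E) | Set.MapsTo w Set.univ V}
  have hN : IsOpen N :=
    (ContinuousLinearEquiv.isOpen.preimage (hψ.continuous_fderiv hn)).inter
      ((ContinuousMap.isOpen_setOfPred_mapsTo isCompact_univ hV).preimage continuous_snd)
  have hT : IsOpen (P.target ∩ P.symm ⁻¹' N) := P.symm.isOpen_inter_preimage hN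
  let U : Set E := (fun ξ => ((ξ, 0) : X)) ⁻¹' (P.target ∩ P.symm ⁻¹' N)
  have hU : IsOpen U := hT.preimage (by fun_prop)
  let S : E → C(unitInterval, E) := fun ξ => (P.symm (ξ, 0)).2
  have hS : ∀ ξ ∈ U, P.symm (ξ, 0) = (ξ, S ξ) ∧ S ξ = pm (ξ, S ξ) := by
    intro ξ hξ
    have h1 : ψ (P.symm (ξ, 0)) = (ξ, 0) := P.right_inv hξ.1
    have h2 : (P.symm (ξ, 0)).1 = ξ := congrArg Prod.fst h1
    have h3 : P.symm (ξ, 0) = (ξ, S ξ) := Prod.ext h2 rfl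
    refine ⟨h3, ?_⟩
    rw [h3] at h1
    exact sub_eq_zero.1 (congrArg Prod.snd h1)
  have hSd : ∀ ξ ∈ U, ContDiffAt ℝ ∞ S ξ := by
    intro ξ hξ
    obtain ⟨e', he'⟩ := hξ.2.1
    have h1 : ContDiffAt ℝ ∞ P.symm (ξ, 0) := P.contDiffAt_symm (f₀' := e') hξ.1
      (by rw [he']; exact (hψ.differentiable hn _).hasFDerivAt) hψ.contDiffAt
    have h2 : ContDiffAt ℝ ∞ (fun ξ : E => ((ξ, 0) : X)) ξ := contDiffAt_id.prodMk contDiffAt_const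
    exact (h1.comp ξ h2).snd
  have hfix : ∀ ξ ∈ U, ∀ η, fderiv ℝ S ξ η =
      picardDeriv B hB π (ξ, S ξ) (η, fderiv ℝ S ξ η) := by
    intro ξ hξ η
    have h1 : HasFDerivAt (fun ξ => ((ξ, S ξ) : X))
        ((ContinuousLinearMap.id ℝ E).prod (fderiv ℝ S ξ)) ξ :=
      (hasFDerivAt_id ξ).prodMk ((hSd ξ hξ).differentiableAt hn).hasFDerivAt
    have h2 := (hL (ξ, S ξ)).comp ξ h1
    have h3 : S =ᶠ[𝓝 ξ] (picardMap B hB.continuous π y₀) ∘ fun ξ => ((ξ, S ξ) : X) := by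
      filter_upwards [hU.mem_nhds hξ] with ζ hζ using (hS ζ hζ).2
    have h4 := (h2.congr_of_eventuallyEq h3).fderiv
    rw [← hLa]
    nth_rewrite 1 [h4]
    rfl
  refine ⟨U, S, hU, ⟨hPt, ?_⟩, fun ξ hξ => (hSd ξ hξ).contDiffWithinAt, ?_, ?_,
    fun ξ hξ => (hS ξ hξ).2, hfix, ?_⟩
  · rw [Set.mem_preimage, hP0]
    exact ⟨⟨e, he.fderiv.symm⟩, fun _ _ => hy₀⟩
  · change (P.symm (0, 0)).2 = _
    rw [hP0]
  · intro ξ hξ t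
    exact hξ.2.2 (Set.mem_univ t)
  · intro ξ hξ η v hv
    obtain ⟨e', he'⟩ := hξ.2.1
    rw [(hS ξ hξ).1] at he'
    have h1 := hfix ξ hξ η
    rw [← hLa] at h1 hv
    have h2 : e' (0, fderiv ℝ S ξ η - v) = 0 := by
      change (e' : X →L[ℝ] X) (0, fderiv ℝ S ξ η - v) = 0
      rw [he', (hψ' _).fderiv]
      refine Prod.ext rfl ?_
      change fderiv ℝ S ξ η - v - L (ξ, S ξ) (0, fderiv ℝ S ξ η - v) = 0
      have h3 : ((0, fderiv ℝ S ξ η - v) : X) = (η, fderiv ℝ S ξ η) - (η, v) := by simp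
      rw [h3, map_sub, ← h1, ← hv, sub_self]
    have h4 := (map_eq_zero_iff e' e'.injective).1 h2
    exact sub_eq_zero.1 (congrArg Prod.snd h4)

/-- Commuting vector fields are straightened by a chart. -/
theorem exists_chart_of_commuting [FiniteDimensional ℝ E] {B : E → E →L[ℝ] E}
    (hB : ContDiff ℝ ∞ B) {π : E →L[ℝ] E} {y₀ : E} {V : Set E} (hV : IsOpen V) (hy₀ : y₀ ∈ V)
    (hπ : π + B y₀ = ContinuousLinearMap.id ℝ E)
    (hcomm : ∀ y ∈ V, ∀ ξ η, fderiv ℝ B y (B y ξ) η = fderiv ℝ B y (B y η) ξ) :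
    ∃ Φ : OpenPartialHomeomorph E E, y₀ ∈ Φ.source ∧ Φ.source ⊆ V ∧
      ContDiffOn ℝ ∞ Φ Φ.source ∧ ContDiffOn ℝ ∞ Φ.symm Φ.target ∧
      ∀ y ∈ Φ.source, Function.Injective (fderiv ℝ Φ y) ∧
        ∀ η, π η = 0 → fderiv ℝ Φ y (B y η) = η := by
  obtain ⟨U, S, hU, h0, hS, hS0, hSV, hSfix, hSd, hSu⟩ := exists_smooth_solution hB π hV hy₀
  have hn : (∞ : WithTop ℕ∞) ≠ 0 := by simp
  -- Time-one map: the π-component of ξ displaces the initial point, and ξ then selects the field to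
  -- flow along. Its local inverse is the chart.
  let G : E → E := fun ξ => S ξ 1
  let ev : C(unitInterval, E) →L[ℝ] E := ContinuousMap.evalCLM ℝ 1
  have hG : ContDiffOn ℝ ∞ G U := ev.contDiff.comp_contDiffOn hS
  have hGd : ∀ ξ ∈ U, ∀ η, fderiv ℝ G ξ η = fderiv ℝ S ξ η 1 := by
    intro ξ hξ η
    have h1 := (differentiableAt_of_contDiffOn hU hS hξ).hasFDerivAt
    have h2 : HasFDerivAt G (ev.comp (fderiv ℝ S ξ)) ξ := ev.hasFDerivAt.comp ξ h1
    rw [h2.fderiv]; rfl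
  have hGB : ∀ ξ ∈ U, ∀ η, π η = 0 → fderiv ℝ G ξ η = B (G ξ) η := by
    intro ξ hξ η hη
    obtain ⟨v, hv, hv1⟩ := picardDeriv_commuting hB (hSfix ξ hξ) hη
      (fun t => hcomm _ (hSV ξ hξ t) ξ η)
    rw [hGd ξ hξ, hSu ξ hξ η v hv, hv1]
  have hG0 : G 0 = y₀ := by
    change S 0 1 = y₀
    rw [hS0]; rfl
  have hGid : fderiv ℝ G 0 = ContinuousLinearMap.id ℝ E := by
    ext η
    rw [hGd 0 h0, hSd 0 h0, hS0, picardDeriv]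
    have h1 : ∀ T : C(unitInterval, E →L[ℝ] E), π η + primitive E
        (pointwiseApply unitInterval E E T (ContinuousMap.const _ 0)
          + ContinuousMap.const _ (B y₀ η)) 1 = η := by
      intro T
      rw [pointwiseApply_const_zero, zero_add, primitive_const_one]
      exact congrArg (fun L : E →L[ℝ] E => L η) hπ
    exact h1 _
  have hG' : HasFDerivAt G ((ContinuousLinearEquiv.refl ℝ E : E ≃L[ℝ] E) : E →L[ℝ] E) 0 := by
    have := (differentiableAt_of_contDiffOn hU hG h0).hasFDerivAt
    rwa [hGid] at this
  let Q := (hG.contDiffAt (hU.mem_nhds h0)).toOpenPartialHomeomorph G hG' hn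
  let U₁ : Set E := U ∩ fderiv ℝ G ⁻¹' Set.range ((↑) : (E ≃L[ℝ] E) → E →L[ℝ] E)
  have hU₁ : IsOpen U₁ :=
    (contDiffOn_fderiv hU hG).continuousOn.isOpen_inter_preimage hU ContinuousLinearEquiv.isOpen
  let R := Q.restrOpen U₁ hU₁
  have hR : ∀ ξ, R ξ = G ξ := fun _ => rfl
  have hRs : R.source ⊆ U₁ := fun ξ hξ => by
    rw [Q.restrOpen_source] at hξ; exact hξ.2
  have h0R : (0 : E) ∈ R.source := by
    rw [Q.restrOpen_source]
    exact ⟨ContDiffAt.mem_toOpenPartialHomeomorph_source _ hG' hn, h0,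
      ⟨ContinuousLinearEquiv.refl ℝ E, hG'.fderiv.symm⟩⟩
  have hGat : ∀ ξ ∈ R.source, ContDiffAt ℝ ∞ G ξ := fun ξ hξ =>
    hG.contDiffAt (hU.mem_nhds (hRs hξ).1)
  refine ⟨R.symm, ?_, ?_, ?_, ?_, ?_⟩
  · rw [← hG0]; exact R.map_source h0R
  · intro y hy
    have h1 : G (R.symm y) = y := R.right_inv hy
    rw [← h1]
    exact hSV _ (hRs (R.map_target hy)).1 1
  · intro y hy
    obtain ⟨e', he'⟩ := (hRs (R.map_target hy)).2
    exact (R.contDiffAt_symm (f₀' := e') hy (by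
      rw [he']; exact ((hGat _ (R.map_target hy)).differentiableAt hn).hasFDerivAt)
      (hGat _ (R.map_target hy))).contDiffWithinAt
  · intro ξ hξ
    exact (hGat ξ hξ).contDiffWithinAt
  · intro y hy
    have hx := hRs (R.map_target hy)
    obtain ⟨e', he'⟩ := hx.2
    have h1 : HasFDerivAt R (e' : E →L[ℝ] E) (R.symm y) := by
      rw [he']; exact ((hGat _ (R.map_target hy)).differentiableAt hn).hasFDerivAt
    have h2 := (R.hasFDerivAt_symm hy h1).fderiv
    refine ⟨by rw [h2]; exact e'.symm.injective, fun η hη => ?_⟩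
    have h3 : G (R.symm y) = y := R.right_inv hy
    have h4 := hGB _ hx.1 η hη
    rw [h3, ← he'] at h4
    rw [h2, ← h4]
    exact e'.symm_apply_apply η

end FlowChart

/-! ### Frobenius theorem for kernels of constant rank -/

section Frobenius

variable {E : Type*} [NormedAddCommGroup E] [NormedSpace ℝ E] [FiniteDimensional ℝ E]
variable {G : Type*} [NormedAddCommGroup G] [NormedSpace ℝ G] [FiniteDimensional ℝ G]

theorem exists_pseudoinverse (L : E →L[ℝ] G) :
    ∃ T : G →L[ℝ] E, ∀ w, L (T (L w)) = L w := by
  obtain ⟨s, hs⟩ := (L : E →ₗ[ℝ] G).rangeRestrict.exists_rightInverse_of_surjective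
    (LinearMap.range_rangeRestrict _)
  obtain ⟨p, hp⟩ := (LinearMap.range (L : E →ₗ[ℝ] G)).subtype.exists_leftInverse_of_injective
    (Submodule.ker_subtype _)
  refine ⟨LinearMap.toContinuousLinearMap (s ∘ₗ p), fun w => ?_⟩
  have h1 := LinearMap.congr_fun hp ((L : E →ₗ[ℝ] G).rangeRestrict w)
  have h2 := LinearMap.congr_fun hs ((L : E →ₗ[ℝ] G).rangeRestrict w)
  have h3 : p (L w) = (L : E →ₗ[ℝ] G).rangeRestrict w := h1
  change L (s (p (L w))) = L w
  rw [h3]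
  exact congrArg Subtype.val h2

/-- A smooth frame of the kernels of a family of linear maps of constant rank, adapted to a
projection `π₀` onto the kernel at `y₀`. -/
theorem exists_frame_of_ker {A : E → E →L[ℝ] G} {O : Set E} (hO : IsOpen O)
    (hA : ContDiffOn ℝ ∞ A O) {y₀ : E} (hy₀ : y₀ ∈ O)
    (hrank : ∀ y ∈ O, Module.finrank ℝ (LinearMap.ker (A y : E →ₗ[ℝ] G)) =
      Module.finrank ℝ (LinearMap.ker (A y₀ : E →ₗ[ℝ] G))) :
    ∃ (V : Set E) (π₀ : E →L[ℝ] E) (B : E → E →L[ℝ] E), IsOpen V ∧ y₀ ∈ V ∧ V ⊆ O ∧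
      ContDiffOn ℝ ∞ B V ∧ B y₀ = π₀ ∧ (∀ w, π₀ (π₀ w) = π₀ w) ∧
      (∀ y ∈ V, ∀ ξ, A y (B y ξ) = 0) ∧ (∀ y ∈ V, ∀ ξ, π₀ (B y ξ) = π₀ ξ) ∧
      ∀ y ∈ V, ∀ w, A y w = 0 → B y (π₀ w) = w := by
  obtain ⟨T, hT⟩ := exists_pseudoinverse (A y₀)
  let π₀ : E →L[ℝ] E := ContinuousLinearMap.id ℝ E - T.comp (A y₀)
  have hπ₀ : ∀ w, π₀ w = w - T (A y₀ w) := fun _ => rfl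
  have hidem : ∀ w, π₀ (π₀ w) = π₀ w := by
    intro w
    rw [hπ₀ (π₀ w), hπ₀ w, map_sub, hT, sub_self, map_zero, sub_zero]
  -- N is the identity at y₀, hence invertible nearby, and agrees with π₀ on the kernel of A y. So
  -- N⁻¹π₀ fixes the shape of the frame.
  let N : E → E →L[ℝ] E := fun y => π₀ + T.comp (A y)
  have hNw : ∀ y w, N y w = π₀ w + T (A y w) := fun _ _ => rfl
  have hN : ContDiffOn ℝ ∞ N O := contDiffOn_const.add (contDiffOn_const.clm_comp hA)
  let V : Set E := O ∩ N ⁻¹' Set.range ((↑) : (E ≃L[ℝ] E) → E →L[ℝ] E)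
  have hV : IsOpen V := hN.continuousOn.isOpen_inter_preimage hO ContinuousLinearEquiv.isOpen
  have hN₀ : N y₀ = ((ContinuousLinearEquiv.refl ℝ E : E ≃L[ℝ] E) : E →L[ℝ] E) := by
    ext w
    rw [hNw, hπ₀]; simp
  let B : E → E →L[ℝ] E := fun y => (N y).inverse.comp π₀
  have hBN : ∀ y ∈ V, ∀ ξ, N y (B y ξ) = π₀ ξ := by
    rintro y ⟨-, e, he⟩ ξ
    change N y ((N y).inverse (π₀ ξ)) = π₀ ξ
    rw [← he, ContinuousLinearMap.inverse_equiv]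
    exact e.apply_symm_apply _
  have hBe : ∀ y ∈ V, ∀ ξ w, N y w = π₀ ξ → B y ξ = w := by
    rintro y ⟨-, e, he⟩ ξ w h
    change (N y).inverse (π₀ ξ) = w
    rw [← h, ← he, ContinuousLinearMap.inverse_equiv]
    exact e.symm_apply_apply _
  have hker : ∀ y ∈ V, ∀ w, A y w = 0 → B y (π₀ w) = w := by
    intro y hy w hw
    refine hBe y hy _ _ ?_
    rw [hNw, hw, map_zero, add_zero, hidem]
  -- The kernel is contained in the range without further assumptions, and the range has at most the
  -- dimension of the kernel at y₀; constant rank forces equality.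
  have hrange : ∀ y ∈ V, LinearMap.ker (A y : E →ₗ[ℝ] G) = LinearMap.range (B y : E →ₗ[ℝ] E) := by
    intro y hy
    refine Submodule.eq_of_le_of_finrank_le (fun w hw => ⟨π₀ w, hker y hy w hw⟩) ?_
    rw [hrank y hy.1]
    have h1 : LinearMap.range (B y : E →ₗ[ℝ] E) ≤
        (LinearMap.ker (A y₀ : E →ₗ[ℝ] G)).map ((N y).inverse : E →ₗ[ℝ] E) := by
      rintro _ ⟨ξ, rfl⟩
      refine ⟨π₀ ξ, ?_, rfl⟩
      change A y₀ (π₀ ξ) = 0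
      rw [hπ₀, map_sub, hT, sub_self]
    exact (Submodule.finrank_mono h1).trans (Submodule.finrank_map_le _ _)
  have hAB : ∀ y ∈ V, ∀ ξ, A y (B y ξ) = 0 := by
    intro y hy ξ
    have h1 : B y ξ ∈ LinearMap.range (B y : E →ₗ[ℝ] E) := ⟨ξ, rfl⟩
    rw [← hrange y hy] at h1
    exact h1
  refine ⟨V, π₀, B, hV, ⟨hy₀, _, hN₀.symm⟩, Set.inter_subset_left, ?_, ?_, hidem, hAB, ?_, hker⟩
  · intro y hy
    obtain ⟨e, he⟩ := hy.2
    have h1 : ContDiffAt ℝ ∞ ContinuousLinearMap.inverse (N y) := by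
      rw [← he]; exact contDiffAt_map_inverse e
    exact ((h1.comp y (hN.contDiffAt (hO.mem_nhds hy.1))).clm_comp
      contDiffAt_const).contDiffWithinAt
  · change (N y₀).inverse.comp π₀ = π₀
    rw [hN₀, ContinuousLinearMap.inverse_equiv]
    rfl
  · intro y hy ξ
    rw [← hBN y hy ξ, hNw, hAB y hy, map_zero, add_zero]

/-- **Frobenius theorem**: an involutive family of kernels of constant rank is carried to a constant
field of subspaces by a smooth chart. -/
theorem exists_chart_of_involutive {A : E → E →L[ℝ] G} {O : Set E} (hO : IsOpen O)
    (hA : ContDiffOn ℝ ∞ A O) {y₀ : E} (hy₀ : y₀ ∈ O)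
    (hrank : ∀ y ∈ O, Module.finrank ℝ (LinearMap.ker (A y : E →ₗ[ℝ] G)) =
      Module.finrank ℝ (LinearMap.ker (A y₀ : E →ₗ[ℝ] G)))
    (hinv : ∀ x ∈ O, ∀ X Y : E → E, DifferentiableAt ℝ X x → DifferentiableAt ℝ Y x →
      (∀ᶠ y in 𝓝 x, A y (X y) = 0) → (∀ᶠ y in 𝓝 x, A y (Y y) = 0) →
      A x (VectorField.lieBracket ℝ X Y x) = 0) :
    ∃ (Φ : OpenPartialHomeomorph E E) (W : Submodule ℝ E), y₀ ∈ Φ.source ∧ Φ.source ⊆ O ∧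
      ContDiffOn ℝ ∞ Φ Φ.source ∧ ContDiffOn ℝ ∞ Φ.symm Φ.target ∧
      ∀ y ∈ Φ.source, ∀ w, A y w = 0 ↔ fderiv ℝ Φ y w ∈ W := by
  obtain ⟨V, π₀, B, hV, hyV, hVO, hB, hB₀, hidem, hAB, hπB, hker⟩ :=
    exists_frame_of_ker hO hA hy₀ hrank
  have hπd : ∀ y ∈ V, ∀ a ξ, π₀ (fderiv ℝ B y a ξ) = 0 := by
    intro y hy a ξ
    have h1 := (differentiableAt_of_contDiffOn hV hB hy).hasFDerivAt
    have h2 := π₀.hasFDerivAt.comp y (h1.clm_apply (hasFDerivAt_const ξ y))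
    have h3 : (fun y => π₀ (B y ξ)) =ᶠ[𝓝 y] fun _ => π₀ ξ := by
      filter_upwards [hV.mem_nhds hy] with z hz using hπB z hz ξ
    have h4 := (h2.congr_of_eventuallyEq h3.symm).unique (hasFDerivAt_const _ y)
    simpa using congrArg (fun L : E →L[ℝ] E => L a) h4
  -- The bracket of two frame fields lies in the kernel by involutivity and is killed by π₀ because
  -- π₀ B is constant; on the kernel π₀ is injective.
  have hcomm : ∀ y ∈ V, ∀ ξ η, fderiv ℝ B y (B y ξ) η = fderiv ℝ B y (B y η) ξ := by
    intro y hy ξ η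
    have hd : ∀ ξ, HasFDerivAt (fun y => B y ξ) ((fderiv ℝ B y).flip ξ) y := by
      intro ξ
      have h1 := (differentiableAt_of_contDiffOn hV hB hy).hasFDerivAt
      have h2 := h1.clm_apply (hasFDerivAt_const ξ y)
      refine h2.congr_fderiv ?_
      ext a; simp
    have h1 := hinv y (hVO hy) (fun y => B y ξ) (fun y => B y η) (hd ξ).differentiableAt
      (hd η).differentiableAt
      (by filter_upwards [hV.mem_nhds hy] with z hz using hAB z hz ξ)
      (by filter_upwards [hV.mem_nhds hy] with z hz using hAB z hz η)
    rw [VectorField.lieBracket, (hd ξ).fderiv, (hd η).fderiv] at h1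
    have h2 := hker y hy _ h1
    rw [map_sub] at h2
    simp only [ContinuousLinearMap.flip_apply, hπd y hy, sub_self, map_zero] at h2
    exact sub_eq_zero.1 h2.symm
  obtain ⟨ε, hε, hεV⟩ := Metric.isOpen_iff.1 hV y₀ hyV
  -- The flow construction takes a frame smooth on all of E; the cutoff keeps it unchanged on the
  -- ball of radius ε/4, where the chart will live.
  let χ : ContDiffBump y₀ := ⟨ε / 4, ε / 2, by positivity, by linarith⟩
  let B' : E → E →L[ℝ] E := fun y => χ y • B y
  have hB' : ContDiff ℝ ∞ B' := by
    refine contDiff_iff_contDiffAt.2 fun y => ?_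
    by_cases hy : y ∈ tsupport B'
    swap
    · exact contDiffAt_const.congr_of_eventuallyEq (notMem_tsupport_iff_eventuallyEq.1 hy)
    have h1 : y ∈ V := by
      have h2 := tsupport_smul_subset_left _ _ hy
      rw [χ.tsupport_eq] at h2
      exact hεV (Metric.closedBall_subset_ball (half_lt_self hε) h2)
    exact χ.contDiffAt.smul (hB.contDiffAt (hV.mem_nhds h1))
  have hone : ∀ y ∈ Metric.ball y₀ (ε / 4), B' y = B y := by
    intro y hy
    change χ y • B y = B y
    rw [χ.one_of_mem_closedBall (Metric.ball_subset_closedBall hy), one_smul]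
  have hsub : Metric.ball y₀ (ε / 4) ⊆ V := (Metric.ball_subset_ball (by linarith)).trans hεV
  have hy4 : y₀ ∈ Metric.ball y₀ (ε / 4) := Metric.mem_ball_self (by positivity)
  obtain ⟨Φ, hΦy, hΦs, hΦ, hΦ', hΦB⟩ := exists_chart_of_commuting
    (π := ContinuousLinearMap.id ℝ E - π₀) hB' Metric.isOpen_ball hy4
    (by rw [hone y₀ hy4, hB₀, sub_add_cancel])
    (fun y hy ξ η => by
      have h1 : B' =ᶠ[𝓝 y] B := by
        filter_upwards [Metric.isOpen_ball.mem_nhds hy] with z hz using hone z hz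
      rw [h1.fderiv_eq, hone y hy]
      exact hcomm y (hsub hy) ξ η)
  -- Since π₀ is a projection this kernel is its range, the kernel of A at y₀.
  refine ⟨Φ, LinearMap.ker (ContinuousLinearMap.id ℝ E - π₀ : E →ₗ[ℝ] E), hΦy,
    hΦs.trans (hsub.trans hVO), hΦ, hΦ', fun y hy w => ?_⟩
  have hyV := hsub (hΦs hy)
  constructor
  · intro hw
    have h1 : (ContinuousLinearMap.id ℝ E - π₀) (π₀ w) = 0 := by
      simp [hidem]
    have h2 := (hΦB y hy).2 _ h1
    rw [hone y (hΦs hy), hker y hyV w hw] at h2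
    rw [h2]
    exact h1
  · intro hw
    have h2 := (hΦB y hy).2 _ hw
    have h3 := (hΦB y hy).1 h2
    rw [← h3, hone y (hΦs hy)]
    exact hAB y hyV _

end Frobenius

/-! ### Local expressions of a Finsler structure on a manifold -/

section LocalExpression

variable {E : Type*} [NormedAddCommGroup E] [NormedSpace ℝ E]
variable {M : Type*} [TopologicalSpace M] [ChartedSpace E M] [IsManifold 𝓘(ℝ, E) ∞ M]

/-- The expression of a function on the tangent bundle in the chart induced by the preferred chart
at `x`. -/
def localExpr (F : TangentBundle 𝓘(ℝ, E) M → ℝ) (x : M) : E × E → ℝ :=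
  F ∘ (extChartAt 𝓘(ℝ, E).tangent (⟨x, 0⟩ : TangentBundle 𝓘(ℝ, E) M)).symm

theorem localExpr_eq (F : TangentBundle 𝓘(ℝ, E) M → ℝ) (z : TangentBundle 𝓘(ℝ, E) M) :
    F ∘ (extChartAt 𝓘(ℝ, E).tangent z).symm = localExpr F z.proj := rfl

theorem localExpr_apply (F : TangentBundle 𝓘(ℝ, E) M → ℝ) (x : M) (q : E × E) :
    localExpr F x q = F ⟨(chartAt E x).symm q.1, tangentCoordChange 𝓘(ℝ, E) x
      ((chartAt E x).symm q.1) ((chartAt E x).symm q.1) q.2⟩ := rfl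

theorem extChartAt_tangent_self (z : TangentBundle 𝓘(ℝ, E) M) :
    extChartAt 𝓘(ℝ, E).tangent z z = (chartAt E z.proj z.proj, z.2) := by
  refine Prod.ext rfl ?_
  exact tangentCoordChange_self (I := 𝓘(ℝ, E)) (mem_extChartAt_source z.proj)

theorem tangentCoordChange_inv {x y z : M} (hx : z ∈ (chartAt E x).source)
    (hy : z ∈ (chartAt E y).source) (v : E) :
    tangentCoordChange 𝓘(ℝ, E) x y z (tangentCoordChange 𝓘(ℝ, E) y x z v) = v := by
  rw [tangentCoordChange_comp (by simp [hx, hy]), tangentCoordChange_self (by simp [hy])]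

/-- The coordinate change of the tangent space at `z` between the charts at `x` and `y`. -/
def coordChangeEquiv {x y z : M} (hx : z ∈ (chartAt E x).source)
    (hy : z ∈ (chartAt E y).source) : E ≃L[ℝ] E :=
  ContinuousLinearEquiv.equivOfInverse (tangentCoordChange 𝓘(ℝ, E) x y z)
    (tangentCoordChange 𝓘(ℝ, E) y x z) (tangentCoordChange_inv hy hx)
    (tangentCoordChange_inv hx hy)

theorem coordChangeEquiv_apply {x y z : M} (hx : z ∈ (chartAt E x).source)
    (hy : z ∈ (chartAt E y).source) (v : E) :
    coordChangeEquiv hx hy v = tangentCoordChange 𝓘(ℝ, E) x y z v := rfl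

theorem IsFinsler.contDiffOn_localExpr {F : TangentBundle 𝓘(ℝ, E) M → ℝ} (hF : IsFinsler F)
    (x : M) : ContDiffOn ℝ ∞ (localExpr F x) (slit (chartAt E x).target) := by
  rw [← contMDiffOn_iff_contDiffOn]
  have h1 := contMDiffOn_extChartAt_symm (I := 𝓘(ℝ, E).tangent) (n := ∞)
    (⟨x, 0⟩ : TangentBundle 𝓘(ℝ, E) M)
  refine hF.smooth.comp (h1.mono ?_) ?_
  · intro q hq
    have := (mem_slit.1 hq).1
    rw [extChartAt_target]
    exact ⟨(TangentBundle.mem_chart_target_iff (I := 𝓘(ℝ, E)) q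
      (⟨x, 0⟩ : TangentBundle 𝓘(ℝ, E) M)).2 this, by simp⟩
  · intro q hq
    obtain ⟨hq1, hq2⟩ := mem_slit.1 hq
    have hs := (chartAt E x).map_target hq1
    change tangentCoordChange 𝓘(ℝ, E) x ((chartAt E x).symm q.1) ((chartAt E x).symm q.1) q.2 ≠ 0
    rw [← coordChangeEquiv_apply hs (mem_chart_source E _)]
    exact fun h => hq2 ((map_eq_zero_iff _ (coordChangeEquiv hs _).injective).1 h)

theorem fundTensor_apply_self {f : E × E → ℝ} {O : Set E} (hO : IsOpen O)
    (hf : ContDiffOn ℝ ∞ f (slit O)) {p : E × E} (hp : p ∈ slit O) :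
    fundTensor f p = fderiv ℝ (fderiv ℝ (fun v => energy f (p.1, v))) p.2 := by
  have hS : IsOpen (slit O) := hO.prod isOpen_compl_singleton
  have he : ContDiffOn ℝ ∞ (energy f) (slit O) := (hf.pow 2).div_const 2
  have hi : ∀ v : E, HasFDerivAt (fun v : E => (p.1, v)) (ContinuousLinearMap.inr ℝ E E) v :=
    fun v => (hasFDerivAt_const p.1 v).prodMk (hasFDerivAt_id v)
  have h1 : ∀ v : E, v ≠ 0 → fderiv ℝ (fun v => energy f (p.1, v)) v =
      dFibre (energy f) (p.1, v) := by
    intro v hv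
    have hq : (p.1, v) ∈ slit O := mem_slit.2 ⟨(mem_slit.1 hp).1, hv⟩
    exact ((differentiableAt_of_contDiffOn hS he hq).hasFDerivAt.comp v (hi v)).fderiv
  have h2 : fderiv ℝ (fun v => energy f (p.1, v)) =ᶠ[𝓝 p.2]
      fun v => dFibre (energy f) (p.1, v) := by
    filter_upwards [isOpen_compl_singleton.mem_nhds (mem_slit.1 hp).2] with v hv using h1 v hv
  have he' : ContDiffOn ℝ ∞ (dFibre (energy f)) (slit O) :=
    (contDiffOn_fderiv hS he).clm_comp contDiffOn_const
  rw [h2.fderiv_eq]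
  exact ((differentiableAt_of_contDiffOn hS he' hp).hasFDerivAt.comp p.2 (hi p.2)).fderiv.symm

theorem fderiv_fderiv_comp_equiv {h : E → ℝ} (e : E ≃L[ℝ] E) {u : E}
    (hd : DifferentiableAt ℝ (fderiv ℝ h) (e u)) (w : E) :
    fderiv ℝ (fderiv ℝ (h ∘ e)) u w w = fderiv ℝ (fderiv ℝ h) (e u) (e w) (e w) := by
  have h1 : fderiv ℝ (h ∘ e) = fun u => (fderiv ℝ h (e u)).comp (e : E →L[ℝ] E) := by
    ext1 u
    exact e.comp_right_fderiv
  rw [h1]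
  have h2 := (hd.hasFDerivAt.comp u e.hasFDerivAt).clm_comp
    (hasFDerivAt_const (e : E →L[ℝ] E) u)
  have h3 := congrArg (fun L : E →L[ℝ] E →L[ℝ] ℝ => L w w) h2.fderiv
  refine h3.trans ?_
  simp

theorem IsFinsler.isLocalFinsler {F : TangentBundle 𝓘(ℝ, E) M → ℝ} (hF : IsFinsler F) (x : M) :
    IsLocalFinsler (localExpr F x) (chartAt E x).target where
  isOpen_base := (chartAt E x).open_target
  smooth := hF.contDiffOn_localExpr x
  homogeneous := by
    intro p hp c hc
    obtain ⟨hp1, hp2⟩ := mem_slit.1 hp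
    have hs := (chartAt E x).map_target hp1
    rw [localExpr_apply, localExpr_apply, map_smul]
    refine hF.homogeneous _ _ c ?_ hc
    rw [← coordChangeEquiv_apply hs (mem_chart_source E _)]
    exact fun h => hp2 ((map_eq_zero_iff _ (coordChangeEquiv hs _).injective).1 h)
  posDef := by
    intro p hp w hw
    obtain ⟨hp1, hp2⟩ := mem_slit.1 hp
    have hs := (chartAt E x).map_target hp1
    let e := coordChangeEquiv (mem_chart_source E ((chartAt E x).symm p.1)) hs
    rw [fundTensor_apply_self (chartAt E x).open_target (hF.contDiffOn_localExpr x) hp]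
    have h1 := hF.posDef ((chartAt E x).symm p.1) (e.symm p.2) (e.symm w)
      (fun h => hp2 ((map_eq_zero_iff _ e.symm.injective).1 h))
      (fun h => hw ((map_eq_zero_iff _ e.symm.injective).1 h))
    -- The fibre energy at the point differs from the coordinate one by a linear isomorphism, under
    -- which positivity of the Hessian is invariant.
    have h2 : (fun u : E => F ⟨(chartAt E x).symm p.1, u⟩ ^ 2 / 2) =
        (fun v => energy (localExpr F x) (p.1, v)) ∘ e := by
      ext1 u
      change _ = (localExpr F x (p.1, e u)) ^ 2 / 2
      rw [localExpr_apply]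
      have h3 : tangentCoordChange 𝓘(ℝ, E) x ((chartAt E x).symm p.1) ((chartAt E x).symm p.1)
        (e u) = u := e.symm_apply_apply u
      rw [h3]
    rw [h2, fderiv_fderiv_comp_equiv] at h1
    · simpa using h1
    · rw [e.apply_symm_apply]
      have h4 : ContDiffAt ℝ ∞ (fun v => energy (localExpr F x) (p.1, v)) p.2 := by
        have h5 : ContDiffAt ℝ ∞ (energy (localExpr F x)) p :=
          (((hF.contDiffOn_localExpr x).pow 2).div_const 2).contDiffAt
            (((chartAt E x).open_target.prod isOpen_compl_singleton).mem_nhds hp)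
        exact h5.comp (f := fun v : E => (p.1, v)) p.2 (contDiffAt_const.prodMk contDiffAt_id)
      exact (h4.fderiv_right (m := 1) (by norm_cast)).differentiableAt (by simp)

theorem IsLocalFinsler.mono {f : E × E → ℝ} {O O' : Set E} (h : IsLocalFinsler f O)
    (hO' : IsOpen O') (hs : O' ⊆ O) : IsLocalFinsler f O' := by
  have hss : slit O' ⊆ slit O := Set.prod_mono_left hs
  exact ⟨hO', h.smooth.mono hss, fun p hp => h.homogeneous p (hss hp),
    fun p hp => h.posDef p (hss hp)⟩

end LocalExpression

/-! ### Nullity spaces of the manifold in a fixed chart -/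

section Nullity

variable {E : Type*} [NormedAddCommGroup E] [NormedSpace ℝ E] [FiniteDimensional ℝ E]
variable {M : Type*} [TopologicalSpace M] [ChartedSpace E M] [IsManifold 𝓘(ℝ, E) ∞ M]
variable {F : TangentBundle 𝓘(ℝ, E) M → ℝ} (hF : IsFinsler F) {k : ℝ}
include hF

omit [FiniteDimensional ℝ E] in
theorem IsFinsler.isChartChange (x y : M) :
    IsChartChange (chartAt E x ∘ (chartAt E y).symm) (localExpr F y) (localExpr F x)
      ((chartAt E y).target ∩ (chartAt E y).symm ⁻¹' (chartAt E x).source)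
      (chartAt E x).target := by
  have hfd : ∀ p ∈ (chartAt E y).target ∩ (chartAt E y).symm ⁻¹' (chartAt E x).source,
      fderiv ℝ (chartAt E x ∘ (chartAt E y).symm) p =
        tangentCoordChange 𝓘(ℝ, E) y x ((chartAt E y).symm p) := by
    intro p hp
    have h1 := hasFDerivWithinAt_tangentCoordChange (I := 𝓘(ℝ, E)) (x := y) (y := x)
      (z := (chartAt E y).symm p) (by simpa using ⟨(chartAt E y).map_target hp.1, hp.2⟩)
    simp only [mfld_simps, hasFDerivWithinAt_univ, (chartAt E y).right_inv hp.1] at h1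
    exact h1.fderiv
  refine ⟨(hF.isLocalFinsler y).mono ((chartAt E y).isOpen_inter_preimage_symm
    (chartAt E x).open_source) Set.inter_subset_left, hF.isLocalFinsler x, ?_, ?_, ?_, ?_⟩
  · have h1 := contDiffOn_ext_coord_change (I := 𝓘(ℝ, E)) (n := ∞) x y
    simpa [mfld_simps] using h1
  · intro p hp
    exact (chartAt E x).map_source hp.2
  · intro p hp
    rw [hfd p hp]
    exact (coordChangeEquiv ((chartAt E y).map_target hp.1) hp.2).bijective
  · intro q hq
    have hp := (mem_slit.1 hq).1
    have h1 : (chartAt E x).symm ((chartAt E x ∘ (chartAt E y).symm) q.1) = (chartAt E y).symm q.1 :=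
      (chartAt E x).left_inv hp.2
    rw [localExpr_apply, localExpr_apply, tangentLift, hfd _ hp]
    dsimp only
    rw [h1, tangentCoordChange_comp]
    simpa using ⟨(chartAt E y).map_target hp.1, hp.2⟩

/-- `nullityAt` is computed in the chart preferred at y, which jumps with y; this moves it to the
single chart at x. -/
theorem IsFinsler.mem_nullityAt_iff {x y : M} (hy : y ∈ (chartAt E x).source) {v : E}
    (hv : v ≠ 0) (w : E) :
    w ∈ nullityAt F k (⟨y, v⟩ : TangentBundle 𝓘(ℝ, E) M) ↔
      modHH (localExpr F x) k (chartAt E x y, tangentCoordChange 𝓘(ℝ, E) y x y v)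
        (tangentCoordChange 𝓘(ℝ, E) y x y w) = 0 := by
  have hyt := mem_chart_target E y
  have hyy : (chartAt E y).symm (chartAt E y y) = y := (chartAt E y).left_inv (mem_chart_source E y)
  have h1 : (chartAt E y y, v) ∈ slit (chartAt E y).target := mem_slit.2 ⟨hyt, hv⟩
  have h2 : chartAt E y y ∈ (chartAt E y).target ∩ (chartAt E y).symm ⁻¹' (chartAt E x).source :=
    ⟨hyt, by rw [Set.mem_preimage, hyy]; exact hy⟩
  have h3 := (hF.isChartChange x y).modHH_eq_zero_iff (k := k)
    (p := (chartAt E y y, v)) (mem_slit.2 ⟨h2, hv⟩) w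
  have h4 : fderiv ℝ (chartAt E x ∘ (chartAt E y).symm) (chartAt E y y) =
      tangentCoordChange 𝓘(ℝ, E) y x y := by
    simp [mfld_simps]
  rw [tangentLift, h4, Function.comp_apply, hyy] at h3
  rw [← h3, nullityAt, extChartAt_tangent_self, localExpr_eq]
  exact (hF.isLocalFinsler y).mem_map_horNullity_iff h1 k w

theorem IsFinsler.mem_nullitySpace_iff {x y : M} (hy : y ∈ (chartAt E x).source) (w : E) :
    w ∈ nullitySpace F k y ↔
      IsNull (localExpr F x) k (chartAt E x y) (tangentCoordChange 𝓘(ℝ, E) y x y w) := by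
  have h1 : w ∈ nullitySpace F k y ↔ ∀ v : E, v ≠ 0 →
      w ∈ nullityAt F k (⟨y, v⟩ : TangentBundle 𝓘(ℝ, E) M) := by
    have h0 : ∀ D : E → Submodule ℝ E, w ∈ ⨅ (v : E) (_ : v ≠ 0), D v ↔
        ∀ v : E, v ≠ 0 → w ∈ D v := fun D => by simp
    exact h0 fun v => nullityAt F k (⟨y, v⟩ : TangentBundle 𝓘(ℝ, E) M)
  rw [h1]
  let e := coordChangeEquiv (mem_chart_source E y) hy
  constructor
  · intro h v hv
    have h2 := (hF.mem_nullityAt_iff hy (fun h0 => hv ((map_eq_zero_iff _ e.symm.injective).1 h0))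
      w).1 (h (e.symm v) fun h0 => hv ((map_eq_zero_iff _ e.symm.injective).1 h0))
    have h3 : tangentCoordChange 𝓘(ℝ, E) y x y (e.symm v) = v := e.apply_symm_apply v
    rwa [h3] at h2
  · intro h v hv
    exact (hF.mem_nullityAt_iff hy hv w).2
      (h _ fun h0 => hv ((map_eq_zero_iff e e.injective).1 h0))

theorem IsFinsler.isNull_of_wellDefined {x y : M} (hy : y ∈ (chartAt E x).source)
    (hwd : NullityWellDefinedAt F k y) {v a : E} (hv : v ≠ 0)
    (h : modHH (localExpr F x) k (chartAt E x y, v) a = 0) :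
    IsNull (localExpr F x) k (chartAt E x y) a := by
  let e := coordChangeEquiv (mem_chart_source E y) hy
  have h1 : ∀ v, tangentCoordChange 𝓘(ℝ, E) y x y (e.symm v) = v := e.apply_symm_apply
  have hv' : e.symm v ≠ 0 := fun h0 => hv ((map_eq_zero_iff _ e.symm.injective).1 h0)
  have h2 := (hF.mem_nullityAt_iff (k := k) hy hv' (e.symm a)).2 (by rwa [h1, h1])
  have h3 := hwd (e.symm v) hv'
  have h4 := (hF.mem_nullitySpace_iff hy (e.symm a)).1 (by rw [← h3]; exact h2)
  rwa [h1] at h4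

end Nullity

/-! ### Charts, vector fields and brackets in the preferred chart -/

section Charts

variable {E : Type*} [NormedAddCommGroup E] [NormedSpace ℝ E]
variable {M : Type*} [TopologicalSpace M] [ChartedSpace E M] [IsManifold 𝓘(ℝ, E) ∞ M]

theorem trans_mem_maximalAtlas (x : M) (Φ : OpenPartialHomeomorph E E)
    (hΦ : ContDiffOn ℝ ∞ Φ Φ.source) (hΦ' : ContDiffOn ℝ ∞ Φ.symm Φ.target) :
    (chartAt E x).trans Φ ∈ IsManifold.maximalAtlas 𝓘(ℝ, E) ∞ M := by
  have hG : Φ ∈ contDiffGroupoid ∞ 𝓘(ℝ, E) := by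
    rw [contDiffGroupoid, mem_groupoid_of_pregroupoid]
    constructor
    · simpa [contDiffPregroupoid] using hΦ
    · simpa [contDiffPregroupoid] using hΦ'
  rw [IsManifold.mem_maximalAtlas_iff, mem_maximalAtlas_iff]
  intro e he
  have h1 : (chartAt E x).symm.trans e ∈ contDiffGroupoid ∞ 𝓘(ℝ, E) :=
    HasGroupoid.compatible (chart_mem_atlas E x) he
  have h2 : e.symm.trans (chartAt E x) ∈ contDiffGroupoid ∞ 𝓘(ℝ, E) :=
    HasGroupoid.compatible he (chart_mem_atlas E x)
  constructor
  · rw [OpenPartialHomeomorph.trans_symm_eq_symm_trans_symm, OpenPartialHomeomorph.trans_assoc]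
    exact StructureGroupoid.trans _ (StructureGroupoid.symm _ hG) h1
  · rw [← OpenPartialHomeomorph.trans_assoc]
    exact StructureGroupoid.trans _ h2 hG

theorem mfderiv_trans_chartAt {x y : M} {Φ : OpenPartialHomeomorph E E}
    (hΦ : ContDiffOn ℝ ∞ Φ Φ.source) (hy : y ∈ ((chartAt E x).trans Φ).source)
    (w : TangentSpace 𝓘(ℝ, E) y) :
    mfderiv 𝓘(ℝ, E) 𝓘(ℝ, E) ((chartAt E x).trans Φ) y w =
      fderiv ℝ Φ (chartAt E x y) (tangentCoordChange 𝓘(ℝ, E) y x y w) := by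
  rw [OpenPartialHomeomorph.trans_source] at hy
  have h1 : MDifferentiableAt 𝓘(ℝ, E) 𝓘(ℝ, E) (chartAt E x) y :=
    mdifferentiableAt_atlas (chart_mem_atlas E x) hy.1
  have h2 : DifferentiableAt ℝ Φ (chartAt E x y) :=
    (hΦ.contDiffAt (Φ.open_source.mem_nhds hy.2)).differentiableAt (by simp)
  rw [OpenPartialHomeomorph.coe_trans, mfderiv_comp y h2.mdifferentiableAt h1, mfderiv_eq_fderiv,
    ← mfderiv_chartAt_eq_tangentCoordChange hy.1]
  rfl

/-- The expression of a vector field in the preferred chart at `x`. -/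
def chartField (x : M) (X : (x : M) → TangentSpace 𝓘(ℝ, E) x) : E → E :=
  VectorField.mpullbackWithin 𝓘(ℝ, E) 𝓘(ℝ, E) (extChartAt 𝓘(ℝ, E) x).symm X (Set.range 𝓘(ℝ, E))

theorem chartField_apply {x y : M} (hy : y ∈ (chartAt E x).source)
    (X : (x : M) → TangentSpace 𝓘(ℝ, E) x) :
    chartField x X (chartAt E x y) = tangentCoordChange 𝓘(ℝ, E) y x y (X y) := by
  have hy' : y ∈ (extChartAt 𝓘(ℝ, E) x).source := by simpa using hy
  have aux : ∀ D J : E →L[ℝ] E, D.IsInvertible → D.comp J = ContinuousLinearMap.id ℝ E →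
      ∀ u u' : E, u' = u → D.inverse u' = J u := by
    rintro _ J ⟨L, rfl⟩ h u _ ⟨⟩
    rw [ContinuousLinearMap.inverse_equiv]
    have h2 : L (J u) = u := congrArg (fun T : E →L[ℝ] E => T u) h
    exact (L.symm_apply_eq).2 h2.symm
  have h1 := mfderivWithin_extChartAt_symm_comp_mfderiv_extChartAt' hy'
  have hJ : mfderiv 𝓘(ℝ, E) 𝓘(ℝ, E) (extChartAt 𝓘(ℝ, E) x) y =
      tangentCoordChange 𝓘(ℝ, E) y x y := mfderiv_chartAt_eq_tangentCoordChange hy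
  rw [hJ] at h1
  exact aux _ _ (isInvertible_mfderivWithin_extChartAt_symm
    ((extChartAt 𝓘(ℝ, E) x).map_source hy')) h1 _ _
    (congrArg (fun z => (X z : E)) ((extChartAt 𝓘(ℝ, E) x).left_inv hy'))

/-- The preferred chart at x has identity derivative at x itself, so the outer pullback in the
manifold bracket disappears. -/
theorem mlieBracket_eq_lieBracket (x : M) (X Y : (x : M) → TangentSpace 𝓘(ℝ, E) x) :
    VectorField.mlieBracket 𝓘(ℝ, E) X Y x =
      VectorField.lieBracket ℝ (chartField x X) (chartField x Y) (chartAt E x x) := by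
  have aux : ∀ D : E →L[ℝ] E, (∀ u, D u = u) → ∀ u : E, D.inverse u = u := by
    intro D h u
    have h1 : D = ContinuousLinearMap.id ℝ E := by ext w; exact h w
    rw [h1, ContinuousLinearMap.inverse_id, ContinuousLinearMap.id_apply]
  have hJ : mfderiv 𝓘(ℝ, E) 𝓘(ℝ, E) (extChartAt 𝓘(ℝ, E) x) x =
      tangentCoordChange 𝓘(ℝ, E) x x x :=
    mfderiv_chartAt_eq_tangentCoordChange (mem_chart_source E x)
  have hs : (extChartAt 𝓘(ℝ, E) x).symm ⁻¹' Set.univ ∩ Set.range 𝓘(ℝ, E) = Set.univ := by simp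
  rw [← VectorField.mlieBracketWithin_univ, VectorField.mlieBracketWithin_apply, hs, hJ]
  refine (aux _ (fun u => tangentCoordChange_self (I := 𝓘(ℝ, E)) (mem_extChartAt_source x)) _).trans
    ?_
  exact congrFun (VectorField.lieBracketWithin_univ (𝕜 := ℝ) (V := chartField x X)
    (W := chartField x Y)) _

end Charts

/-! ### Involutivity and complete integrability on the manifold -/

section Main

variable {E : Type*} [NormedAddCommGroup E] [NormedSpace ℝ E] [FiniteDimensional ℝ E]
variable {M : Type*} [TopologicalSpace M] [ChartedSpace E M] [IsManifold 𝓘(ℝ, E) ∞ M]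
variable {F : TangentBundle 𝓘(ℝ, E) M → ℝ} (hF : IsFinsler F) {k : ℝ} {U : Set M} (hU : IsOpen U)
    (hwd : ∀ x ∈ U, NullityWellDefinedAt F k x)
include hF hU hwd

omit hU in
/-- In a chart the nullity spaces over `U` do not depend on the direction. -/
theorem IsFinsler.isNull_iff (x : M) :
    ∀ y ∈ (chartAt E x).target ∩ (chartAt E x).symm ⁻¹' U, ∀ v : E, v ≠ 0 → ∀ a,
      modHH (localExpr F x) k (y, v) a = 0 ↔ IsNull (localExpr F x) k y a := by
  intro y hy v hv a
  refine ⟨fun h => ?_, fun h => h v hv⟩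
  have e := (chartAt E x).right_inv hy.1
  rw [← e] at h ⊢
  exact hF.isNull_of_wellDefined ((chartAt E x).map_target hy.1) (hwd _ hy.2) hv h

theorem IsFinsler.isNull_lieBracket (x : M) {y : E}
    (hy : y ∈ (chartAt E x).target ∩ (chartAt E x).symm ⁻¹' U) {X Y : E → E}
    (hX : DifferentiableAt ℝ X y) (hXn : ∀ᶠ z in 𝓝 y, IsNull (localExpr F x) k z (X z))
    (hY : DifferentiableAt ℝ Y y) (hYn : ∀ᶠ z in 𝓝 y, IsNull (localExpr F x) k z (Y z)) :
    IsNull (localExpr F x) k y (VectorField.lieBracket ℝ X Y y) :=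
  ((hF.isLocalFinsler x).mono ((chartAt E x).isOpen_inter_preimage_symm hU)
    Set.inter_subset_left).isNull_lieBracket
    (fun z hz v hv a h => (hF.isNull_iff hwd x z hz v hv a).1 h) hy hX hXn hY hYn

theorem IsFinsler.isInvolutiveOn_nullitySpace : IsInvolutiveOn (nullitySpace F k) U := by
  intro V hV hVU X Y hX hY hXn hYn x hx
  have hxs := mem_chart_source E x
  have key : ∀ X : (x : M) → TangentSpace 𝓘(ℝ, E) x,
      ContMDiffOn 𝓘(ℝ, E) 𝓘(ℝ, E).tangent ∞
        (fun x => (⟨x, X x⟩ : TangentBundle 𝓘(ℝ, E) M)) V →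
      (∀ x ∈ V, X x ∈ nullitySpace F k x) →
      DifferentiableAt ℝ (chartField x X) (chartAt E x x) ∧
      ∀ᶠ z in 𝓝 (chartAt E x x), IsNull (localExpr F x) k z (chartField x X z) := by
    intro X hX hXn
    constructor
    · have h1 := ((hX.contMDiffAt (hV.mem_nhds hx)).mdifferentiableAt
        (by simp)).mdifferentiableWithinAt (s := Set.univ)
      have h2 : DifferentiableWithinAt ℝ (chartField x X) _ _ :=
        h1.differentiableWithinAt_mpullbackWithin_vectorField
      exact (h2.mono fun _ _ => by simp).differentiableAt univ_mem
    · have h3 : (chartAt E x).target ∩ (chartAt E x).symm ⁻¹' V ∈ 𝓝 (chartAt E x x) :=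
        ((chartAt E x).isOpen_inter_preimage_symm hV).mem_nhds
          ⟨mem_chart_target E x, by rwa [Set.mem_preimage, (chartAt E x).left_inv hxs]⟩
      filter_upwards [h3] with z hz
      have hs := (chartAt E x).map_target hz.1
      have h4 := chartField_apply hs X
      have h5 := (hF.mem_nullitySpace_iff hs _).1 (hXn _ hz.2)
      rw [(chartAt E x).right_inv hz.1] at h4 h5
      rw [h4]
      exact h5
  obtain ⟨dX, nX⟩ := key X hX hXn
  obtain ⟨dY, nY⟩ := key Y hY hYn
  have h := hF.isNull_lieBracket hU hwd x
    ⟨mem_chart_target E x, by rw [Set.mem_preimage, (chartAt E x).left_inv hxs]; exact hVU hx⟩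
    dX nX dY nY
  refine (hF.mem_nullitySpace_iff hxs _).2 ?_
  rw [mlieBracket_eq_lieBracket, tangentCoordChange_self (by simp)]
  exact h

theorem IsFinsler.isCompletelyIntegrableOn_nullitySpace
    (hconst : ∀ x ∈ U, ∀ y ∈ U, nullityIndex F k x = nullityIndex F k y) :
    IsCompletelyIntegrableOn (nullitySpace F k) U := by
  intro x hx
  have hxs := mem_chart_source E x
  let O := (chartAt E x).target ∩ (chartAt E x).symm ⁻¹' U
  have hO : IsOpen O := (chartAt E x).isOpen_inter_preimage_symm hU
  have hxO : chartAt E x x ∈ O :=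
    ⟨mem_chart_target E x, by rwa [Set.mem_preimage, (chartAt E x).left_inv hxs]⟩
  suffices ∃ (Φ : OpenPartialHomeomorph E E) (W : Submodule ℝ E), chartAt E x x ∈ Φ.source ∧
      Φ.source ⊆ O ∧ ContDiffOn ℝ ∞ Φ Φ.source ∧ ContDiffOn ℝ ∞ Φ.symm Φ.target ∧
      ∀ y ∈ Φ.source, ∀ w, IsNull (localExpr F x) k y w ↔ fderiv ℝ Φ y w ∈ W by
    obtain ⟨Φ, W, hxΦ, hΦO, hΦ, hΦ', hW⟩ := this
    refine ⟨(chartAt E x).trans Φ, trans_mem_maximalAtlas x Φ hΦ hΦ', ?_, ?_, W, ?_⟩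
    · rw [OpenPartialHomeomorph.trans_source]
      exact ⟨hxs, hxΦ⟩
    · intro y hy
      rw [OpenPartialHomeomorph.trans_source] at hy
      have h1 := (hΦO hy.2).2
      rwa [Set.mem_preimage, (chartAt E x).left_inv hy.1] at h1
    · intro y hy w
      rw [mfderiv_trans_chartAt hΦ hy]
      rw [OpenPartialHomeomorph.trans_source] at hy
      exact (hF.mem_nullitySpace_iff hy.1 w).trans (hW _ hy.2 _)
  -- In dimension zero there is no nonzero direction and nullity is vacuous. Otherwise one constant
  -- direction v serves over the whole chart domain and presents the nullity spaces as kernels.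
  cases subsingleton_or_nontrivial E with
  | inl hE =>
    refine ⟨OpenPartialHomeomorph.ofSet O hO, ⊤, hxO, subset_rfl, contDiff_id.contDiffOn,
      contDiff_id.contDiffOn, fun y _ w => ?_⟩
    exact iff_of_true (fun v hv => (hv (Subsingleton.elim _ _)).elim) trivial
  | inr hE =>
    obtain ⟨v, hv⟩ := exists_ne (0 : E)
    have hnull : ∀ y ∈ O, ∀ a, modHH (localExpr F x) k (y, v) a = 0 ↔
        IsNull (localExpr F x) k y a := fun y hy a => hF.isNull_iff hwd x y hy v hv a
    have hdim : ∀ y ∈ O, Module.finrank ℝ (LinearMap.ker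
        (modHH (localExpr F x) k (y, v) : E →ₗ[ℝ] E →L[ℝ] E →L[ℝ] E)) =
        nullityIndex F k x := by
      intro y hy
      have hs := (chartAt E x).map_target hy.1
      rw [hconst x hx _ hy.2]
      let e := coordChangeEquiv (mem_chart_source E ((chartAt E x).symm y)) hs
      -- Constancy of the index concerns spaces written in varying preferred charts; the coordinate
      -- isomorphism carries it to the kernels in the chart at x.
      have aux : ∀ D K : Submodule ℝ E, (∀ a, e.symm a ∈ D ↔ a ∈ K) →
          Module.finrank ℝ K = Module.finrank ℝ D := by
        intro D K h
        have h1 : K = D.map (e.toLinearEquiv : E →ₗ[ℝ] E) := by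
          ext a
          rw [Submodule.mem_map_equiv, ← h]
          rfl
        rw [h1]
        exact LinearEquiv.finrank_map_eq e.toLinearEquiv D
      refine aux (nullitySpace F k ((chartAt E x).symm y)) _ fun a => ?_
      have h2 := hF.mem_nullitySpace_iff (k := k) hs (e.symm a)
      have h3 : tangentCoordChange 𝓘(ℝ, E) ((chartAt E x).symm y) x ((chartAt E x).symm y)
        (e.symm a) = a := e.apply_symm_apply a
      rw [(chartAt E x).right_inv hy.1, h3, ← hnull y hy] at h2
      exact h2
    obtain ⟨Φ, W, h1, h2, h3, h4, h5⟩ := exists_chart_of_involutive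
      (A := fun y => modHH (localExpr F x) k (y, v)) hO
      ((hF.isLocalFinsler x).contDiffOn_modHH.comp (f := fun y : E => (y, v))
        (contDiff_id.prodMk contDiff_const).contDiffOn
        fun y hy => mem_slit.2 ⟨hy.1, hv⟩) hxO
      (fun y hy => (hdim y hy).trans (hdim _ hxO).symm)
      (fun y hy X Y hX hY hXn hYn => (hnull y hy _).2 (hF.isNull_lieBracket hU hwd x hy
        hX (by filter_upwards [hXn, hO.mem_nhds hy] with z h1 h2 using (hnull z h2 _).1 h1)
        hY (by filter_upwards [hYn, hO.mem_nhds hy] with z h1 h2 using (hnull z h2 _).1 h1)))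
    exact ⟨Φ, W, h1, h2, h3, h4, fun y hy w => (hnull y (h2 hy) w).symm.trans (h5 y hy w)⟩

end Main

end FinslerNullity

end

theorem theorem1 {E : Type*} [NormedAddCommGroup E] [NormedSpace ℝ E] [FiniteDimensional ℝ E]
    {M : Type*} [TopologicalSpace M] [ChartedSpace E M] [IsManifold 𝓘(ℝ, E) ∞ M]
    (F : TangentBundle 𝓘(ℝ, E) M → ℝ) (hF : FinslerNullity.IsFinsler F)
    (k : ℝ) (hk : 0 ≤ k) (U : Set M) (hU : IsOpen U)
    (hwd : ∀ x ∈ U, FinslerNullity.NullityWellDefinedAt F k x)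
    (hconst : ∀ x ∈ U, ∀ y ∈ U,
      FinslerNullity.nullityIndex F k x = FinslerNullity.nullityIndex F k y) :
    FinslerNullity.IsInvolutiveOn (FinslerNullity.nullitySpace F k) U ∧
      FinslerNullity.IsCompletelyIntegrableOn (FinslerNullity.nullitySpace F k) U := by
  exact ⟨hF.isInvolutiveOn_nullitySpace hU hwd,
    hF.isCompletelyIntegrableOn_nullitySpace hU hwd hconst⟩
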